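/- Let $(V,g)$ be a $4$-dimensional Euclidean vector space and $S^3=\{x\in V: g(x,x)=1\}$ the round sphere with Levi-Civita connection $\nabla$. A (smooth, symmetric, rank two) tensor $K$ on $S^3$ is a *Killing tensor* if $\nabla_{(\gamma}K_{\alpha\beta)}=0$. Viewed as an endomorphism field, it is *integrable* if its Nijenhuis torsion $N^{\alpha}{}_{\beta\gamma}=K^{\alpha}{}_{\delta}\nabla_{[\gamma}K^{\delta}{}_{\beta]}+\nabla_{\delta}K^{\alpha}{}_{[\gamma}K^{\delta}{}_{\beta]}$ satisfies $N^{\delta}{}_{[\beta\gamma}g_{\alpha]\delta}=0$, $N^{\delta}{}_{[\beta\gamma}K_{\alpha]\delta}=0$ and $N^{\delta}{}_{[\beta\gamma}K_{\alpha]\varepsilon}K^{\varepsilon}{}_{\delta}=0$. A *Stäckel system* on $S^3$ is a $3$-dimensional vector space of integrable Killing tensors that mutually commute as endomorphisms. An *algebraic curvature tensor* on $V$ is a tensor $R_{a_1b_1a_2b_2}$ with the symmetries of a Riemann tensor (antisymmetry in each index pair, pair symmetry, Bianchi identity); it is the algebraic curvature tensor of $K$ if $K_x(v,w)=R_{a_1b_1a_2b_2}x^{a_1}x^{a_2}v^{b_1}w^{b_2}$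 for $x\in S^3$, $v,w\in T_xS^3$. It is *diagonal* in an orthonormal basis $e_0,e_1,e_2,e_3$ of $V$ if $R_{ijkl}=0$ unless $\{i,j\}=\{k,l\}$. To a diagonal $R$ one associates, for $(\alpha,\beta,\gamma)$ cyclic permutations of $(1,2,3)$, $s=2\sum_\alpha(R_{0\alpha0\alpha}+R_{\beta\gamma\beta\gamma})$, $w_\alpha=\frac12(R_{0\alpha0\alpha}+R_{\beta\gamma\beta\gamma})-\frac s{12}$, $t_\alpha=\frac12(R_{0\alpha0\alpha}-R_{\beta\gamma\beta\gamma})$, and the matrix $$M(R)=\begin{pmatrix}w_2-w_3&-t_3&t_2\\ t_3&w_3-w_1&-t_1\\ -t_2&t_1&w_1-w_2\end{pmatrix}.$$ Let $\mathcal A\cong\mathbb R^5$ be the space of real $3\times3$ matrices whose symmetric part is diagonal and trace free. The *KS-variety* is the projective variety $\{\det M=0\}\subset\mathbb P\mathcal A$; a point $M$ of it is *singular* if the derivative of $\det|_{\mathcal A}$ vanishes at $M$. For a non-singular point $M$ let $n=\pi(M)\in\mathbb P^2$ be its kernel, and put $$\iota(n)=\begin{pmatrix}0&-n_3&n_2\\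 n_3&0&-n_1\\ -n_2&n_1&0\end{pmatrix},\qquad \nu(n)=\begin{pmatrix}n_2^2-n_3^2&-n_1n_2&n_3n_1\\ n_1n_2&n_3^2-n_1^2&-n_2n_3\\ -n_3n_1&n_2n_3&n_1^2-n_2^2\end{pmatrix}.$$ A *Stäckel line* is the projective line through the points $M$, $\iota(\pi(M))$ and $\nu(\pi(M))$ for some non-singular point $M$ of the KS-variety. We identify a projective line with the $2$-dimensional space of matrices it consists of (including $0$, the matrix of the metric). **Corollary.** Stäckel lines in the KS-variety correspond to Stäckel systems on $S^3$. More precisely: 1. For every orthonormal basis of $V$ and every Stäckel line $L$, the preimage of $L$ under the map from the integrable Killing tensors with algebraic curvature tensor diagonal in this basis to the matrices, $K\mapsto M(R)$, is a Stäckel system. 2. For every orthonormal basis of $V$, every Stäckel system all of whose members have an algebraic curvature tensor that is diagonal in this basis is the preimage, as in 1, of exactly one Stäckel line. 3. The Killing tensors in any Stäckel system on $S^3$ have simultaneously diagonalisable algebraic curvature tensors: there is an orthonormal basis of $V$ in which the algebraic curvature tensors of all its members are diagonal. -/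

import Mathlib

open Module
open scoped Manifold ContDiff

noncomputable section

namespace KSVariety

section Sphere

variable {V : Type*} [NormedAddCommGroup V] [InnerProductSpace ℝ V]

/-! ### Tensor fields on the unit sphere of a Euclidean space

The tangent space of the unit sphere at `x` is the orthogonal complement of `x`. An endomorphism
field on the sphere is given by the endomorphisms `K x` of the ambient space which extend the
endomorphisms of the tangent spaces by zero on the normal line spanned by `x`. -/

/-- Families of endomorphisms of the ambient space, indexed by the unit sphere. -/
abbrev EndField (V : Type*) [NormedAddCommGroup V] [InnerProductSpace ℝ V] : Type _ :=
  Metric.sphere (0 : V) 1 → (V →L[ℝ] V)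

/-- `v` is tangent to the unit sphere at `x`. -/
def IsTangent (x : Metric.sphere (0 : V) 1) (v : V) : Prop := inner ℝ (x : V) v = 0

/-- The orthogonal projection of the ambient space onto the tangent space of the sphere at `x`. -/
def tangentProj (x : Metric.sphere (0 : V) 1) : V →L[ℝ] V :=
  ContinuousLinearMap.id ℝ V - (innerSL ℝ (x : V)).smulRight (x : V)

/-- A smooth symmetric endomorphism field on the three-dimensional unit sphere (equivalently, by
means of the metric, a smooth symmetric tensor `K(v, w) = ⟪K v, w⟫` of rank two). -/
structure IsSymField [Fact (finrank ℝ V = 3 + 1)] (K : EndField V) : Prop where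
  smooth : ContMDiff (𝓡 3) 𝓘(ℝ, V →L[ℝ] V) ∞ K
  symm : ∀ x v w, inner ℝ (K x v) w = inner ℝ v (K x w)
  normal : ∀ x : Metric.sphere (0 : V) 1, K x (x : V) = 0

open Classical in
/-- The extension of a field to the ambient space, constant along rays (and `0` at the origin). -/
def radialExt (K : EndField V) (y : V) : V →L[ℝ] V :=
  if h : y = 0 then 0
  else K ⟨‖y‖⁻¹ • y, by
    rw [mem_sphere_zero_iff_norm, norm_smul, norm_inv, norm_norm,
      inv_mul_cancel₀ (norm_ne_zero_iff.mpr h)]⟩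

/-- The Levi-Civita derivative `∇_u K` at `x` of an endomorphism field of the sphere, for `u` tangent
at `x`. The Levi-Civita connection of a submanifold of a Euclidean space is the tangential part of
the ambient derivative, so that `(∇_u K) v` is, for tangent `v`, the tangential part of
`(D_u K) v`. -/
def covDeriv (K : EndField V) (x : Metric.sphere (0 : V) 1) (u : V) : V →L[ℝ] V :=
  tangentProj x ∘L (fderiv ℝ (radialExt K) (x : V) u) ∘L tangentProj x

/-- The Killing equation `∇_(γ K_αβ) = 0` (the complete symmetrisation of a tensor that is symmetric
in `α, β` is, up to a factor, the cyclic sum). -/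
def KillingEq (K : EndField V) : Prop :=
  ∀ (x : Metric.sphere (0 : V) 1) (u v w : V), IsTangent x u → IsTangent x v → IsTangent x w →
    inner ℝ (covDeriv K x u v) w + inner ℝ (covDeriv K x v w) u
      + inner ℝ (covDeriv K x w u) v = 0

/-- Killing tensors (of rank two) on the three-sphere. -/
def IsKilling [Fact (finrank ℝ V = 3 + 1)] (K : EndField V) : Prop := IsSymField K ∧ KillingEq K

/-- The Nijenhuis torsion
`N^α_{βγ} = K^α_δ ∇_[γ K^δ_β] + ∇_δ K^α_[γ K^δ_β]`, contracted with `u^β v^γ`. -/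
def nijenhuis (K : EndField V) (x : Metric.sphere (0 : V) 1) (u v : V) : V :=
  K x (covDeriv K x v u - covDeriv K x u v) + (covDeriv K x (K x u) v - covDeriv K x (K x v) u)

/-- The Nijenhuis integrability conditions
`N^δ_[βγ g_α]δ = 0`, `N^δ_[βγ K_α]δ = 0`, `N^δ_[βγ K_α]ε K^ε_δ = 0`
(the torsion is antisymmetric, so complete antisymmetrisation is, up to a factor, a cyclic sum). -/
def IsIntegrable (K : EndField V) : Prop :=
  ∀ (x : Metric.sphere (0 : V) 1) (u v w : V), IsTangent x u → IsTangent x v → IsTangent x w →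
    (inner ℝ (nijenhuis K x u v) w + inner ℝ (nijenhuis K x v w) u
      + inner ℝ (nijenhuis K x w u) v = 0) ∧
    (inner ℝ (nijenhuis K x u v) (K x w) + inner ℝ (nijenhuis K x v w) (K x u)
      + inner ℝ (nijenhuis K x w u) (K x v) = 0) ∧
    (inner ℝ (nijenhuis K x u v) (K x (K x w)) + inner ℝ (nijenhuis K x v w) (K x (K x u))
      + inner ℝ (nijenhuis K x w u) (K x (K x v)) = 0)

/-- A Stäckel system on the three-sphere: a three-dimensional vector space of mutually commuting
integrable Killing tensors. -/
structure IsStaeckelSystem [Fact (finrank ℝ V = 3 + 1)] (S : Submodule ℝ (EndField V)) : Prop where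
  finrank_eq : finrank ℝ S = 3
  killing : ∀ K ∈ S, IsKilling K
  integrable : ∀ K ∈ S, IsIntegrable K
  commute : ∀ K ∈ S, ∀ L ∈ S, ∀ x, K x ∘L L x = L x ∘L K x

/-! ### Algebraic curvature tensors -/

/-- Four-fold covariant tensors on `V`. -/
abbrev Tensor4 (V : Type*) [NormedAddCommGroup V] [InnerProductSpace ℝ V] : Type _ :=
  V →ₗ[ℝ] V →ₗ[ℝ] V →ₗ[ℝ] V →ₗ[ℝ] ℝ

/-- Algebraic curvature tensors. -/
structure IsAlgCurv (R : Tensor4 V) : Prop where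
  antisymm_left : ∀ a b c d, R b a c d = - R a b c d
  antisymm_right : ∀ a b c d, R a b d c = - R a b c d
  pair_symm : ∀ a b c d, R c d a b = R a b c d
  bianchi : ∀ a b c d, R a b c d + R a c d b + R a d b c = 0

/-- `R` is an algebraic curvature tensor of the tensor field `K`:
`K_x(v, w) = R_{a₁ b₁ a₂ b₂} x^{a₁} x^{a₂} v^{b₁} w^{b₂}` for tangent vectors `v, w` at `x`
(this determines `R`). -/
def IsCurvOf (K : EndField V) (R : Tensor4 V) : Prop :=
  IsAlgCurv R ∧ ∀ (x : Metric.sphere (0 : V) 1) (v w : V), IsTangent x v → IsTangent x w →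
    inner ℝ (K x v) w = R x v x w

/-- `R` is diagonal in the orthonormal basis `e`, i.e. it is diagonal as an endomorphism of `Λ²V`
with respect to the basis `e i ∧ e j`, `i < j`. -/
def IsDiagonal (e : OrthonormalBasis (Fin 4) ℝ V) (R : Tensor4 V) : Prop :=
  ∀ i j k l : Fin 4, ({i, j} : Set (Fin 4)) ≠ {k, l} → R (e i) (e j) (e k) (e l) = 0

end Sphere

/-! ### The Killing-Stäckel variety -/

/-- The space of `3 × 3` matrices whose symmetric part is diagonal and trace free. -/
def ksSpace : Set (Matrix (Fin 3) (Fin 3) ℝ) :=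
  {M | (∀ i j, i ≠ j → M i j = - M j i) ∧ M.trace = 0}

/-- The Killing-Stäckel matrices; the points of the (projective) Killing-Stäckel variety are the
lines spanned by the nonzero ones. -/
def ksCone : Set (Matrix (Fin 3) (Fin 3) ℝ) := {M | M ∈ ksSpace ∧ M.det = 0}

/-- `M` represents a non-singular point of the Killing-Stäckel variety: `M` is a nonzero
Killing-Stäckel matrix at which the derivative of the restriction of `det` to `ksSpace` does not
vanish. -/
def IsNonsingularPoint (M : Matrix (Fin 3) (Fin 3) ℝ) : Prop :=
  M ∈ ksCone ∧ M ≠ 0 ∧ ∃ A ∈ ksSpace, deriv (fun t : ℝ => (M + t • A).det) 0 ≠ 0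

/-- The linear embedding `ι` of the projective plane, in homogeneous coordinates. -/
def iota (n : Fin 3 → ℝ) : Matrix (Fin 3) (Fin 3) ℝ :=
  !![0, -n 2, n 1;
     n 2, 0, -n 0;
     -n 1, n 0, 0]

/-- The embedding `ν` of the projective plane, in homogeneous coordinates. -/
def nu (n : Fin 3 → ℝ) : Matrix (Fin 3) (Fin 3) ℝ :=
  !![n 1 ^ 2 - n 2 ^ 2, -(n 0 * n 1), n 2 * n 0;
     n 0 * n 1, n 2 ^ 2 - n 0 ^ 2, -(n 1 * n 2);
     -(n 2 * n 0), n 1 * n 2, n 0 ^ 2 - n 1 ^ 2]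

/-- Stäckel lines: the projective lines through `M`, `ι(π(M))` and `ν(π(M))` for a non-singular point
`M` of the Killing-Stäckel variety, where `π(M) = (n₁ : n₂ : n₃)` is the kernel of `M`. A projective
line is given by the two-dimensional space of matrices that it consists of. -/
def IsStaeckelLine (L : Submodule ℝ (Matrix (Fin 3) (Fin 3) ℝ)) : Prop :=
  ∃ (M : Matrix (Fin 3) (Fin 3) ℝ) (n : Fin 3 → ℝ), IsNonsingularPoint M ∧
    LinearMap.ker M.mulVecLin = Submodule.span ℝ {n} ∧
    L = Submodule.span ℝ {M, iota n, nu n}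

section Correspondence

variable {V : Type*} [NormedAddCommGroup V] [InnerProductSpace ℝ V]

/-- The diagonal component `R_{ijij}` in the basis `e`. -/
def diagComp (e : OrthonormalBasis (Fin 4) ℝ V) (R : Tensor4 V) (i j : Fin 4) : ℝ :=
  R (e i) (e j) (e i) (e j)

/-- The scalar curvature `s` of a diagonal algebraic curvature tensor. -/
def scal (e : OrthonormalBasis (Fin 4) ℝ V) (R : Tensor4 V) : ℝ :=
  2 * (diagComp e R 0 1 + diagComp e R 2 3 + diagComp e R 0 2 + diagComp e R 3 1
    + diagComp e R 0 3 + diagComp e R 1 2)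

/-- The parameter `w_α = (R_{0α0α} + R_{βγβγ}) / 2 - s / 12`. -/
def wPar (e : OrthonormalBasis (Fin 4) ℝ V) (R : Tensor4 V) (α β γ : Fin 4) : ℝ :=
  (diagComp e R 0 α + diagComp e R β γ) / 2 - scal e R / 12

/-- The parameter `t_α = (R_{0α0α} - R_{βγβγ}) / 2`. -/
def tPar (e : OrthonormalBasis (Fin 4) ℝ V) (R : Tensor4 V) (α β γ : Fin 4) : ℝ :=
  (diagComp e R 0 α - diagComp e R β γ) / 2

/-- The matrix associated with a diagonal algebraic curvature tensor. -/
def ksMatrix (e : OrthonormalBasis (Fin 4) ℝ V) (R : Tensor4 V) : Matrix (Fin 3) (Fin 3) ℝ :=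
  let w₁ := wPar e R 1 2 3
  let w₂ := wPar e R 2 3 1
  let w₃ := wPar e R 3 1 2
  let t₁ := tPar e R 1 2 3
  let t₂ := tPar e R 2 3 1
  let t₃ := tPar e R 3 1 2
  !![w₂ - w₃, -t₃, t₂;
     t₃, w₃ - w₁, -t₁;
     -t₂, t₁, w₁ - w₂]

/-- `K` has an algebraic curvature tensor, and this tensor is diagonal in the basis `e`. -/
def HasDiagonalCurv (e : OrthonormalBasis (Fin 4) ℝ V) (K : EndField V) : Prop :=
  ∃ R : Tensor4 V, IsCurvOf K R ∧ IsDiagonal e R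

/-- The preimage of (the space of matrices) `L` under the map from the integrable Killing tensors with
algebraic curvature tensor diagonal in the basis `e` to the Killing-Stäckel matrices. -/
def ksPreimage [Fact (finrank ℝ V = 3 + 1)] (e : OrthonormalBasis (Fin 4) ℝ V)
    (L : Submodule ℝ (Matrix (Fin 3) (Fin 3) ℝ)) : Set (EndField V) :=
  {K | IsKilling K ∧ IsIntegrable K ∧
    ∃ R : Tensor4 V, IsCurvOf K R ∧ IsDiagonal e R ∧ ksMatrix e R ∈ L}

end Correspondence

end KSVariety

end

open KSVariety

/-! Write `E` for `K` at `x` on the tangent space and `B` for the magnetic part of the curvature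
tensor `R` at `x`, that is `B(v, w) = R(⋆(x ∧ v), x, w)`. It is trace free by the Bianchi identity.

Curvature tensors. A Killing tensor is constant along great circles. Hence its extension to a form
of degree two in the base point is symmetric under exchange of base point and argument, and it
polarises to an algebraic curvature tensor (`IsKilling.exists_isCurvOf`). In a frame the three
integrability conditions are combinations of `tr BE` and `tr BE²` (`IsCurvOf.cyclic_nijenhuis`), so
they amount to the vanishing of these two traces.

Lines to systems. For diagonal `R` the trace `tr BE` vanishes identically and `tr BE² = 2 det M ·
x₀x₁x₂x₃ |x|²` (`diagStarTrace_diagOpMatrix_sq`), so `det M = 0` gives integrability. Two diagonal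
tensors commute iff the rows `εᵀM` and `εᵀM'` are parallel for every sign vector `ε`
(`paramCommute_iff`). Such rows are orthogonal to `ε` because the symmetric part of `M` is diagonal
and trace free, and a common kernel vector `n` makes them orthogonal to `n` as well. The map from
diagonal tensors to matrices kills exactly the multiples of the metric, so a two-dimensional space
of matrices has a three-dimensional preimage.

Diagonalisation. If `R` and `R'` commute, then `tr BE'` is symmetric in the two tensors
(`CurvCommute.magTrace_symm`), so in a Stäckel system the condition `tr BE = 0` polarises to `tr BE'
= 0` for all pairs. As a quartic in `x` this says `W⁺ ⊗ W'⁻ = W'⁺ ⊗ W⁻` and `⟨W⁺, W'⁺⟩ = ⟨W⁻, W'⁻⟩`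
for the two Weyl parts (`weyl_of_magElec_eq_zero`). So modulo one member all Weyl tensors vanish,
and by dimension the system contains a Kulkarni-Nomizu product of the metric with some `h` that is
not a multiple of the identity. Commuting with it makes every member diagonal in an eigenbasis of
`h`, apart from the freedom within eigenspaces, which serves to diagonalise one Ricci tensor
(`IsStaeckelSystem.exists_diagonal`).

Systems to lines. For diagonal tensors the Weyl relation says that the matrices have proportional
diagonals, so their space contains a skew matrix `ι(n)`, and commuting with it forces `n` into every
kernel (`mem_isokernel_of_vecMul_eq`). If the `nᵢ²` are not all equal, the matrices killing `n` are
spanned by `ι(n)` and `ν(n)`. If they are all equal, `ν(n)` is a multiple of `ι(n)`, and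
proportionality of the diagonals leaves `ι(n)` and one further direction, represented by a
non-singular point. -/

namespace KSVariety

/-! ### Coordinates, bivectors and frames adapted to the Hodge star -/

section Algebra

variable {V : Type*} [NormedAddCommGroup V] [InnerProductSpace ℝ V]

theorem eq_sum_coord (e : OrthonormalBasis (Fin 4) ℝ V) (v : V) :
    v = inner ℝ (e 0) v • e 0 + inner ℝ (e 1) v • e 1 + inner ℝ (e 2) v • e 2
      + inner ℝ (e 3) v • e 3 := by
  have h := e.sum_repr' v
  rw [Fin.sum_univ_four] at h
  exact h.symm

theorem inner_eq_coord (e : OrthonormalBasis (Fin 4) ℝ V) (v w : V) :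
    inner ℝ v w = inner ℝ (e 0) v * inner ℝ (e 0) w + inner ℝ (e 1) v * inner ℝ (e 1) w
      + inner ℝ (e 2) v * inner ℝ (e 2) w + inner ℝ (e 3) v * inner ℝ (e 3) w := by
  have h := e.sum_inner_mul_inner v w
  rw [Fin.sum_univ_four] at h
  simp only [real_inner_comm _ v] at h ⊢
  exact h.symm

/-- The component of `v ∧ w` along `e i ∧ e j`. -/
noncomputable def wedgeCoord (e : OrthonormalBasis (Fin 4) ℝ V) (v w : V) (i j : Fin 4) : ℝ :=
  inner ℝ (e i) v * inner ℝ (e j) w - inner ℝ (e j) v * inner ℝ (e i) w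

theorem antisymm_expand (e : OrthonormalBasis (Fin 4) ℝ V) (τ : V →ₗ[ℝ] V →ₗ[ℝ] ℝ)
    (h : ∀ a b, τ b a = - τ a b) (v w : V) :
    τ v w = wedgeCoord e v w 0 1 * τ (e 0) (e 1) + wedgeCoord e v w 0 2 * τ (e 0) (e 2)
      + wedgeCoord e v w 0 3 * τ (e 0) (e 3) + wedgeCoord e v w 2 3 * τ (e 2) (e 3)
      + wedgeCoord e v w 3 1 * τ (e 3) (e 1) + wedgeCoord e v w 1 2 * τ (e 1) (e 2) := by
  have h0 : ∀ a, τ a a = 0 := fun a => by linarith [h a a]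
  have hv := eq_sum_coord e v
  have hw := eq_sum_coord e w
  generalize hv0 : inner ℝ (e 0) v = v0 at *
  generalize hv1 : inner ℝ (e 1) v = v1 at *
  generalize hv2 : inner ℝ (e 2) v = v2 at *
  generalize hv3 : inner ℝ (e 3) v = v3 at *
  generalize hw0 : inner ℝ (e 0) w = w0 at *
  generalize hw1 : inner ℝ (e 1) w = w1 at *
  generalize hw2 : inner ℝ (e 2) w = w2 at *
  generalize hw3 : inner ℝ (e 3) w = w3 at *
  simp only [wedgeCoord, hv0, hv1, hv2, hv3, hw0, hw1, hw2, hw3]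
  rw [hv, hw]
  simp only [map_add, map_smul, LinearMap.add_apply, LinearMap.smul_apply, smul_eq_mul, h0]
  rw [h (e 0) (e 1), h (e 0) (e 2), h (e 0) (e 3), h (e 2) (e 3), h (e 3) (e 1), h (e 1) (e 2)]
  ring

/-- The Hodge star of `x ∧ v`, paired with an alternating form `τ`. -/
noncomputable def starPair (e : OrthonormalBasis (Fin 4) ℝ V) (τ : V →ₗ[ℝ] V →ₗ[ℝ] ℝ) (x v : V) :
    ℝ :=
  wedgeCoord e x v 2 3 * τ (e 0) (e 1) + wedgeCoord e x v 3 1 * τ (e 0) (e 2)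
    + wedgeCoord e x v 1 2 * τ (e 0) (e 3) + wedgeCoord e x v 0 1 * τ (e 2) (e 3)
    + wedgeCoord e x v 0 2 * τ (e 3) (e 1) + wedgeCoord e x v 0 3 * τ (e 1) (e 2)

/-- The trace of a bilinear form does not depend on the orthonormal basis. This moves traces between
a frame that depends on the point and a fixed basis. -/
theorem sum_bilin_orthonormalBasis (e f : OrthonormalBasis (Fin 4) ℝ V)
    (β : V →ₗ[ℝ] V →ₗ[ℝ] ℝ) : ∑ a, β (f a) (f a) = ∑ i, β (e i) (e i) := by
  have h1 : ∀ a, β (f a) (f a)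
      = ∑ i, ∑ j, inner ℝ (e i) (f a) * inner ℝ (f a) (e j) * β (e i) (e j) := by
    intro a
    conv_lhs => rw [← e.sum_repr' (f a)]
    simp only [map_sum, map_smul, LinearMap.sum_apply, LinearMap.smul_apply, smul_eq_mul,
      Finset.mul_sum]
    rw [Finset.sum_comm]
    refine Finset.sum_congr rfl fun i _ => Finset.sum_congr rfl fun j _ => ?_
    rw [real_inner_comm (f a) (e j)]
    ring
  simp only [h1]
  rw [Finset.sum_comm]
  refine Finset.sum_congr rfl fun i _ => ?_
  rw [Finset.sum_comm]
  simp only [← Finset.sum_mul, f.sum_inner_mul_inner, e.inner_eq_ite]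
  simp

/-- At each unit vector there is an orthonormal basis which starts with it and is
adapted to the Hodge star. -/
theorem exists_adapted_basis (e : OrthonormalBasis (Fin 4) ℝ V) {x : V} (hx : ‖x‖ = 1) :
    ∃ f : OrthonormalBasis (Fin 4) ℝ V, f 0 = x ∧
      ∀ τ : V →ₗ[ℝ] V →ₗ[ℝ] ℝ, (∀ a b, τ b a = - τ a b) →
        τ (f 2) (f 3) = starPair e τ x (f 1) ∧ τ (f 3) (f 1) = starPair e τ x (f 2) ∧
          τ (f 1) (f 2) = starPair e τ x (f 3) := by
  have hxx := inner_eq_coord e x x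
  rw [real_inner_self_eq_norm_sq, hx] at hxx
  have hx0 := eq_sum_coord e x
  generalize hx0' : inner ℝ (e 0) x = x0 at *
  generalize hx1' : inner ℝ (e 1) x = x1 at *
  generalize hx2' : inner ℝ (e 2) x = x2 at *
  generalize hx3' : inner ℝ (e 3) x = x3 at *
  -- With `e` identified with the quaternion units `1, i, j, k`, these are the products `x`, `xi`,
  -- `xj`, `xk`. Right multiplication by units gives an oriented orthonormal frame with polynomial
  -- coordinates.
  set q : Fin 4 → V := ![x, -x1 • e 0 + x0 • e 1 + x3 • e 2 + (-x2) • e 3,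
    -x2 • e 0 + (-x3) • e 1 + x0 • e 2 + x1 • e 3,
    -x3 • e 0 + x2 • e 1 + (-x1) • e 2 + x0 • e 3] with hq
  have q0 : q 0 = x := rfl
  have q1 : q 1 = -x1 • e 0 + x0 • e 1 + x3 • e 2 + (-x2) • e 3 := rfl
  have q2 : q 2 = -x2 • e 0 + (-x3) • e 1 + x0 • e 2 + x1 • e 3 := rfl
  have q3 : q 3 = -x3 • e 0 + x2 • e 1 + (-x1) • e 2 + x0 • e 3 := rfl
  have ip : ∀ i j, inner ℝ (e i) (e j) = if i = j then (1 : ℝ) else 0 := fun i j =>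
    e.inner_eq_ite i j
  have hon : Orthonormal ℝ q := by
    rw [orthonormal_iff_ite]
    intro i j
    rw [inner_eq_coord e]
    fin_cases i <;> fin_cases j <;>
      simp [q0, q1, q2, q3, hx0', hx1', hx2', hx3', inner_add_right, inner_smul_right, ip,
        -neg_smul] <;> first | ring1 | linear_combination -hxx
  have hcard : Fintype.card (Fin 4) = finrank ℝ V := (finrank_eq_card_basis e.toBasis).symm
  let b := basisOfOrthonormalOfCardEqFinrank hon hcard
  have hb : ⇑b = q := coe_basisOfOrthonormalOfCardEqFinrank hon hcard
  refine ⟨b.toOrthonormalBasis (by rw [hb]; exact hon), by simp [hb, q0], fun τ hτ => ?_⟩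
  simp only [Basis.coe_toOrthonormalBasis, hb, starPair]
  rw [antisymm_expand e τ hτ (q 2), antisymm_expand e τ hτ (q 3), antisymm_expand e τ hτ (q 1)]
  refine ⟨?_, ?_, ?_⟩ <;>
    simp [wedgeCoord, q1, q2, q3, hx0', hx1', hx2', hx3', inner_add_right, inner_smul_right, ip,
      -neg_smul] <;> ring

end Algebra

end KSVariety

namespace KSVariety

/-! ### Covariant derivative of a field that has a curvature tensor -/

section Curvature

variable {V : Type*} [NormedAddCommGroup V] [InnerProductSpace ℝ V]

namespace IsAlgCurv

variable {R : Tensor4 V}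

theorem self_left (hR : IsAlgCurv R) (a c d : V) : R a a c d = 0 := by
  linarith [hR.antisymm_left a a c d]

theorem self_right (hR : IsAlgCurv R) (a b c : V) : R a b c c = 0 := by
  linarith [hR.antisymm_right a b c c]

theorem sectional_symm (hR : IsAlgCurv R) (x v w : V) : R x v x w = R x w x v :=
  hR.pair_symm x w x v

end IsAlgCurv

theorem isTangent_tangentProj (x : Metric.sphere (0 : V) 1) (v : V) :
    IsTangent x (tangentProj x v) := by
  have hx : inner ℝ (x : V) (x : V) = (1 : ℝ) := by
    rw [real_inner_self_eq_norm_sq, norm_eq_of_mem_sphere x, one_pow]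
  simp [IsTangent, tangentProj, inner_sub_right, inner_smul_right]

theorem tangentProj_apply (x : Metric.sphere (0 : V) 1) (v : V) :
    tangentProj x v = v - inner ℝ (x : V) v • (x : V) := by
  simp [tangentProj]

theorem tangentProj_of_isTangent {x : Metric.sphere (0 : V) 1} {v : V} (hv : IsTangent x v) :
    tangentProj x v = v := by
  rw [tangentProj_apply, show inner ℝ (x : V) v = (0 : ℝ) from hv, zero_smul, sub_zero]

theorem inner_tangentProj {x : Metric.sphere (0 : V) 1} {w : V} (hw : IsTangent x w) (v : V) :
    inner ℝ (tangentProj x v) w = (inner ℝ v w : ℝ) := by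
  rw [tangentProj_apply, inner_sub_left, inner_smul_left,
    show inner ℝ (x : V) w = (0 : ℝ) from hw, mul_zero, sub_zero]

theorem radialExt_of_ne_zero (K : EndField V) {y : V} (hy : y ≠ 0)
    (x : Metric.sphere (0 : V) 1) (hx : (x : V) = ‖y‖⁻¹ • y) : radialExt K y = K x := by
  rw [radialExt, dif_neg hy]
  congr 1
  exact Subtype.ext hx.symm

theorem exists_sphere_of_ne_zero {y : V} (hy : y ≠ 0) :
    ∃ x : Metric.sphere (0 : V) 1, (x : V) = ‖y‖⁻¹ • y :=
  ⟨⟨‖y‖⁻¹ • y, by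
    rw [mem_sphere_zero_iff_norm, norm_smul, norm_inv, norm_norm,
      inv_mul_cancel₀ (norm_ne_zero_iff.mpr hy)]⟩, rfl⟩

theorem radialExt_coe (K : EndField V) (x : Metric.sphere (0 : V) 1) : radialExt K x = K x :=
  radialExt_of_ne_zero K (ne_zero_of_mem_unit_sphere x) x (by simp)

section

variable [Fact (finrank ℝ V = 3 + 1)] {K : EndField V}

theorem IsSymField.isTangent (hK : IsSymField K) (x : Metric.sphere (0 : V) 1) (v : V) :
    IsTangent x (K x v) := by
  rw [IsTangent, ← hK.symm, hK.normal, inner_zero_left]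

theorem IsSymField.apply_tangentProj (hK : IsSymField K) (x : Metric.sphere (0 : V) 1) (v : V) :
    K x (tangentProj x v) = K x v := by
  rw [tangentProj_apply, map_sub, map_smul, hK.normal, smul_zero, sub_zero]

/-- The formula which relates a field and its curvature tensor holds for all vectors. -/
theorem IsCurvOf.inner_eq (hK : IsSymField K) {R : Tensor4 V} (hR : IsCurvOf K R)
    (x : Metric.sphere (0 : V) 1) (v w : V) : inner ℝ (K x v) w = R x v x w := by
  have h := hR.2 x (tangentProj x v) (tangentProj x w) (isTangent_tangentProj x v)
    (isTangent_tangentProj x w)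
  rw [hK.apply_tangentProj, hK.symm, hK.apply_tangentProj, ← hK.symm] at h
  rw [h, tangentProj_apply, tangentProj_apply]
  simp [hR.1.self_left, hR.1.self_right]

theorem IsCurvOf.inner_radialExt (hK : IsSymField K) {R : Tensor4 V} (hR : IsCurvOf K R)
    {y : V} (hy : y ≠ 0) (v w : V) :
    inner ℝ (radialExt K y v) w = (‖y‖ ^ 2)⁻¹ * R y v y w := by
  obtain ⟨x, hx⟩ := exists_sphere_of_ne_zero hy
  rw [radialExt_of_ne_zero K hy x hx, hR.inner_eq hK, hx]
  simp
  ring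

/-- The radial extension is `K` composed with the smooth retraction `y ↦ y / ‖y‖` of the punctured
space onto the sphere. -/
theorem IsSymField.differentiableAt_radialExt (hK : IsSymField K) {y : V} (hy : y ≠ 0) :
    DifferentiableAt ℝ (radialExt K) y := by
  let U : TopologicalSpace.Opens V := ⟨{0}ᶜ, isOpen_compl_singleton⟩
  have h1 : ContMDiff 𝓘(ℝ, V) 𝓘(ℝ, V) ∞ (fun z : U => ‖(z : V)‖⁻¹ • (z : V)) := by
    intro z
    have hz : (z : V) ≠ 0 := z.2
    have h2 : ContDiffAt ℝ ∞ (fun z : V => ‖z‖⁻¹ • z) z :=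
      ((contDiffAt_norm ℝ hz).inv (norm_ne_zero_iff.mpr hz)).smul contDiffAt_id
    exact contMDiffAt_subtype_iff.mpr h2.contMDiffAt
  have h3 : ∀ z : U, ‖(z : V)‖⁻¹ • (z : V) ∈ Metric.sphere (0 : V) 1 := fun z => by
    rw [mem_sphere_zero_iff_norm, norm_smul, norm_inv, norm_norm,
      inv_mul_cancel₀ (norm_ne_zero_iff.mpr z.2)]
  have h4 := hK.smooth.comp (ContMDiff.codRestrict_sphere h1 h3)
  have h5 : ContMDiffAt 𝓘(ℝ, V) 𝓘(ℝ, V →L[ℝ] V) ∞ (radialExt K) y := by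
    rw [← contMDiffAt_subtype_iff (U := U) (x := ⟨y, hy⟩)]
    refine (h4 ⟨y, hy⟩).congr_of_eventuallyEq (Filter.Eventually.of_forall fun z => ?_)
    exact radialExt_of_ne_zero K z.2 _ rfl
  exact h5.contDiffAt.differentiableAt (by simp)

theorem hasDerivAt_inner_radialExt_line (hK : IsSymField K) (x : Metric.sphere (0 : V) 1)
    (u v w : V) : HasDerivAt (fun t : ℝ => inner ℝ (radialExt K ((x : V) + t • u) v) w)
      (inner ℝ (fderiv ℝ (radialExt K) (x : V) u v) w) 0 := by
  have h0 : HasDerivAt (fun t : ℝ => (x : V) + t • u) u 0 := by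
    simpa using ((hasDerivAt_id (0 : ℝ)).smul_const u).const_add (x : V)
  have h1 : HasFDerivAt (radialExt K) (fderiv ℝ (radialExt K) (x : V)) ((x : V) + (0 : ℝ) • u) := by
    simpa using (hK.differentiableAt_radialExt (ne_zero_of_mem_unit_sphere x)).hasFDerivAt
  have h2 := h1.comp_hasDerivAt (0 : ℝ) h0
  have h3 := (h2.clm_apply (hasDerivAt_const (0 : ℝ) v)).inner ℝ (hasDerivAt_const (0 : ℝ) w)
  simpa using h3

/-- The covariant derivative in terms of the curvature tensor. -/
theorem IsCurvOf.inner_covDeriv (hK : IsSymField K) {R : Tensor4 V} (hR : IsCurvOf K R)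
    {x : Metric.sphere (0 : V) 1} {u v w : V} (hu : IsTangent x u) (hv : IsTangent x v)
    (hw : IsTangent x w) :
    inner ℝ (covDeriv K x u v) w = R u v x w + R x v u w := by
  have h1 : inner ℝ (covDeriv K x u v) w = (inner ℝ (fderiv ℝ (radialExt K) (x : V) u v) w : ℝ) := by
    simp only [covDeriv, ContinuousLinearMap.comp_apply]
    rw [inner_tangentProj hw, tangentProj_of_isTangent hv]
  rw [h1]
  refine (hasDerivAt_inner_radialExt_line hK x u v w).unique ?_
  have hx : ‖(x : V)‖ = 1 := norm_eq_of_mem_sphere x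
  have hnorm : ∀ t : ℝ, ‖(x : V) + t • u‖ ^ 2 = 1 + t ^ 2 * ‖u‖ ^ 2 := by
    intro t
    rw [norm_add_sq_real, hx, inner_smul_right, show inner ℝ (x : V) u = (0 : ℝ) from hu,
      norm_smul, mul_pow, Real.norm_eq_abs, sq_abs]
    ring
  -- Along `x + t u` with `u ⟂ x` the squared norm is `1 + t² ‖u‖²`, so the normalising factor is
  -- stationary at `t = 0` and the derivative is the linear coefficient of the quadratic polynomial
  -- in `t`.
  have hfun : (fun t : ℝ => inner ℝ (radialExt K ((x : V) + t • u) v) w)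
      = fun t : ℝ => (1 + t ^ 2 * ‖u‖ ^ 2)⁻¹
        * (R x v x w + t * (R u v x w + R x v u w) + t ^ 2 * R u v u w) := by
    funext t
    have hne : (x : V) + t • u ≠ 0 := by
      intro h
      have := hnorm t
      rw [h, norm_zero] at this
      nlinarith [sq_nonneg (t * ‖u‖)]
    rw [hR.inner_radialExt hK hne, hnorm]
    simp
    left
    ring
  rw [hfun]
  have h3 : HasDerivAt (fun t : ℝ => 1 + t ^ 2 * ‖u‖ ^ 2) 0 0 := by
    simpa using (((hasDerivAt_id (0 : ℝ)).pow 2).mul_const (‖u‖ ^ 2)).const_add 1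
  have h4 : HasDerivAt (fun t : ℝ => R x v x w + t * (R u v x w + R x v u w) + t ^ 2 * R u v u w)
      (R u v x w + R x v u w) 0 := by
    simpa using (((hasDerivAt_id (0 : ℝ)).mul_const (R u v x w + R x v u w)).const_add
      (R x v x w)).fun_add (((hasDerivAt_id (0 : ℝ)).pow 2).mul_const (R u v u w))
  have h5 := (h3.fun_inv (by simp)).fun_mul h4
  simpa using h5

end

end Curvature

end KSVariety

namespace KSVariety

/-! ### Killing tensors come from algebraic curvature tensors -/

section Existence

variable {V : Type*} [NormedAddCommGroup V] [InnerProductSpace ℝ V]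

theorem radialExt_zero (K : EndField V) : radialExt K 0 = 0 := by simp [radialExt]

/-- The field `K`, extended to a homogeneous function of degree two on the ambient space. -/
noncomputable def homExt (K : EndField V) (y v w : V) : ℝ :=
  ‖y‖ ^ 2 * inner ℝ (radialExt K y v) w

variable {K : EndField V}

theorem homExt_add_left (y v v' w : V) :
    homExt K y (v + v') w = homExt K y v w + homExt K y v' w := by
  simp [homExt, inner_add_left, mul_add]

theorem homExt_smul_left (y v w : V) (c : ℝ) : homExt K y (c • v) w = c * homExt K y v w := by
  simp [homExt, inner_smul_left]
  ring

theorem homExt_zero (v w : V) : homExt K 0 v w = 0 := by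
  simp [homExt]

theorem homExt_smul_of_pos {c : ℝ} (hc : 0 < c) (y v w : V) :
    homExt K (c • y) v w = c ^ 2 * homExt K y v w := by
  by_cases hy : y = 0
  · simp [hy, homExt_zero]
  obtain ⟨x, hx⟩ := exists_sphere_of_ne_zero hy
  have h : (x : V) = ‖c • y‖⁻¹ • (c • y) := by
    rw [hx, norm_smul, Real.norm_of_nonneg hc.le, smul_smul, mul_inv, mul_right_comm,
      inv_mul_cancel₀ hc.ne', one_mul]
  rw [homExt, homExt, radialExt_of_ne_zero K hy x hx,
    radialExt_of_ne_zero K (smul_ne_zero hc.ne' hy) x h, norm_smul, Real.norm_of_nonneg hc.le]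
  ring

/-- The full polarisation of the biquadratic form `homExt K x v v`. -/
noncomputable def polarExt (K : EndField V) (x y v w : V) : ℝ :=
  (homExt K (v + w) x y - homExt K (v - w) x y) / 4

theorem polarExt_add (x x' y v w : V) :
    polarExt K (x + x') y v w = polarExt K x y v w + polarExt K x' y v w := by
  simp only [polarExt, homExt_add_left]; ring

theorem polarExt_smul (c : ℝ) (x y v w : V) :
    polarExt K (c • x) y v w = c * polarExt K x y v w := by
  simp only [polarExt, homExt_smul_left]; ring

variable [Fact (finrank ℝ V = 3 + 1)]

theorem IsSymField.inner_radialExt_symm (hK : IsSymField K) (y v w : V) :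
    inner ℝ (radialExt K y v) w = (inner ℝ (radialExt K y w) v : ℝ) := by
  by_cases hy : y = 0
  · simp [hy, radialExt_zero]
  · obtain ⟨x, hx⟩ := exists_sphere_of_ne_zero hy
    rw [radialExt_of_ne_zero K hy x hx, hK.symm, real_inner_comm]

theorem IsSymField.radialExt_self (hK : IsSymField K) (y : V) : radialExt K y y = 0 := by
  by_cases hy : y = 0
  · simp [hy]
  · obtain ⟨x, hx⟩ := exists_sphere_of_ne_zero hy
    have h : y = ‖y‖ • (x : V) := by
      rw [hx, smul_smul, mul_inv_cancel₀ (norm_ne_zero_iff.mpr hy), one_smul]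
    rw [radialExt_of_ne_zero K hy x hx]
    nth_rewrite 1 [h]
    rw [map_smul, hK.normal, smul_zero]

/-- A Killing tensor is constant along unit speed geodesics. -/
theorem IsKilling.const_along_geodesic (hK : IsKilling K) {x n : V} (hx : ‖x‖ = 1) (hn : ‖n‖ = 1)
    (hxn : inner ℝ x n = (0 : ℝ)) (t : ℝ) :
    inner ℝ (radialExt K (Real.cos t • x + Real.sin t • n)
      (-Real.sin t • x + Real.cos t • n)) (-Real.sin t • x + Real.cos t • n)
      = (inner ℝ (radialExt K x n) n : ℝ) := by
  obtain ⟨hS, hE⟩ := hK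
  set γ : ℝ → V := fun t => Real.cos t • x + Real.sin t • n with hγ
  set δ : ℝ → V := fun t => -Real.sin t • x + Real.cos t • n with hδ
  have hγ' : ∀ t, HasDerivAt γ (δ t) t := fun t =>
    ((Real.hasDerivAt_cos t).smul_const x).fun_add ((Real.hasDerivAt_sin t).smul_const n)
  have hδ' : ∀ t, HasDerivAt δ (-γ t) t := fun t => by
    have h := ((Real.hasDerivAt_sin t).neg.smul_const x).fun_add
      ((Real.hasDerivAt_cos t).smul_const n)
    have h2 : -γ t = -Real.cos t • x + -Real.sin t • n := by
      simp only [hγ]; module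
    rw [h2]
    exact h
  have hxx : inner ℝ x x = (1 : ℝ) := by rw [real_inner_self_eq_norm_sq, hx, one_pow]
  have hnn : inner ℝ n n = (1 : ℝ) := by rw [real_inner_self_eq_norm_sq, hn, one_pow]
  have hnx : inner ℝ n x = (0 : ℝ) := by rw [real_inner_comm, hxn]
  have hγn : ∀ t, ‖γ t‖ = 1 := fun t => by
    have : ‖γ t‖ ^ 2 = 1 := by
      rw [← real_inner_self_eq_norm_sq]
      simp only [hγ, inner_add_left, inner_add_right, inner_smul_left, inner_smul_right, hxx, hnn,
        hxn, hnx]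
      simp
      linarith [Real.sin_sq_add_cos_sq t]
    nlinarith [norm_nonneg (γ t)]
  have hγδ : ∀ t, inner ℝ (γ t) (δ t) = (0 : ℝ) := fun t => by
    simp only [hγ, hδ, inner_add_left, inner_add_right, inner_smul_left, inner_smul_right, hxx, hnn,
      hxn, hnx]
    simp
    ring
  have hderiv : ∀ t, HasDerivAt (fun t => inner ℝ (radialExt K (γ t) (δ t)) (δ t)) (0 : ℝ) t := by
    intro t
    have hne : γ t ≠ 0 := fun h => by simpa [h] using hγn t
    have h1 := (hS.differentiableAt_radialExt hne).hasFDerivAt.comp_hasDerivAt t (hγ' t)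
    have h2 := (h1.clm_apply (hδ' t)).inner ℝ (hδ' t)
    refine h2.congr_deriv ?_
    let y : Metric.sphere (0 : V) 1 := ⟨γ t, by simpa using hγn t⟩
    have hy : IsTangent y (δ t) := hγδ t
    have h3 := hE y (δ t) (δ t) (δ t) hy hy hy
    have h4 : inner ℝ (covDeriv K y (δ t) (δ t)) (δ t)
        = (inner ℝ (fderiv ℝ (radialExt K) (γ t) (δ t) (δ t)) (δ t) : ℝ) := by
      simp only [covDeriv, ContinuousLinearMap.comp_apply]
      rw [inner_tangentProj hy, tangentProj_of_isTangent hy]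
    -- The acceleration of a great circle is `-γ`, which `K` annihilates. What remains of the
    -- derivative is the Killing equation with three equal arguments.
    simp only [Function.comp_apply, map_neg, inner_neg_right, inner_add_left, hS.radialExt_self,
      neg_zero, inner_zero_left]
    rw [hS.inner_radialExt_symm _ _ (γ t), hS.radialExt_self, inner_zero_left]
    linarith
  have hc := is_const_of_deriv_eq_zero (fun t => (hderiv t).differentiableAt)
    (fun t => (hderiv t).deriv) t 0
  simpa [hγ, hδ] using hc

theorem IsSymField.homExt_symm (hK : IsSymField K) (y v w : V) :
    homExt K y v w = homExt K y w v := by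
  rw [homExt, hK.inner_radialExt_symm, homExt]

theorem IsSymField.homExt_self_left (hK : IsSymField K) (y w : V) : homExt K y y w = 0 := by
  simp [homExt, hK.radialExt_self]

/-- The quadratic form `homExt K y v v` is invariant under unimodular changes of `(y, v)`; in
particular it is symmetric. -/
theorem IsKilling.homExt_swap (hK : IsKilling K) (y v : V) : homExt K y v v = homExt K v y y := by
  have hS := hK.1
  by_cases hy : y = 0
  · simp [hy, homExt]
  by_cases hv : v = 0
  · simp [hv, homExt]
  set c := ‖y‖ with hc
  have hcpos : 0 < c := norm_pos_iff.mpr hy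
  obtain ⟨x, hxn, hyx⟩ : ∃ x : V, ‖x‖ = 1 ∧ y = c • x :=
    ⟨c⁻¹ • y, by rw [norm_smul, norm_inv, norm_norm, inv_mul_cancel₀ hcpos.ne'],
      by rw [smul_smul, mul_inv_cancel₀ hcpos.ne', one_smul]⟩
  have hxx : inner ℝ x x = (1 : ℝ) := by rw [real_inner_self_eq_norm_sq, hxn, one_pow]
  set a : ℝ := inner ℝ x v with ha
  set v' := v - a • x with hv'
  have hxv' : inner ℝ x v' = (0 : ℝ) := by
    rw [hv', inner_sub_right, inner_smul_right, hxx, ← ha]; ring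
  -- If `y` and `v` are parallel, both sides vanish because `K` annihilates the normal direction.
  by_cases h0 : v' = 0
  · have hvx : v = a • x := sub_eq_zero.mp h0
    have hax : a ≠ 0 := fun h => hv (by rw [hvx, h, zero_smul])
    have h1 : v = (a * c⁻¹) • y := by
      rw [hvx, hyx, smul_smul, mul_assoc, inv_mul_cancel₀ hcpos.ne', mul_one]
    have h2 : y = (c * a⁻¹) • v := by
      rw [hvx, smul_smul, mul_assoc, inv_mul_cancel₀ hax, mul_one, hyx]
    have h3 : homExt K y v v = 0 := by
      nth_rewrite 1 [h1]
      rw [homExt_smul_left, hS.homExt_self_left, mul_zero]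
    have h4 : homExt K v y y = 0 := by
      nth_rewrite 1 [h2]
      rw [homExt_smul_left, hS.homExt_self_left, mul_zero]
    rw [h3, h4]
  set b := ‖v'‖ with hb
  have hbpos : 0 < b := norm_pos_iff.mpr h0
  obtain ⟨n, hnn, hxn0, hvab⟩ : ∃ n : V, ‖n‖ = 1 ∧ inner ℝ x n = (0 : ℝ) ∧ v = a • x + b • n :=
    ⟨b⁻¹ • v', by rw [norm_smul, norm_inv, norm_norm, inv_mul_cancel₀ hbpos.ne'],
      by rw [inner_smul_right, hxv', mul_zero],
      by rw [smul_smul, mul_inv_cancel₀ hbpos.ne', one_smul, hv']; abel⟩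
  clear_value a b
  set d := ‖v‖ with hd
  have hdpos : 0 < d := norm_pos_iff.mpr hv
  have hdab : d ^ 2 = a ^ 2 + b ^ 2 := by
    rw [hd, hvab, norm_add_sq_real, norm_smul, norm_smul, inner_smul_left, inner_smul_right, hxn0,
      hxn, hnn, Real.norm_eq_abs, Real.norm_eq_abs, mul_one, mul_one, sq_abs, sq_abs]
    simp
  -- Rotating by the angle of `(a, b)` moves the great circle through `x` with direction `n` to the
  -- point `v / ‖v‖`.
  obtain ⟨θ, hcos, hsin⟩ : ∃ θ : ℝ, Real.cos θ = a / d ∧ Real.sin θ = b / d := by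
    have hz : (⟨a, b⟩ : ℂ) ≠ 0 := fun h => hbpos.ne' (congrArg Complex.im h)
    have hnz : ‖(⟨a, b⟩ : ℂ)‖ = d := by
      rw [Complex.norm_def, Complex.normSq_mk, ← sq, ← sq, ← hdab, Real.sqrt_sq hdpos.le]
    exact ⟨Complex.arg ⟨a, b⟩, by rw [Complex.cos_arg hz, hnz], by rw [Complex.sin_arg, hnz]⟩
  have hgeo := hK.const_along_geodesic hxn hnn hxn0 θ
  set γ := Real.cos θ • x + Real.sin θ • n with hγ
  set δ := -Real.sin θ • x + Real.cos θ • n with hδ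
  have hvγ : v = d • γ := by
    rw [hγ, hcos, hsin, smul_add, smul_smul, smul_smul, mul_div_cancel₀ _ hdpos.ne',
      mul_div_cancel₀ _ hdpos.ne']
    exact hvab
  have hyγ : y = (c * Real.cos θ) • γ + (-c * Real.sin θ) • δ := by
    have : (c * Real.cos θ) • γ + (-c * Real.sin θ) • δ
        = (c * (Real.sin θ ^ 2 + Real.cos θ ^ 2)) • x := by
      rw [hγ, hδ]; module
    rw [this, Real.sin_sq_add_cos_sq, mul_one, hyx]
  have hγn : ‖γ‖ = 1 := by
    have : d = d * ‖γ‖ := by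
      conv_lhs => rw [hd, hvγ, norm_smul, Real.norm_of_nonneg hdpos.le]
    field_simp at this
    exact this.symm
  -- Only the component transverse to the base point contributes. Both sides of the claim thereby
  -- become `b² c²` times the value of the field at one end of the great circle.
  have key : ∀ (z m : V), ‖z‖ = 1 → ∀ p q : ℝ,
      homExt K z (p • z + q • m) (p • z + q • m) = q ^ 2 * inner ℝ (radialExt K z m) m := by
    intro z m hz p q
    rw [homExt_add_left, homExt_smul_left, hS.homExt_self_left, homExt_smul_left, hS.homExt_symm,
      homExt_add_left, homExt_smul_left, hS.homExt_self_left, homExt_smul_left, homExt, hz]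
    ring
  have e1 : homExt K y v v = c ^ 2 * (b ^ 2 * inner ℝ (radialExt K x n) n) := by
    rw [hyx, homExt_smul_of_pos hcpos, hvab, key x n hxn]
  have e2 : homExt K v y y
      = d ^ 2 * ((-c * Real.sin θ) ^ 2 * inner ℝ (radialExt K γ δ) δ) := by
    rw [← key γ δ hγn (c * Real.cos θ), ← hyγ, ← homExt_smul_of_pos hdpos, ← hvγ]
  rw [e1, e2, hgeo, hsin]
  field_simp

theorem IsKilling.polarExt_comm (hK : IsKilling K) (x y v w : V) :
    polarExt K y x v w = polarExt K x y v w := by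
  simp only [polarExt, hK.1.homExt_symm _ y x]

/-- By the exchange symmetry, polarisation in the arguments can be carried out in the base point
instead. This shows in particular that the form is quadratic in the base point. -/
theorem IsKilling.homExt_polar (hK : IsKilling K) (y v w : V) :
    homExt K y v w = (homExt K (v + w) y y - homExt K (v - w) y y) / 4 := by
  rw [hK.homExt_swap (v + w) y, hK.homExt_swap (v - w) y]
  have hneg : v - w = v + (-1 : ℝ) • w := by module
  have h : ∀ a b : V, homExt K y (a + b) (a + b)
      = homExt K y a a + 2 * homExt K y a b + homExt K y b b := fun a b => by
    rw [homExt_add_left, hK.1.homExt_symm, homExt_add_left, hK.1.homExt_symm _ b (a + b),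
      homExt_add_left, hK.1.homExt_symm _ b a]
    ring
  rw [hneg, h, h, homExt_smul_left, hK.1.homExt_symm y v ((-1 : ℝ) • w), homExt_smul_left,
    hK.1.homExt_symm y w ((-1 : ℝ) • w), homExt_smul_left, hK.1.homExt_symm y w v]
  ring

theorem IsKilling.polarExt_swap (hK : IsKilling K) (x y v w : V) :
    polarExt K v w x y = polarExt K x y v w := by
  simp only [polarExt]
  rw [hK.homExt_polar (x + y) v w, hK.homExt_polar (x - y) v w, hK.homExt_polar (v + w) x y,
    hK.homExt_polar (v - w) x y, hK.homExt_swap (v + w) (x + y), hK.homExt_swap (v + w) (x - y),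
    hK.homExt_swap (v - w) (x + y), hK.homExt_swap (v - w) (x - y)]
  rw [hK.homExt_swap (x + y), hK.homExt_swap (x + y), hK.homExt_swap (x - y),
    hK.homExt_swap (x - y)]
  ring

theorem IsKilling.polarExt_diag (hK : IsKilling K) (x v w : V) :
    polarExt K x x v w = homExt K x v w := by
  rw [← hK.polarExt_swap, polarExt, sub_self, homExt_zero, ← two_smul ℝ x,
    homExt_smul_of_pos two_pos]
  ring

/-- The multilinear form `(a, b, c, d) ↦ F a c b d - F b c a d`. -/
noncomputable def tensorOfPolar (F : V → V → V → V → ℝ)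
    (hadd : ∀ x x' y v w, F (x + x') y v w = F x y v w + F x' y v w)
    (hsmul : ∀ (c : ℝ) x y v w, F (c • x) y v w = c * F x y v w)
    (hcomm : ∀ x y v w, F y x v w = F x y v w) (hswap : ∀ x y v w, F v w x y = F x y v w) :
    Tensor4 V :=
  have hadd2 : ∀ x y y' v w, F x (y + y') v w = F x y v w + F x y' v w := fun x y y' v w => by
    rw [← hcomm, hadd, hcomm, hcomm _ y']
  have hsmul2 : ∀ (c : ℝ) x y v w, F x (c • y) v w = c * F x y v w := fun c x y v w => by
    rw [← hcomm, hsmul, hcomm]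
  have hadd3 : ∀ x y v v' w, F x y (v + v') w = F x y v w + F x y v' w := fun x y v v' w => by
    rw [← hswap, hadd, hswap, hswap v']
  have hsmul3 : ∀ (c : ℝ) x y v w, F x y (c • v) w = c * F x y v w := fun c x y v w => by
    rw [← hswap, hsmul, hswap]
  have hadd4 : ∀ x y v w w', F x y v (w + w') = F x y v w + F x y v w' := fun x y v w w' => by
    rw [← hswap, hadd2, hswap, hswap v w']
  have hsmul4 : ∀ (c : ℝ) x y v w, F x y v (c • w) = c * F x y v w := fun c x y v w => by
    rw [← hswap, hsmul2, hswap]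
  LinearMap.mk₂ ℝ (fun a b => LinearMap.mk₂ ℝ (fun c d => 2 / 3 * (F a c b d - F b c a d))
      (fun c c' d => by rw [hadd2, hadd2]; ring)
      (fun r c d => by rw [hsmul2, hsmul2, smul_eq_mul]; ring)
      (fun c d d' => by rw [hadd4, hadd4]; ring)
      (fun r c d => by rw [hsmul4, hsmul4, smul_eq_mul]; ring))
    (fun a a' b => by
      ext c d; simp only [LinearMap.mk₂_apply, LinearMap.add_apply, hadd, hadd3]; ring)
    (fun r a b => by
      ext c d
      simp only [LinearMap.mk₂_apply, LinearMap.smul_apply, hsmul, hsmul3, smul_eq_mul]; ring)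
    (fun a b b' => by
      ext c d; simp only [LinearMap.mk₂_apply, LinearMap.add_apply, hadd, hadd3]; ring)
    (fun r a b => by
      ext c d
      simp only [LinearMap.mk₂_apply, LinearMap.smul_apply, hsmul, hsmul3, smul_eq_mul]; ring)

/-- Every Killing tensor on the sphere comes from an algebraic curvature tensor. -/
theorem IsKilling.exists_isCurvOf (hK : IsKilling K) : ∃ R : Tensor4 V, IsCurvOf K R := by
  have hc := hK.polarExt_comm
  have hs := hK.polarExt_swap
  let R : Tensor4 V := tensorOfPolar (polarExt K) polarExt_add polarExt_smul hc hs
  have hR : ∀ a b c d, R a b c d = 2 / 3 * (polarExt K a c b d - polarExt K b c a d) :=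
    fun a b c d => rfl
  have hc2 : ∀ x y v w, polarExt K x y w v = polarExt K x y v w := fun x y v w => by
    rw [← hs, hc, hs]
  refine ⟨R, ⟨fun a b c d => ?_, fun a b c d => ?_, fun a b c d => ?_, fun a b c d => ?_⟩,
    fun x v w hv hw => ?_⟩
  · rw [hR, hR]; ring
  · rw [hR, hR]
    linarith [hs a c b d, hs b c a d]
  · rw [hR, hR]
    linarith [hc a c d b, hc2 a c b d, hs a d c b, hc b c a d, hc2 b c a d, hc a d c b,
      hc2 d a b c, hs b c d a]
  · rw [hR, hR, hR]
    linarith [hs a c b d, hc d b a c, hs a d c b, hc b c a d, hs a b d c, hc c d a b]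
  · have hx : ‖(x : V)‖ = 1 := norm_eq_of_mem_sphere x
    have h1 : inner ℝ (K x v) w = polarExt K (x : V) x v w := by
      rw [hK.polarExt_diag, homExt, radialExt_coe, hx]; ring
    have h0 : ∀ y, polarExt K y y y w = 0 := fun y => by
      rw [hK.polarExt_diag, hK.1.homExt_self_left]
    have hadd2 : ∀ x y y' v w, polarExt K x (y + y') v w = polarExt K x y v w + polarExt K x y' v w :=
      fun x y y' v w => by rw [← hc, polarExt_add, hc, hc _ y']
    have hadd3 : ∀ x y v v' w, polarExt K x y (v + v') w = polarExt K x y v w + polarExt K x y v' w :=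
      fun x y v v' w => by rw [← hs, polarExt_add, hs, hs v']
    have hsmul2 : ∀ (c : ℝ) x y v w, polarExt K x (c • y) v w = c * polarExt K x y v w :=
      fun c x y v w => by rw [← hc, polarExt_smul, hc]
    have hsmul3 : ∀ (c : ℝ) x y v w, polarExt K x y (c • v) w = c * polarExt K x y v w :=
      fun c x y v w => by rw [← hs, polarExt_smul, hs]
    -- Let `F` be the polarised form. The part of `F(y, y, y, w) = 0` at `y = x ± v` that is linear
    -- in `v` gives `F(x, x, v, w) + 2 F(x, v, x, w) = 0`. So `F(x, x, v, w) - F(v, x, x, w)` is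
    -- `3/2` times `F(x, x, v, w)`, which explains the factor `2 / 3` in the tensor.
    have h2 := h0 (x + v)
    have h3 := h0 (x + (-1 : ℝ) • v)
    simp only [polarExt_add, hadd2, hadd3, polarExt_smul, hsmul2, hsmul3, h0] at h2 h3
    rw [h1, hR, hc x v x w]
    linarith [hc x v x w]

end Existence

end KSVariety

namespace KSVariety

/-! ### Cyclic sums of the Nijenhuis torsion -/

section Torsion

variable {V : Type*} [NormedAddCommGroup V] [InnerProductSpace ℝ V]

/-- The torsion as a bilinear map. -/
noncomputable def nijenhuisBilin (K : EndField V) (x : Metric.sphere (0 : V) 1) :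
    V →ₗ[ℝ] V →ₗ[ℝ] V :=
  LinearMap.mk₂ ℝ (nijenhuis K x)
    (fun u u' v => by simp only [nijenhuis, covDeriv, map_add, ContinuousLinearMap.comp_add,
      ContinuousLinearMap.add_comp, _root_.add_apply, map_sub]; abel)
    (fun c u v => by simp only [nijenhuis, covDeriv, map_smul, ContinuousLinearMap.comp_smul,
      ContinuousLinearMap.smul_comp, _root_.smul_apply, map_sub, smul_sub, smul_add])
    (fun u v v' => by simp only [nijenhuis, covDeriv, map_add, ContinuousLinearMap.comp_add,
      ContinuousLinearMap.add_comp, _root_.add_apply, map_sub]; abel)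
    (fun c u v => by simp only [nijenhuis, covDeriv, map_smul, ContinuousLinearMap.comp_smul,
      ContinuousLinearMap.smul_comp, _root_.smul_apply, map_sub, smul_sub, smul_add])

theorem nijenhuis_antisymm (K : EndField V) (x : Metric.sphere (0 : V) 1) (u v : V) :
    nijenhuis K x v u = - nijenhuis K x u v := by
  simp only [nijenhuis, map_sub]; abel

theorem isTangent_iff_eq_sum {x : Metric.sphere (0 : V) 1} {f : OrthonormalBasis (Fin 4) ℝ V}
    (hf : f 0 = x) {u : V} (hu : IsTangent x u) :
    u = inner ℝ (f 1) u • f 1 + inner ℝ (f 2) u • f 2 + inner ℝ (f 3) u • f 3 := by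
  have h := eq_sum_coord f u
  rwa [hf, show inner ℝ (x : V) u = (0 : ℝ) from hu, zero_smul, zero_add] at h

theorem isTangent_basis {x : Metric.sphere (0 : V) 1} {f : OrthonormalBasis (Fin 4) ℝ V}
    (hf : f 0 = x) {i : Fin 4} (hi : i ≠ 0) : IsTangent x (f i) := by
  rw [IsTangent, ← hf, f.inner_eq_ite, if_neg hi.symm]

/-- A cyclic sum of an alternating map vanishes once it vanishes on a basis. -/
theorem cyclic_sum_eq_zero (A : V →ₗ[ℝ] V →ₗ[ℝ] V) (hA : ∀ u v, A v u = - A u v) (C : V →ₗ[ℝ] V)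
    (f₁ f₂ f₃ : V)
    (h : inner ℝ (A f₁ f₂) (C f₃) + inner ℝ (A f₂ f₃) (C f₁) + inner ℝ (A f₃ f₁) (C f₂) = (0 : ℝ))
    (a b c a' b' c' a'' b'' c'' : ℝ) {u v w : V} (hu : u = a • f₁ + b • f₂ + c • f₃)
    (hv : v = a' • f₁ + b' • f₂ + c' • f₃) (hw : w = a'' • f₁ + b'' • f₂ + c'' • f₃) :
    inner ℝ (A u v) (C w) + inner ℝ (A v w) (C u) + inner ℝ (A w u) (C v) = (0 : ℝ) := by
  have h0 : ∀ u, A u u = 0 := fun u => by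
    have := hA u u
    rwa [eq_neg_iff_add_eq_zero, ← two_smul ℝ, smul_eq_zero_iff_right two_ne_zero] at this
  subst hu hv hw
  simp only [map_add, map_smul, LinearMap.add_apply, LinearMap.smul_apply, inner_add_left,
    inner_add_right, inner_smul_left, inner_smul_right, h0, hA f₁ f₂, hA f₂ f₃, hA f₃ f₁,
    inner_neg_left, RCLike.conj_to_real, smul_add, smul_neg, smul_zero, add_zero,
    zero_add]
  linear_combination (a * (b' * c'' - c' * b'') - b * (a' * c'' - c' * a'')
    + c * (a' * b'' - b' * a'')) * h

variable [Fact (finrank ℝ V = 3 + 1)] {K : EndField V} {R : Tensor4 V}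

theorem IsCurvOf.inner_nijenhuis (hK : IsSymField K) (hR : IsCurvOf K R)
    {x : Metric.sphere (0 : V) 1} {u v z : V} (hu : IsTangent x u) (hv : IsTangent x v)
    (hz : IsTangent x z) :
    inner ℝ (nijenhuis K x u v) z = R v u x (K x z) + R x u v (K x z) - R u v x (K x z)
      - R x v u (K x z) + R (K x u) v x z + R x v (K x u) z - R (K x v) u x z
      - R x u (K x v) z := by
  rw [nijenhuis, inner_add_left, hK.symm, inner_sub_left, inner_sub_left,
    hR.inner_covDeriv hK hv hu (hK.isTangent x z), hR.inner_covDeriv hK hu hv (hK.isTangent x z),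
    hR.inner_covDeriv hK (hK.isTangent x u) hv hz, hR.inner_covDeriv hK (hK.isTangent x v) hu hz]
  ring

theorem IsCurvOf.apply_basis (hK : IsSymField K) (hR : IsCurvOf K R)
    {x : Metric.sphere (0 : V) 1} {f : OrthonormalBasis (Fin 4) ℝ V} (hf : f 0 = x) (v : V) :
    K x v = R x v x (f 1) • f 1 + R x v x (f 2) • f 2 + R x v x (f 3) • f 3 := by
  have h := isTangent_iff_eq_sum hf (hK.isTangent x v)
  simp only [real_inner_comm (K x v), hR.inner_eq hK] at h
  exact h

/-- The trace of `B ∘ K ^ p` at `x`, where `B` is the magnetic part of the curvature tensor. -/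
noncomputable def magTrace (R : Tensor4 V) (f : OrthonormalBasis (Fin 4) ℝ V) (C : V → V) : ℝ :=
  R (f 2) (f 3) (f 0) (C (f 1)) + R (f 3) (f 1) (f 0) (C (f 2)) + R (f 1) (f 2) (f 0) (C (f 3))

set_option linter.unusedSimpArgs false in
set_option maxHeartbeats 1000000 in
-- The covariant derivative of `K` is expressed by the magnetic part `B`, so the cyclic sums are
-- linear in `B` with coefficients polynomial in `E`, and turn out to be combinations of `tr BE` and
-- `tr BE²`. The integrability conditions thus reduce to these two traces.
theorem IsCurvOf.cyclic_nijenhuis (hK : IsSymField K) (hR : IsCurvOf K R)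
    {x : Metric.sphere (0 : V) 1} {f : OrthonormalBasis (Fin 4) ℝ V} (hf : f 0 = x) :
    ∃ c d e : ℝ,
      inner ℝ (nijenhuis K x (f 1) (f 2)) (f 3) + inner ℝ (nijenhuis K x (f 2) (f 3)) (f 1)
        + inner ℝ (nijenhuis K x (f 3) (f 1)) (f 2) = -3 * magTrace R f (K x) ∧
      inner ℝ (nijenhuis K x (f 1) (f 2)) (K x (f 3))
        + inner ℝ (nijenhuis K x (f 2) (f 3)) (K x (f 1))
        + inner ℝ (nijenhuis K x (f 3) (f 1)) (K x (f 2))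
        = -6 * magTrace R f (fun v => K x (K x v)) + c * magTrace R f (K x) ∧
      inner ℝ (nijenhuis K x (f 1) (f 2)) (K x (K x (f 3)))
        + inner ℝ (nijenhuis K x (f 2) (f 3)) (K x (K x (f 1)))
        + inner ℝ (nijenhuis K x (f 3) (f 1)) (K x (K x (f 2)))
        = d * magTrace R f (fun v => K x (K x v)) + e * magTrace R f (K x) := by
  have t1 := isTangent_basis hf (i := 1) (by decide)
  have t2 := isTangent_basis hf (i := 2) (by decide)
  have t3 := isTangent_basis hf (i := 3) (by decide)
  have n12 := fun {z : V} (hz : IsTangent x z) => hR.inner_nijenhuis hK t1 t2 hz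
  have n23 := fun {z : V} (hz : IsTangent x z) => hR.inner_nijenhuis hK t2 t3 hz
  have n31 := fun {z : V} (hz : IsTangent x z) => hR.inner_nijenhuis hK t3 t1 hz
  have k1 := hR.apply_basis hK hf (f 1)
  have k2 := hR.apply_basis hK hf (f 2)
  have k3 := hR.apply_basis hK hf (f 3)
  rw [hR.1.sectional_symm x (f 2) (f 1)] at k2
  rw [hR.1.sectional_symm x (f 3) (f 1), hR.1.sectional_symm x (f 3) (f 2)] at k3
  generalize R x (f 1) x (f 1) = e11 at *
  generalize R x (f 1) x (f 2) = e12 at *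
  generalize R x (f 1) x (f 3) = e13 at *
  generalize R x (f 2) x (f 2) = e22 at *
  generalize R x (f 2) x (f 3) = e23 at *
  generalize R x (f 3) x (f 3) = e33 at *
  -- The Bianchi identity: the magnetic part is trace free.
  have hb : R (f 1) (f 2) x (f 3) = - R (f 2) (f 3) x (f 1) - R (f 3) (f 1) x (f 2) := by
    linarith [hR.1.bianchi x (f 1) (f 2) (f 3), hR.1.pair_symm (f 1) (f 2) x (f 3),
      hR.1.pair_symm (f 2) (f 3) x (f 1), hR.1.pair_symm (f 3) (f 1) x (f 2)]
  have hp : ∀ i j k, R x (f i) (f j) (f k) = R (f j) (f k) x (f i) := fun i j k =>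
    hR.1.pair_symm _ _ _ _
  have p11 : ∀ i v, R (f i) (f i) x v = 0 := fun i v => hR.1.self_left _ _ _
  have p21 : ∀ v, R (f 2) (f 1) x v = - R (f 1) (f 2) x v := fun v => hR.1.antisymm_left _ _ _ _
  have p32 : ∀ v, R (f 3) (f 2) x v = - R (f 2) (f 3) x v := fun v => hR.1.antisymm_left _ _ _ _
  have p13 : ∀ v, R (f 1) (f 3) x v = - R (f 3) (f 1) x v := fun v => hR.1.antisymm_left _ _ _ _
  obtain ⟨b11, q11⟩ : ∃ r, R (f 2) (f 3) x (f 1) = r := ⟨_, rfl⟩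
  obtain ⟨b12, q12⟩ : ∃ r, R (f 2) (f 3) x (f 2) = r := ⟨_, rfl⟩
  obtain ⟨b13, q13⟩ : ∃ r, R (f 2) (f 3) x (f 3) = r := ⟨_, rfl⟩
  obtain ⟨b21, q21⟩ : ∃ r, R (f 3) (f 1) x (f 1) = r := ⟨_, rfl⟩
  obtain ⟨b22, q22⟩ : ∃ r, R (f 3) (f 1) x (f 2) = r := ⟨_, rfl⟩
  obtain ⟨b23, q23⟩ : ∃ r, R (f 3) (f 1) x (f 3) = r := ⟨_, rfl⟩
  obtain ⟨b31, q31⟩ : ∃ r, R (f 1) (f 2) x (f 1) = r := ⟨_, rfl⟩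
  obtain ⟨b32, q32⟩ : ∃ r, R (f 1) (f 2) x (f 2) = r := ⟨_, rfl⟩
  obtain ⟨b33, q33⟩ : ∃ r, R (f 1) (f 2) x (f 3) = r := ⟨_, rfl⟩
  rw [q33, q11, q22] at hb
  have N121 : inner ℝ (nijenhuis K x (f 1) (f 2)) (f 1) =
      -2 * b21 * e23 + 2 * b22 * e13 - 2 * b31 * e11 + 2 * b31 * e22 - 4 * b32 * e12 - 2 * b33 *
      e13 := by
    rw [n12 t1]
    simp only [k1, k2, k3, map_add, map_smul, LinearMap.add_apply, LinearMap.smul_apply,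
      smul_eq_mul, hp, p11, p21, p32, p13, q11, q12, q13, q21, q22, q23, q31, q32, q33]
    ring
  have N122 : inner ℝ (nijenhuis K x (f 1) (f 2)) (f 2) =
      2 * b11 * e23 - 2 * b12 * e13 - 4 * b31 * e12 + 2 * b32 * e11 - 2 * b32 * e22 - 2 * b33 *
      e23 := by
    rw [n12 t2]
    simp only [k1, k2, k3, map_add, map_smul, LinearMap.add_apply, LinearMap.smul_apply,
      smul_eq_mul, hp, p11, p21, p32, p13, q11, q12, q13, q21, q22, q23, q31, q32, q33]
    ring
  have N123 : inner ℝ (nijenhuis K x (f 1) (f 2)) (f 3) =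
      -b11 * e22 + b11 * e33 + b12 * e12 - b13 * e13 + b21 * e12 - b22 * e11 + b22 * e33 - b23 *
      e23 - 3 * b31 * e13 - 3 * b32 * e23 + b33 * e11 + b33 * e22 - 2 * b33 * e33 := by
    rw [n12 t3]
    simp only [k1, k2, k3, map_add, map_smul, LinearMap.add_apply, LinearMap.smul_apply,
      smul_eq_mul, hp, p11, p21, p32, p13, q11, q12, q13, q21, q22, q23, q31, q32, q33]
    ring
  have N231 : inner ℝ (nijenhuis K x (f 2) (f 3)) (f 1) =
      -2 * b11 * e11 + b11 * e22 + b11 * e33 - 3 * b12 * e12 - 3 * b13 * e13 - b21 * e12 + b22 *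
      e11 - b22 * e33 + b23 * e23 - b31 * e13 + b32 * e23 + b33 * e11 - b33 * e22 := by
    rw [n23 t1]
    simp only [k1, k2, k3, map_add, map_smul, LinearMap.add_apply, LinearMap.smul_apply,
      smul_eq_mul, hp, p11, p21, p32, p13, q11, q12, q13, q21, q22, q23, q31, q32, q33]
    ring
  have N232 : inner ℝ (nijenhuis K x (f 2) (f 3)) (f 2) =
      -2 * b11 * e12 - 2 * b12 * e22 + 2 * b12 * e33 - 4 * b13 * e23 - 2 * b32 * e13 + 2 * b33 *
      e12 := by
    rw [n23 t2]
    simp only [k1, k2, k3, map_add, map_smul, LinearMap.add_apply, LinearMap.smul_apply,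
      smul_eq_mul, hp, p11, p21, p32, p13, q11, q12, q13, q21, q22, q23, q31, q32, q33]
    ring
  have N233 : inner ℝ (nijenhuis K x (f 2) (f 3)) (f 3) =
      -2 * b11 * e13 - 4 * b12 * e23 + 2 * b13 * e22 - 2 * b13 * e33 + 2 * b22 * e13 - 2 * b23 *
      e12 := by
    rw [n23 t3]
    simp only [k1, k2, k3, map_add, map_smul, LinearMap.add_apply, LinearMap.smul_apply,
      smul_eq_mul, hp, p11, p21, p32, p13, q11, q12, q13, q21, q22, q23, q31, q32, q33]
    ring
  have N311 : inner ℝ (nijenhuis K x (f 3) (f 1)) (f 1) =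
      -2 * b21 * e11 + 2 * b21 * e33 - 2 * b22 * e12 - 4 * b23 * e13 - 2 * b31 * e23 + 2 * b33 *
      e12 := by
    rw [n31 t1]
    simp only [k1, k2, k3, map_add, map_smul, LinearMap.add_apply, LinearMap.smul_apply,
      smul_eq_mul, hp, p11, p21, p32, p13, q11, q12, q13, q21, q22, q23, q31, q32, q33]
    ring
  have N312 : inner ℝ (nijenhuis K x (f 3) (f 1)) (f 2) =
      b11 * e22 - b11 * e33 - b12 * e12 + b13 * e13 - 3 * b21 * e12 + b22 * e11 - 2 * b22 * e22
      + b22 * e33 - 3 * b23 * e23 + b31 * e13 - b32 * e23 - b33 * e11 + b33 * e22 := by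
    rw [n31 t2]
    simp only [k1, k2, k3, map_add, map_smul, LinearMap.add_apply, LinearMap.smul_apply,
      smul_eq_mul, hp, p11, p21, p32, p13, q11, q12, q13, q21, q22, q23, q31, q32, q33]
    ring
  have N313 : inner ℝ (nijenhuis K x (f 3) (f 1)) (f 3) =
      2 * b11 * e23 - 2 * b13 * e12 - 4 * b21 * e13 - 2 * b22 * e23 + 2 * b23 * e11 - 2 * b23 *
      e33 := by
    rw [n31 t3]
    simp only [k1, k2, k3, map_add, map_smul, LinearMap.add_apply, LinearMap.smul_apply,
      smul_eq_mul, hp, p11, p21, p32, p13, q11, q12, q13, q21, q22, q23, q31, q32, q33]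
    ring
  simp only [inner_add_right, inner_smul_right, k1, k2, k3, map_add, map_smul, smul_eq_mul,
    N121, N122, N123, N231, N232, N233, N311, N312, N313, magTrace, hf, q11, q12, q13, q21, q22,
    q23, q31, q32, q33]
  clear N121 N122 N123 N231 N232 N233 N311 N312 N313 n12 n23 n31
  subst hb
  -- The coefficients are `3 tr E`, `-4 tr E` and `(tr E)² + 4 σ₂(E)`. No further invariant occurs
  -- since, by Cayley-Hamilton and `tr B = 0`, the trace `tr BE³` is a combination of `tr BE²` and
  -- `tr BE`.
  refine ⟨3 * (e11 + e22 + e33), -4 * (e11 + e22 + e33), (e11 + e22 + e33) ^ 2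
    + 4 * (e11 * e22 + e22 * e33 + e33 * e11 - e12 ^ 2 - e23 ^ 2 - e13 ^ 2), ?_, ?_, ?_⟩ <;> ring

end Torsion

end KSVariety

namespace KSVariety

/-! ### Commuting curvature tensors and the mixed trace `tr BE'` -/

section Operators

variable {V : Type*} [NormedAddCommGroup V] [InnerProductSpace ℝ V]

/-- The endomorphism `R(x, ·, x, ·)`. -/
noncomputable def curvOp (e : OrthonormalBasis (Fin 4) ℝ V) (R : Tensor4 V) (x : V) : V →ₗ[ℝ] V :=
  ∑ i, (((R x).flip x).flip (e i)).smulRight (e i)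

theorem inner_curvOp (e : OrthonormalBasis (Fin 4) ℝ V) (R : Tensor4 V) (x v w : V) :
    inner ℝ (curvOp e R x v) w = R x v x w := by
  simp only [curvOp, LinearMap.sum_apply, LinearMap.smulRight_apply, LinearMap.flip_apply,
    sum_inner, inner_smul_left, RCLike.conj_to_real]
  conv_rhs => rw [← e.sum_repr' w]
  simp only [map_sum, map_smul, smul_eq_mul]
  exact Finset.sum_congr rfl fun i _ => mul_comm _ _

theorem curvOp_apply (e : OrthonormalBasis (Fin 4) ℝ V) (R : Tensor4 V) (x v : V) :
    curvOp e R x v = R x v x (e 0) • e 0 + R x v x (e 1) • e 1 + R x v x (e 2) • e 2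
      + R x v x (e 3) • e 3 := by
  have h := eq_sum_coord e (curvOp e R x v)
  simp only [real_inner_comm (curvOp e R x v), inner_curvOp] at h
  exact h

theorem curvOp_smul (e : OrthonormalBasis (Fin 4) ℝ V) (R : Tensor4 V) (c : ℝ) (x v : V) :
    curvOp e R (c • x) v = c ^ 2 • curvOp e R x v := by
  refine ext_inner_right ℝ fun w => ?_
  rw [inner_curvOp, inner_smul_left, inner_curvOp]
  simp
  ring

/-- The bilinear form `R(·, ·, c, d)`. -/
noncomputable def curvForm (R : Tensor4 V) (c d : V) : V →ₗ[ℝ] V →ₗ[ℝ] ℝ :=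
  LinearMap.mk₂ ℝ (fun a b => R a b c d) (by simp) (by simp) (by simp) (by simp)

@[simp] theorem curvForm_apply (R : Tensor4 V) (a b c d : V) : curvForm R c d a b = R a b c d := rfl

theorem starPair_self (e : OrthonormalBasis (Fin 4) ℝ V) (τ : V →ₗ[ℝ] V →ₗ[ℝ] ℝ) (x : V) :
    starPair e τ x x = 0 := by
  simp only [starPair, wedgeCoord]; ring

/-- The trace of the magnetic part of `R` against an operator, in an arbitrary basis. -/
noncomputable def starTrace (e : OrthonormalBasis (Fin 4) ℝ V) (R : Tensor4 V) (x : V)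
    (T : V → V) : ℝ :=
  ∑ i, starPair e (curvForm R x (T (e i))) x (e i)

/-- The frame `f` varies with `x` while `e` is fixed. Since the trace does not depend on the basis,
the conditions in frames become polynomial conditions on `x` in the coordinates of `e`. -/
theorem exists_basis_magTrace_eq (e : OrthonormalBasis (Fin 4) ℝ V) {x : V} (hx : ‖x‖ = 1) :
    ∃ f : OrthonormalBasis (Fin 4) ℝ V, f 0 = x ∧ ∀ R : Tensor4 V, IsAlgCurv R →
      ∀ T : V →ₗ[ℝ] V, magTrace R f T = starTrace e R x T := by
  obtain ⟨f, hf, hstar⟩ := exists_adapted_basis e hx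
  refine ⟨f, hf, fun R hR T => ?_⟩
  let β : V →ₗ[ℝ] V →ₗ[ℝ] ℝ := LinearMap.mk₂ ℝ (fun v w => starPair e (curvForm R x (T w)) x v)
    (fun v v' w => by simp only [starPair, wedgeCoord, inner_add_right]; ring)
    (fun c v w => by simp only [starPair, wedgeCoord, inner_smul_right, smul_eq_mul]; ring)
    (fun v w w' => by simp only [starPair, curvForm_apply, map_add]; ring)
    (fun c v w => by simp only [starPair, curvForm_apply, map_smul, smul_eq_mul]; ring)
  have h : ∑ a, β (f a) (f a) = starTrace e R x T := sum_bilin_orthonormalBasis e f β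
  have h0 : β (f 0) (f 0) = 0 := by
    rw [hf]; exact starPair_self e _ x
  have hs := fun w => hstar (curvForm R x w) fun a b => hR.antisymm_left a b x w
  rw [Fin.sum_univ_four, h0, zero_add] at h
  rw [← h, magTrace, hf]
  change _ = starPair e (curvForm R x (T (f 1))) x (f 1) + starPair e (curvForm R x (T (f 2))) x (f 2)
    + starPair e (curvForm R x (T (f 3))) x (f 3)
  rw [← (hs _).1, ← (hs _).2.1, ← (hs _).2.2]
  rfl

/-- The differences of the values at `±1` and at `±2` involve the odd coefficients only and separate
`c₁` from `c₃`. -/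
theorem linear_coeff_eq_zero {c₁ c₂ c₃ c₄ : ℝ}
    (h : ∀ t : ℝ, c₁ * t + c₂ * t ^ 2 + c₃ * t ^ 3 + c₄ * t ^ 4 = 0) : c₁ = 0 := by
  linarith [h 1, h (-1), h 2, h (-2)]

/-- The operators `R(x, ·, x, ·)` and `R'(x, ·, x, ·)` commute for all `x`. -/
def CurvCommute (R R' : Tensor4 V) : Prop :=
  ∀ (e : OrthonormalBasis (Fin 4) ℝ V) (x v w : V),
    R x v x (curvOp e R' x w) = R x w x (curvOp e R' x v)

/-- The derivative of the commutation relation at `x` in the direction `a`, obtained as the linear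
coefficient of the relation at `x + t a`. -/
theorem CurvCommute.polarised {R R' : Tensor4 V} (h : CurvCommute R R')
    (e : OrthonormalBasis (Fin 4) ℝ V) (x a v w : V) :
    (∑ i, ((R a v x (e i) + R x v a (e i)) * R' x w x (e i)
      + R x v x (e i) * (R' a w x (e i) + R' x w a (e i))))
    = ∑ i, ((R a w x (e i) + R x w a (e i)) * R' x v x (e i)
      + R x w x (e i) * (R' a v x (e i) + R' x v a (e i))) := by
  have hsum : ∀ y, ∑ i, (R y v y (e i) * R' y w y (e i) - R y w y (e i) * R' y v y (e i)) = 0 := by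
    intro y
    have h0 := h e y v w
    simp only [curvOp_apply, map_add, map_smul, smul_eq_mul] at h0
    simp only [Fin.sum_univ_four]
    linear_combination h0
  set c₂ : Fin 4 → ℝ := fun i => R a v a (e i) * R' x w x (e i)
      + (R a v x (e i) + R x v a (e i)) * (R' a w x (e i) + R' x w a (e i))
      + R x v x (e i) * R' a w a (e i)
      - R a w a (e i) * R' x v x (e i)
      - (R a w x (e i) + R x w a (e i)) * (R' a v x (e i) + R' x v a (e i))
      - R x w x (e i) * R' a v a (e i) with hc₂
  set c₃ : Fin 4 → ℝ := fun i => R a v a (e i) * (R' a w x (e i) + R' x w a (e i))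
      + (R a v x (e i) + R x v a (e i)) * R' a w a (e i)
      - R a w a (e i) * (R' a v x (e i) + R' x v a (e i))
      - (R a w x (e i) + R x w a (e i)) * R' a v a (e i) with hc₃
  set c₄ : Fin 4 → ℝ := fun i => R a v a (e i) * R' a w a (e i) - R a w a (e i) * R' a v a (e i)
    with hc₄
  rw [← sub_eq_zero, ← Finset.sum_sub_distrib]
  refine linear_coeff_eq_zero (c₂ := ∑ i, c₂ i) (c₃ := ∑ i, c₃ i) (c₄ := ∑ i, c₄ i) fun t => ?_
  rw [Finset.sum_mul, Finset.sum_mul, Finset.sum_mul, Finset.sum_mul, ← Finset.sum_add_distrib,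
    ← Finset.sum_add_distrib, ← Finset.sum_add_distrib,
    ← sub_eq_zero_of_eq ((hsum (x + t • a)).trans (hsum x).symm), ← Finset.sum_sub_distrib]
  refine Finset.sum_congr rfl fun i _ => ?_
  simp only [map_add, map_smul, smul_eq_mul, LinearMap.add_apply, LinearMap.smul_apply, hc₂, hc₃,
    hc₄]
  ring

set_option linter.unusedSimpArgs false in
-- Differentiating the `(f 2, f 3)` entry of the commutator in the direction `f 1` and adding the
-- cyclic permutations gives three times the difference of the two mixed traces.
theorem CurvCommute.magTrace_symm {R R' : Tensor4 V} (hR : IsAlgCurv R) (hR' : IsAlgCurv R')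
    (h : CurvCommute R R') (f : OrthonormalBasis (Fin 4) ℝ V) :
    magTrace R f (curvOp f R' (f 0)) = magTrace R' f (curvOp f R (f 0)) := by
  have h1 := h.polarised f (f 0) (f 1) (f 2) (f 3)
  have h2 := h.polarised f (f 0) (f 2) (f 3) (f 1)
  have h3 := h.polarised f (f 0) (f 3) (f 1) (f 2)
  have b : ∀ {Q : Tensor4 V}, IsAlgCurv Q → Q (f 1) (f 2) (f 0) (f 3)
      = - Q (f 2) (f 3) (f 0) (f 1) - Q (f 3) (f 1) (f 0) (f 2) := fun {Q} hQ => by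
    linarith [hQ.bianchi (f 0) (f 1) (f 2) (f 3), hQ.pair_symm (f 1) (f 2) (f 0) (f 3),
      hQ.pair_symm (f 2) (f 3) (f 0) (f 1), hQ.pair_symm (f 3) (f 1) (f 0) (f 2)]
  have hp : ∀ {Q : Tensor4 V}, IsAlgCurv Q → ∀ i j k,
      Q (f 0) (f i) (f j) (f k) = Q (f j) (f k) (f 0) (f i) := fun hQ i j k => hQ.pair_symm _ _ _ _
  have hs : ∀ {Q : Tensor4 V}, IsAlgCurv Q → ∀ i v, Q (f i) (f i) (f 0) v = 0 :=
    fun hQ i v => hQ.self_left _ _ _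
  have hr : ∀ {Q : Tensor4 V}, IsAlgCurv Q → ∀ a b, Q a b (f 0) (f 0) = 0 :=
    fun hQ a b => hQ.self_right _ _ _
  have ha : ∀ {Q : Tensor4 V}, IsAlgCurv Q → ∀ i j v, Q (f i) (f j) (f 0) v
      = - Q (f j) (f i) (f 0) v := fun hQ i j v => hQ.antisymm_left _ _ _ _
  have hs21 : ∀ {Q : Tensor4 V}, IsAlgCurv Q → Q (f 0) (f 2) (f 0) (f 1) = Q (f 0) (f 1) (f 0) (f 2)
    := fun hQ => hQ.sectional_symm _ _ _
  have hs31 : ∀ {Q : Tensor4 V}, IsAlgCurv Q → Q (f 0) (f 3) (f 0) (f 1) = Q (f 0) (f 1) (f 0) (f 3)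
    := fun hQ => hQ.sectional_symm _ _ _
  have hs32 : ∀ {Q : Tensor4 V}, IsAlgCurv Q → Q (f 0) (f 3) (f 0) (f 2) = Q (f 0) (f 2) (f 0) (f 3)
    := fun hQ => hQ.sectional_symm _ _ _
  simp only [Fin.sum_univ_four, hr hR, hr hR', mul_zero, zero_mul, add_zero, zero_add,
    hp hR 1 1, hp hR 1 2, hp hR 1 3, hp hR 2 1, hp hR 2 2, hp hR 2 3, hp hR 3 1, hp hR 3 2,
    hp hR 3 3, hp hR' 1 1, hp hR' 1 2, hp hR' 1 3, hp hR' 2 1, hp hR' 2 2, hp hR' 2 3, hp hR' 3 1,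
    hp hR' 3 2, hp hR' 3 3, hs hR, hs hR', ha hR 2 1, ha hR' 2 1, ha hR 3 2, ha hR' 3 2, ha hR 1 3,
    ha hR' 1 3, b hR, b hR', hs21 hR, hs21 hR', hs31 hR, hs31 hR', hs32 hR, hs32 hR'] at h1 h2 h3
  simp only [magTrace, curvOp_apply, map_add, map_smul, smul_eq_mul, hr hR, hr hR', mul_zero,
    zero_add, b hR, b hR', hs21 hR, hs21 hR', hs31 hR, hs31 hR', hs32 hR, hs32 hR']
  linear_combination (h1 + h2 + h3) / 3

variable {K K' : EndField V} {R R' : Tensor4 V}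

theorem IsAlgCurv.add (hR : IsAlgCurv R) (hR' : IsAlgCurv R') : IsAlgCurv (R + R') := by
  constructor <;> intro a b c d <;> simp only [LinearMap.add_apply]
  · linarith [hR.antisymm_left a b c d, hR'.antisymm_left a b c d]
  · linarith [hR.antisymm_right a b c d, hR'.antisymm_right a b c d]
  · linarith [hR.pair_symm a b c d, hR'.pair_symm a b c d]
  · linarith [hR.bianchi a b c d, hR'.bianchi a b c d]

theorem IsAlgCurv.smul (hR : IsAlgCurv R) (r : ℝ) : IsAlgCurv (r • R) := by
  constructor <;> intro a b c d <;> simp only [LinearMap.smul_apply, smul_eq_mul]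
  · rw [hR.antisymm_left a b c d]; ring
  · rw [hR.antisymm_right a b c d]; ring
  · rw [hR.pair_symm a b c d]
  · linear_combination r * hR.bianchi a b c d

theorem IsCurvOf.add (hR : IsCurvOf K R) (hR' : IsCurvOf K' R') : IsCurvOf (K + K') (R + R') :=
  ⟨hR.1.add hR'.1, fun x v w hv hw => by
    simp [inner_add_left, hR.2 x v w hv hw, hR'.2 x v w hv hw]⟩

theorem IsCurvOf.smul (hR : IsCurvOf K R) (r : ℝ) : IsCurvOf (r • K) (r • R) :=
  ⟨hR.1.smul r, fun x v w hv hw => by simp [inner_smul_left, hR.2 x v w hv hw]⟩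

theorem magTrace_add (R R' : Tensor4 V) (f : OrthonormalBasis (Fin 4) ℝ V) (T T' : V → V) :
    magTrace (R + R') f (T + T') = magTrace R f T + magTrace R f T' + magTrace R' f T
      + magTrace R' f T' := by
  simp only [magTrace, LinearMap.add_apply, Pi.add_apply, map_add]
  ring

end Operators

/-! ### The mixed trace vanishes in a Stäckel system -/

section Systems

variable {V : Type*} [NormedAddCommGroup V] [InnerProductSpace ℝ V]
  [Fact (finrank ℝ V = 3 + 1)] {K K' : EndField V} {R R' : Tensor4 V}

theorem IsCurvOf.eq_curvOp (hK : IsSymField K) (hR : IsCurvOf K R)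
    (e : OrthonormalBasis (Fin 4) ℝ V) (x : Metric.sphere (0 : V) 1) (v : V) :
    K x v = curvOp e R x v := by
  refine ext_inner_right ℝ fun w => ?_
  rw [hR.inner_eq hK, inner_curvOp]

/-- Homogeneity in the base point extends the relation from the sphere to all of `V`, where it is a
polynomial identity that can be differentiated. -/
theorem curvCommute_of_commute (hK : IsSymField K) (hR : IsCurvOf K R) (hK' : IsSymField K')
    (hR' : IsCurvOf K' R') (h : ∀ x, K x ∘L K' x = K' x ∘L K x) : CurvCommute R R' := by
  have h1 : ∀ (e : OrthonormalBasis (Fin 4) ℝ V) (x : Metric.sphere (0 : V) 1) (v w : V),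
      R x v x (curvOp e R' x w) = R x w x (curvOp e R' x v) := fun e x v w => by
    rw [← hR'.eq_curvOp hK', ← hR'.eq_curvOp hK', ← hR.inner_eq hK, ← hR.inner_eq hK, ← hK'.symm,
      hK.symm x w, real_inner_comm w]
    exact congrArg (fun T : V →L[ℝ] V => (inner ℝ w (T v) : ℝ)) (h x).symm
  intro e y v w
  by_cases hy : y = 0
  · simp [hy]
  obtain ⟨x, hx⟩ := exists_sphere_of_ne_zero hy
  have hyx : y = ‖y‖ • (x : V) := by
    rw [hx, smul_smul, mul_inv_cancel₀ (norm_ne_zero_iff.mpr hy), one_smul]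
  rw [hyx, curvOp_smul, curvOp_smul]
  simp only [map_smul, LinearMap.smul_apply, smul_eq_mul, h1 e x v w]

theorem IsIntegrable.magTrace_eq_zero (hK : IsSymField K) (hR : IsCurvOf K R)
    (hI : IsIntegrable K) (f : OrthonormalBasis (Fin 4) ℝ V) :
    magTrace R f (curvOp f R (f 0)) = 0 := by
  let x : Metric.sphere (0 : V) 1 := ⟨f 0, by simp⟩
  have hf : f 0 = x := rfl
  obtain ⟨_, _, _, h, -⟩ := hR.cyclic_nijenhuis hK hf
  have h2 := (hI x (f 1) (f 2) (f 3) (isTangent_basis hf (by decide))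
    (isTangent_basis hf (by decide)) (isTangent_basis hf (by decide))).1
  have h3 : magTrace R f (K x) = 0 := by linarith
  rw [← h3, magTrace, magTrace]
  simp only [hR.eq_curvOp hK f x, hf]

/-- The polarised first integrability condition and the commutation relations. -/
theorem IsStaeckelSystem.magTrace_eq_zero {S : Submodule ℝ (EndField V)} (hS : IsStaeckelSystem S)
    (hK : K ∈ S) (hK' : K' ∈ S) (hR : IsCurvOf K R) (hR' : IsCurvOf K' R')
    (f : OrthonormalBasis (Fin 4) ℝ V) : magTrace R f (curvOp f R' (f 0)) = 0 := by
  have h1 := (hS.integrable K hK).magTrace_eq_zero (hS.killing K hK).1 hR f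
  have h2 := (hS.integrable K' hK').magTrace_eq_zero (hS.killing K' hK').1 hR' f
  have hadd := S.add_mem hK hK'
  -- The quadratic condition `tr BE = 0` holds on the whole vector space, so its polarisation `tr
  -- BE' + tr B'E` vanishes. The two summands are equal by the commutation relations.
  have h3 := (hS.integrable _ hadd).magTrace_eq_zero (hS.killing _ hadd).1 (hR.add hR') f
  have h4 := (curvCommute_of_commute (hS.killing K hK).1 hR (hS.killing K' hK').1 hR'
    (hS.commute K hK K' hK')).magTrace_symm hR.1 hR'.1 f
  have hop : ⇑(curvOp f (R + R') (f 0)) = ⇑(curvOp f R (f 0)) + ⇑(curvOp f R' (f 0)) := by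
    funext v
    refine ext_inner_right ℝ fun w => ?_
    rw [Pi.add_apply, inner_add_left, inner_curvOp, inner_curvOp, inner_curvOp]
    rfl
  rw [hop, magTrace_add] at h3
  linarith

theorem IsStaeckelSystem.starTrace_eq_zero {S : Submodule ℝ (EndField V)}
    (hS : IsStaeckelSystem S) (hK : K ∈ S) (hK' : K' ∈ S) (hR : IsCurvOf K R)
    (hR' : IsCurvOf K' R') (e : OrthonormalBasis (Fin 4) ℝ V) (x : V) :
    starTrace e R x (curvOp e R' x) = 0 := by
  by_cases hx : x = 0
  · simp [hx, starTrace, starPair]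
  obtain ⟨u, hu⟩ := exists_sphere_of_ne_zero hx
  obtain ⟨f, hf, h⟩ := exists_basis_magTrace_eq e (norm_eq_of_mem_sphere u)
  have h0 := hS.magTrace_eq_zero hK hK' hR hR' f
  have hop : curvOp f R' (f 0) = curvOp e R' u := by
    rw [hf]
    ext v
    refine ext_inner_right ℝ fun w => ?_
    rw [inner_curvOp, inner_curvOp]
  rw [hop, h R hR.1] at h0
  have hxu : x = ‖x‖ • (u : V) := by
    rw [hu, smul_smul, mul_inv_cancel₀ (norm_ne_zero_iff.mpr hx), one_smul]
  -- The star pairing contributes degree two in `x` and the operator degree two, so vanishing on the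
  -- sphere gives vanishing everywhere.
  have hscale : ∀ c : ℝ, starTrace e R (c • (u : V)) (curvOp e R' (c • (u : V)))
      = c ^ 4 * starTrace e R u (curvOp e R' u) := fun c => by
    simp only [starTrace, Finset.mul_sum]
    refine Finset.sum_congr rfl fun i _ => ?_
    simp only [curvOp_smul, starPair, wedgeCoord, inner_smul_right, curvForm_apply, map_smul,
      LinearMap.smul_apply, smul_eq_mul]
    ring
  rw [hxu, hscale, h0, mul_zero]

end Systems

end KSVariety

namespace KSVariety

/-! ### The quartic `tr BE'` and the Weyl parts -/

section Weyl

/-- The polynomial `x ↦ tr (B ∘ E)` which pairs the magnetic part of one curvature tensor with the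
electric part of another one, in terms of the matrices of the curvature operators. -/
noncomputable def magElec (r s : Fin 6 → Fin 6 → ℝ) (x0 x1 x2 x3 : ℝ) : ℝ :=
  (x1 * x2 * r 0 4 + x1 * x2 * r 1 3 + x1 * x3 * r 0 5 + x1 * x3 * r 2 3 + x1 ^ 2 * r 0 3 + x2 *
  x3 * r 1 5 + x2 * x3 * r 2 4 + x2 ^ 2 * r 1 4 - x3 ^ 2 * r 0 3 - x3 ^ 2 * r 1 4) * (s 0 0 * x1 ^
  2 + 2 * s 0 1 * x1 * x2 + 2 * s 0 2 * x1 * x3 + s 1 1 * x2 ^ 2 + 2 * s 1 2 * x2 * x3 + s 2 2 *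
  x3 ^ 2) + (-r 0 1 * x1 * x3 + r 0 2 * x1 * x2 - r 1 1 * x2 * x3 + r 1 2 * x2 ^ 2 - r 1 2 * x3 ^
  2 + r 2 2 * x2 * x3 - 2 * x0 * x1 * r 0 3 - x0 * x2 * r 0 4 - x0 * x2 * r 1 3 - x0 * x3 * r 0 5
  - x0 * x3 * r 2 3 + x1 * x2 * r 3 5 - x1 * x3 * r 3 4 - x2 * x3 * r 4 4 + x2 * x3 * r 5 5 + x2 ^
  2 * r 4 5 - x3 ^ 2 * r 4 5) * (-s 0 0 * x0 * x1 - s 0 1 * x0 * x2 - s 0 2 * x0 * x3 + x1 * x2 *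
  s 0 5 - x1 * x3 * s 0 4 - x2 * x3 * s 0 3 - 2 * x2 * x3 * s 1 4 + x2 ^ 2 * s 1 5 - x3 ^ 2 * s 2
  4) + (r 0 0 * x1 * x3 + r 0 1 * x2 * x3 - r 0 2 * x1 ^ 2 + r 0 2 * x3 ^ 2 - r 1 2 * x1 * x2 - r
  2 2 * x1 * x3 - x0 * x1 * r 0 4 - x0 * x1 * r 1 3 - 2 * x0 * x2 * r 1 4 - x0 * x3 * r 1 5 - x0 *
  x3 * r 2 4 - x1 * x2 * r 4 5 + x1 * x3 * r 3 3 - x1 * x3 * r 5 5 - x1 ^ 2 * r 3 5 + x2 * x3 * r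
  3 4 + x3 ^ 2 * r 3 5) * (-s 0 1 * x0 * x1 - s 1 1 * x0 * x2 - s 1 2 * x0 * x3 - x1 * x2 * s 1 5
  + 2 * x1 * x3 * s 0 3 + x1 * x3 * s 1 4 - x1 ^ 2 * s 0 5 + x2 * x3 * s 1 3 + x3 ^ 2 * s 2 3) +
  (-r 0 0 * x1 * x2 + r 0 1 * x1 ^ 2 - r 0 1 * x2 ^ 2 - r 0 2 * x2 * x3 + r 1 1 * x1 * x2 + r 1 2
  * x1 * x3 - x0 * x1 * r 0 5 - x0 * x1 * r 2 3 - x0 * x2 * r 1 5 - x0 * x2 * r 2 4 + 2 * x0 * x3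
  * r 0 3 + 2 * x0 * x3 * r 1 4 - x1 * x2 * r 3 3 + x1 * x2 * r 4 4 + x1 * x3 * r 4 5 + x1 ^ 2 * r
  3 4 - x2 * x3 * r 3 5 - x2 ^ 2 * r 3 4) * (-s 0 2 * x0 * x1 - s 1 2 * x0 * x2 - s 2 2 * x0 * x3
  - x1 * x2 * s 0 3 + x1 * x2 * s 1 4 + x1 * x3 * s 2 4 + x1 ^ 2 * s 0 4 - x2 * x3 * s 2 3 - x2 ^
  2 * s 1 3) + (r 0 1 * x0 * x3 - r 0 2 * x0 * x2 - x0 * x2 * r 3 5 + x0 * x3 * r 3 4 + x0 ^ 2 * r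
  0 3 - x2 * x3 * r 1 5 - x2 * x3 * r 2 4 - x2 ^ 2 * r 0 3 - x2 ^ 2 * r 1 4 + x3 ^ 2 * r 1 4) * (s
  0 0 * x0 ^ 2 - 2 * x0 * x2 * s 0 5 + 2 * x0 * x3 * s 0 4 - 2 * x2 * x3 * s 4 5 + x2 ^ 2 * s 5 5
  + x3 ^ 2 * s 4 4) + (-r 0 0 * x0 * x3 + r 0 2 * x0 * x1 + r 1 1 * x0 * x3 - r 1 2 * x0 * x2 + x0
  * x1 * r 3 5 - x0 * x2 * r 4 5 - x0 * x3 * r 3 3 + x0 * x3 * r 4 4 + x0 ^ 2 * r 0 4 + x0 ^ 2 * r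
  1 3 + 2 * x1 * x2 * r 0 3 + 2 * x1 * x2 * r 1 4 + x1 * x3 * r 1 5 + x1 * x3 * r 2 4 + x2 * x3 *
  r 0 5 + x2 * x3 * r 2 3 - x3 ^ 2 * r 0 4 - x3 ^ 2 * r 1 3) * (s 0 1 * x0 ^ 2 + x0 * x1 * s 0 5 -
  x0 * x2 * s 1 5 - x0 * x3 * s 0 3 + x0 * x3 * s 1 4 - x1 * x2 * s 5 5 + x1 * x3 * s 4 5 + x2 *
  x3 * s 3 5 - x3 ^ 2 * s 3 4) + (r 0 0 * x0 * x2 - r 0 1 * x0 * x1 + r 1 2 * x0 * x3 - r 2 2 * x0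
  * x2 - x0 * x1 * r 3 4 + x0 * x2 * r 3 3 - x0 * x2 * r 5 5 + x0 * x3 * r 4 5 + x0 ^ 2 * r 0 5 +
  x0 ^ 2 * r 2 3 + x1 * x2 * r 1 5 + x1 * x2 * r 2 4 - 2 * x1 * x3 * r 1 4 + x2 * x3 * r 0 4 + x2
  * x3 * r 1 3 - x2 ^ 2 * r 0 5 - x2 ^ 2 * r 2 3) * (s 0 2 * x0 ^ 2 - x0 * x1 * s 0 4 + 2 * x0 *
  x2 * s 0 3 + x0 * x2 * s 1 4 + x0 * x3 * s 2 4 + x1 * x2 * s 4 5 - x1 * x3 * s 4 4 + x2 * x3 * s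
  3 4 - x2 ^ 2 * s 3 5) + (-r 0 1 * x0 * x3 + r 1 2 * x0 * x1 + x0 * x1 * r 4 5 - x0 * x3 * r 3 4
  + x0 ^ 2 * r 1 4 - x1 * x3 * r 0 5 - x1 * x3 * r 2 3 - x1 ^ 2 * r 0 3 - x1 ^ 2 * r 1 4 + x3 ^ 2
  * r 0 3) * (s 1 1 * x0 ^ 2 + 2 * x0 * x1 * s 1 5 - 2 * x0 * x3 * s 1 3 - 2 * x1 * x3 * s 3 5 +
  x1 ^ 2 * s 5 5 + x3 ^ 2 * s 3 3) + (r 0 1 * x0 * x2 - r 0 2 * x0 * x3 - r 1 1 * x0 * x1 + r 2 2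
  * x0 * x1 - x0 * x1 * r 4 4 + x0 * x1 * r 5 5 + x0 * x2 * r 3 4 - x0 * x3 * r 3 5 + x0 ^ 2 * r 1
  5 + x0 ^ 2 * r 2 4 + x1 * x2 * r 0 5 + x1 * x2 * r 2 3 + x1 * x3 * r 0 4 + x1 * x3 * r 1 3 - x1
  ^ 2 * r 1 5 - x1 ^ 2 * r 2 4 - 2 * x2 * x3 * r 0 3) * (s 1 2 * x0 ^ 2 - x0 * x1 * s 0 3 - 2 * x0
  * x1 * s 1 4 + x0 * x2 * s 1 3 - x0 * x3 * s 2 3 + x1 * x2 * s 3 5 + x1 * x3 * s 3 4 - x1 ^ 2 *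
  s 4 5 - x2 * x3 * s 3 3) + (r 0 2 * x0 * x2 - r 1 2 * x0 * x1 - x0 * x1 * r 4 5 + x0 * x2 * r 3
  5 - x0 ^ 2 * r 0 3 - x0 ^ 2 * r 1 4 - x1 * x2 * r 0 4 - x1 * x2 * r 1 3 + x1 ^ 2 * r 1 4 + x2 ^
  2 * r 0 3) * (s 2 2 * x0 ^ 2 - 2 * x0 * x1 * s 2 4 + 2 * x0 * x2 * s 2 3 - 2 * x1 * x2 * s 3 4 +
  x1 ^ 2 * s 4 4 + x2 ^ 2 * s 3 3)

/-- The entries of the self-dual Weyl part of a curvature operator. -/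
noncomputable def weylPlus (r : Fin 6 → Fin 6 → ℝ) : Fin 5 → ℝ :=
  ![r 0 1 + r 3 4 + r 0 4 + r 1 3, r 1 2 + r 4 5 + r 1 5 + r 2 4, r 0 2 + r 3 5 + r 0 5 + r 2 3,
    r 0 0 - r 1 1 + r 3 3 - r 4 4 + 2 * (r 0 3 - r 1 4),
    r 1 1 - r 2 2 + r 4 4 - r 5 5 + 2 * (r 0 3 + 2 * r 1 4)]

/-- The entries of the anti-self-dual Weyl part of a curvature operator. -/
noncomputable def weylMinus (r : Fin 6 → Fin 6 → ℝ) : Fin 5 → ℝ :=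
  ![r 0 1 + r 3 4 - r 0 4 - r 1 3, r 1 2 + r 4 5 - r 1 5 - r 2 4, r 0 2 + r 3 5 - r 0 5 - r 2 3,
    r 0 0 - r 1 1 + r 3 3 - r 4 4 - 2 * (r 0 3 - r 1 4),
    r 1 1 - r 2 2 + r 4 4 - r 5 5 - 2 * (r 0 3 + 2 * r 1 4)]

/-- A quartic polynomial in four variables which vanishes identically has vanishing coefficients. -/
theorem quartic_coeff_eq_zero
    {c0000 c0001 c0002 c0003 c0011 c0012 c0013 c0022 c0023 c0033 c0111 c0112 c0113 c0122 c0123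
    c0133 c0222 c0223 c0233 c0333 c1111 c1112 c1113 c1122 c1123 c1133 c1222 c1223 c1233 c1333
    c2222 c2223 c2233 c2333 c3333 : ℝ}
    (h : ∀ x0 x1 x2 x3 : ℝ, c0000 * (x0 ^ 4) + c0001 * (x0 ^ 3 * x1) + c0002 * (x0 ^ 3 * x2) + c0003 * (x0 ^ 3 * x3) +
      c0011 * (x0 ^ 2 * x1 ^ 2) + c0012 * (x0 ^ 2 * x1 * x2) + c0013 * (x0 ^ 2 * x1 * x3) + c0022
      * (x0 ^ 2 * x2 ^ 2) + c0023 * (x0 ^ 2 * x2 * x3) + c0033 * (x0 ^ 2 * x3 ^ 2) + c0111 * (x0 *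
      x1 ^ 3) + c0112 * (x0 * x1 ^ 2 * x2) + c0113 * (x0 * x1 ^ 2 * x3) + c0122 * (x0 * x1 * x2 ^
      2) + c0123 * (x0 * x1 * x2 * x3) + c0133 * (x0 * x1 * x3 ^ 2) + c0222 * (x0 * x2 ^ 3) +
      c0223 * (x0 * x2 ^ 2 * x3) + c0233 * (x0 * x2 * x3 ^ 2) + c0333 * (x0 * x3 ^ 3) + c1111 *
      (x1 ^ 4) + c1112 * (x1 ^ 3 * x2) + c1113 * (x1 ^ 3 * x3) + c1122 * (x1 ^ 2 * x2 ^ 2) + c1123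
      * (x1 ^ 2 * x2 * x3) + c1133 * (x1 ^ 2 * x3 ^ 2) + c1222 * (x1 * x2 ^ 3) + c1223 * (x1 * x2
      ^ 2 * x3) + c1233 * (x1 * x2 * x3 ^ 2) + c1333 * (x1 * x3 ^ 3) + c2222 * (x2 ^ 4) + c2223 *
      (x2 ^ 3 * x3) + c2233 * (x2 ^ 2 * x3 ^ 2) + c2333 * (x2 * x3 ^ 3) + c3333 * (x3 ^ 4) = 0) :
    c0000 = 0 ∧ c0001 = 0 ∧ c0002 = 0 ∧ c0003 = 0 ∧ c0011 = 0 ∧ c0012 = 0 ∧ c0013 = 0 ∧ c0022 = 0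
    ∧ c0023 = 0 ∧ c0033 = 0 ∧ c0111 = 0 ∧ c0112 = 0 ∧ c0113 = 0 ∧ c0122 = 0 ∧ c0123 = 0 ∧ c0133 =
    0 ∧ c0222 = 0 ∧ c0223 = 0 ∧ c0233 = 0 ∧ c0333 = 0 ∧ c1111 = 0 ∧ c1112 = 0 ∧ c1113 = 0 ∧ c1122
    = 0 ∧ c1123 = 0 ∧ c1133 = 0 ∧ c1222 = 0 ∧ c1223 = 0 ∧ c1233 = 0 ∧ c1333 = 0 ∧ c2222 = 0 ∧
    c2223 = 0 ∧ c2233 = 0 ∧ c2333 = 0 ∧ c3333 = 0 := by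
  -- Each coefficient is a rational combination of values of the quartic at small integer points.
  refine ⟨?_, ?_, ?_, ?_, ?_, ?_, ?_, ?_, ?_, ?_, ?_, ?_, ?_, ?_, ?_, ?_, ?_, ?_, ?_, ?_, ?_, ?_, ?_,
    ?_, ?_, ?_, ?_, ?_, ?_, ?_, ?_, ?_, ?_, ?_, ?_⟩
  · linear_combination (1/16) * h 2 0 0 0
  · linear_combination (1/6) * h 1 (-1) 0 0 + (-1/6) * h 1 1 0 0 + (-1/12) * h 2 (-1) 0 0 + (1/12) * h 2 1 0 0
  · linear_combination (1/6) * h 1 0 (-1) 0 + (-1/6) * h 1 0 1 0 + (-1/12) * h 2 0 (-1) 0 + (1/12) * h 2 0 1 0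
  · linear_combination (1/12) * h 1 0 0 (-2) + (-2/3) * h 1 0 0 (-1) + (2/3) * h 1 0 0 1 + (-1/12) * h 1 0 0 2
  · linear_combination (-1/16) * h 0 2 0 0 + (1/2) * h 1 (-1) 0 0 + (-1) * h 1 0 0 0 + (1/2) * h 1 1 0 0
  · linear_combination h 0 0 1 0 + h 0 1 0 0 + (-1) * h 0 1 1 0 + (1/2) * h 1 (-1) (-1) 0 + (-1/2) * h 1 (-1) 0 0 +
      (-1/2) * h 1 0 (-1) 0 + h 1 0 0 0 + (-1/2) * h 1 0 1 0 + (-1/2) * h 1 1 0 0 + (1/2) * h 1 1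
      1 0
  · linear_combination (1/2) * h 0 1 0 (-1) + (-1/2) * h 0 1 0 1 + (1/4) * h 1 (-1) 0 (-1) + (-1/4) * h 1 (-1) 0 1
      + (-1/4) * h 1 1 0 (-1) + (1/4) * h 1 1 0 1
  · linear_combination (-1/4) * h 0 0 2 0 + (1/8) * h 1 0 (-2) 0 + (-1/4) * h 1 0 0 0 + (1/8) * h 1 0 2 0
  · linear_combination (-1/2) * h 0 0 0 1 + (1/18) * h 0 0 1 (-2) + (-4/9) * h 0 0 1 1 + (1/18) * h 0 0 2 (-1) +
      (-1/32) * h 0 0 2 0 + (1/4) * h 1 0 (-1) (-1) + (-1/4) * h 1 0 (-1) 1 + (-1/4) * h 1 0 1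
      (-1) + (1/4) * h 1 0 1 1
  · linear_combination (-1) * h 0 0 0 1 + (1/2) * h 1 0 0 (-1) + (-1) * h 1 0 0 0 + (1/2) * h 1 0 0 1
  · linear_combination (-1/12) * h 1 (-2) 0 0 + (1/6) * h 1 (-1) 0 0 + (-1/6) * h 1 1 0 0 + (1/12) * h 1 2 0 0
  · linear_combination (-1/4) * h 1 (-1) (-1) 0 + (1/4) * h 1 (-1) 1 0 + (1/2) * h 1 0 (-1) 0 + (-1/2) * h 1 0 1 0
      + (-1/4) * h 1 1 (-1) 0 + (1/4) * h 1 1 1 0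
  · linear_combination (-1/4) * h 1 (-1) 0 (-1) + (1/4) * h 1 (-1) 0 1 + (-1/2) * h 1 0 0 1 + (-1/4) * h 1 1 0 (-1)
      + (1/4) * h 1 1 0 1 + (1/32) * h 2 0 0 (-2)
  · linear_combination h 0 0 1 0 + (-1/2) * h 0 1 (-1) 0 + h 0 1 0 0 + (-1/2) * h 0 1 1 0 + (-1/2) * h 1 0 (-1) 0 +
      h 1 0 0 0 + (-1/2) * h 1 0 1 0 + (1/2) * h 1 1 (-1) 0 + (-1) * h 1 1 0 0 + (1/2) * h 1 1 1 0
  · linear_combination (-1/8) * h 1 (-1) (-1) (-1) + (1/8) * h 1 (-1) (-1) 1 + (1/8) * h 1 (-1) 1 (-1) + (-1/8) * h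
      1 (-1) 1 1 + (1/8) * h 1 1 (-1) (-1) + (-1/8) * h 1 1 (-1) 1 + (-1/8) * h 1 1 1 (-1) + (1/8)
      * h 1 1 1 1
  · linear_combination h 0 0 0 1 + (-1/2) * h 0 1 0 (-1) + h 0 1 0 0 + (-1/2) * h 0 1 0 1 + (-1/2) * h 1 0 0 (-1) +
      h 1 0 0 0 + (-1/2) * h 1 0 0 1 + (1/2) * h 1 1 0 (-1) + (-1) * h 1 1 0 0 + (1/2) * h 1 1 0 1
  · linear_combination (-1/12) * h 1 0 (-2) 0 + (1/6) * h 1 0 (-1) 0 + (-1/6) * h 1 0 1 0 + (1/12) * h 1 0 2 0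
  · linear_combination h 0 0 0 1 + (-1/2) * h 0 0 1 (-1) + h 0 0 1 0 + (-1/2) * h 0 0 1 1 + (-1/2) * h 1 0 (-1) 0 +
      (1/2) * h 1 0 (-1) 1 + h 1 0 0 0 + (-1) * h 1 0 0 1 + (-1/2) * h 1 0 1 0 + (1/2) * h 1 0 1 1
  · linear_combination h 0 0 0 1 + (-1/2) * h 0 0 1 (-1) + h 0 0 1 0 + (-1/2) * h 0 0 1 1 + (-1/2) * h 1 0 0 (-1) +
      h 1 0 0 0 + (-1/2) * h 1 0 0 1 + (1/2) * h 1 0 1 (-1) + (-1) * h 1 0 1 0 + (1/2) * h 1 0 1 1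
  · linear_combination (-2/3) * h 1 0 0 (-1) + (2/3) * h 1 0 0 1 + (1/12) * h 2 0 0 (-1) + (-1/12) * h 2 0 0 1
  · linear_combination h 0 1 0 0
  · linear_combination (1/6) * h 0 1 (-1) 0 + (-1/6) * h 0 1 1 0 + (-1/12) * h 0 2 (-1) 0 + (1/12) * h 0 2 1 0
  · linear_combination (1/6) * h 0 1 0 (-1) + (-1/6) * h 0 1 0 1 + (-1/12) * h 0 2 0 (-1) + (1/12) * h 0 2 0 1
  · linear_combination (-1) * h 0 0 1 0 + (1/2) * h 0 1 (-1) 0 + (-1) * h 0 1 0 0 + (1/2) * h 0 1 1 0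
  · linear_combination (-1/2) * h 0 0 1 1 + (1/32) * h 0 0 2 (-2) + (1/4) * h 0 1 (-1) (-1) + (-1/4) * h 0 1 (-1) 1
      + (-1/4) * h 0 1 1 (-1) + (1/4) * h 0 1 1 1
  · linear_combination (-1) * h 0 0 0 1 + (1/2) * h 0 1 0 (-1) + (-1) * h 0 1 0 0 + (1/2) * h 0 1 0 1
  · linear_combination (-1/12) * h 0 1 (-2) 0 + (1/6) * h 0 1 (-1) 0 + (-1/6) * h 0 1 1 0 + (1/12) * h 0 1 2 0
  · linear_combination (3/2) * h 0 0 1 0 + (-1/16) * h 0 1 (-2) (-1) + (1/4) * h 0 1 (-1) 1 + (1/4) * h 0 1 1 1 +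
      (-1/16) * h 0 1 2 (-1) + (1/128) * h 0 2 0 (-2) + (-1/32) * h 0 2 0 2
  · linear_combination (-1) * h 0 0 0 1 + (1/2) * h 0 0 1 (-1) + (-1) * h 0 0 1 0 + (1/2) * h 0 0 1 1 + (-1/2) * h
      0 1 (-1) (-1) + h 0 1 (-1) 0 + (-1/2) * h 0 1 (-1) 1 + (1/2) * h 0 1 0 (-1) + (-1) * h 0 1 0
      0 + (1/2) * h 0 1 0 1
  · linear_combination (-1/15) * h 0 1 0 (-2) + (1/15) * h 0 1 0 2 + (1/60) * h 0 2 0 (-1) + (-1/60) * h 0 2 0 1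
  · linear_combination h 0 0 1 0
  · linear_combination (1/6) * h 0 0 1 (-1) + (-1/6) * h 0 0 1 1 + (-1/12) * h 0 0 2 (-1) + (1/12) * h 0 0 2 1
  · linear_combination (-1/4) * h 0 0 0 1 + (1/8) * h 0 0 2 (-1) + (-1/4) * h 0 0 2 0 + (1/8) * h 0 0 2 1
  · linear_combination (-2/3) * h 0 0 1 (-1) + (2/3) * h 0 0 1 1 + (1/12) * h 0 0 2 (-1) + (-1/12) * h 0 0 2 1
  · linear_combination h 0 0 0 1

/-- The inner product of trace free symmetric matrices. -/
noncomputable def weylInner (v w : Fin 5 → ℝ) : ℝ :=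
  2 * (v 0 * w 0 + v 1 * w 1 + v 2 * w 2)
    + (v 3 * w 3 + v 4 * w 4 + (v 3 + v 4) * (w 3 + w 4)) / 3

set_option maxHeartbeats 2000000 in
/-- The pairing `magElec` determines the two Weyl parts up to a common factor. -/
theorem weyl_of_magElec_eq_zero (r s : Fin 6 → Fin 6 → ℝ)
    (h : ∀ x0 x1 x2 x3 : ℝ, magElec r s x0 x1 x2 x3 = 0) :
    (∀ i j, weylPlus r i * weylMinus s j = weylPlus s i * weylMinus r j) ∧
      weylInner (weylPlus r) (weylPlus s) = weylInner (weylMinus r) (weylMinus s) := by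
  simp only [magElec] at h
  have H : weylPlus r 0 * weylMinus s 0 = weylPlus s 0 * weylMinus r 0 ∧
      weylPlus r 0 * weylMinus s 1 = weylPlus s 0 * weylMinus r 1 ∧
      weylPlus r 0 * weylMinus s 2 = weylPlus s 0 * weylMinus r 2 ∧
      weylPlus r 0 * weylMinus s 3 = weylPlus s 0 * weylMinus r 3 ∧
      weylPlus r 0 * weylMinus s 4 = weylPlus s 0 * weylMinus r 4 ∧
      weylPlus r 1 * weylMinus s 0 = weylPlus s 1 * weylMinus r 0 ∧
      weylPlus r 1 * weylMinus s 1 = weylPlus s 1 * weylMinus r 1 ∧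
      weylPlus r 1 * weylMinus s 2 = weylPlus s 1 * weylMinus r 2 ∧
      weylPlus r 1 * weylMinus s 3 = weylPlus s 1 * weylMinus r 3 ∧
      weylPlus r 1 * weylMinus s 4 = weylPlus s 1 * weylMinus r 4 ∧
      weylPlus r 2 * weylMinus s 0 = weylPlus s 2 * weylMinus r 0 ∧
      weylPlus r 2 * weylMinus s 1 = weylPlus s 2 * weylMinus r 1 ∧
      weylPlus r 2 * weylMinus s 2 = weylPlus s 2 * weylMinus r 2 ∧
      weylPlus r 2 * weylMinus s 3 = weylPlus s 2 * weylMinus r 3 ∧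
      weylPlus r 2 * weylMinus s 4 = weylPlus s 2 * weylMinus r 4 ∧
      weylPlus r 3 * weylMinus s 0 = weylPlus s 3 * weylMinus r 0 ∧
      weylPlus r 3 * weylMinus s 1 = weylPlus s 3 * weylMinus r 1 ∧
      weylPlus r 3 * weylMinus s 2 = weylPlus s 3 * weylMinus r 2 ∧
      weylPlus r 3 * weylMinus s 3 = weylPlus s 3 * weylMinus r 3 ∧
      weylPlus r 3 * weylMinus s 4 = weylPlus s 3 * weylMinus r 4 ∧
      weylPlus r 4 * weylMinus s 0 = weylPlus s 4 * weylMinus r 0 ∧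
      weylPlus r 4 * weylMinus s 1 = weylPlus s 4 * weylMinus r 1 ∧
      weylPlus r 4 * weylMinus s 2 = weylPlus s 4 * weylMinus r 2 ∧
      weylPlus r 4 * weylMinus s 3 = weylPlus s 4 * weylMinus r 3 ∧
      weylPlus r 4 * weylMinus s 4 = weylPlus s 4 * weylMinus r 4 ∧
      weylInner (weylPlus r) (weylPlus s) = weylInner (weylMinus r) (weylMinus s) := by
    simp only [weylInner, weylPlus, weylMinus, Matrix.cons_val]
    generalize r 0 0 = r00 at h ⊢
    generalize s 0 0 = s00 at h ⊢
    generalize r 0 1 = r01 at h ⊢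
    generalize s 0 1 = s01 at h ⊢
    generalize r 0 2 = r02 at h ⊢
    generalize s 0 2 = s02 at h ⊢
    generalize r 0 3 = r03 at h ⊢
    generalize s 0 3 = s03 at h ⊢
    generalize r 0 4 = r04 at h ⊢
    generalize s 0 4 = s04 at h ⊢
    generalize r 0 5 = r05 at h ⊢
    generalize s 0 5 = s05 at h ⊢
    generalize r 1 1 = r11 at h ⊢
    generalize s 1 1 = s11 at h ⊢
    generalize r 1 2 = r12 at h ⊢
    generalize s 1 2 = s12 at h ⊢
    generalize r 1 3 = r13 at h ⊢
    generalize s 1 3 = s13 at h ⊢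
    generalize r 1 4 = r14 at h ⊢
    generalize s 1 4 = s14 at h ⊢
    generalize r 1 5 = r15 at h ⊢
    generalize s 1 5 = s15 at h ⊢
    generalize r 2 2 = r22 at h ⊢
    generalize s 2 2 = s22 at h ⊢
    generalize r 2 3 = r23 at h ⊢
    generalize s 2 3 = s23 at h ⊢
    generalize r 2 4 = r24 at h ⊢
    generalize s 2 4 = s24 at h ⊢
    generalize r 3 3 = r33 at h ⊢
    generalize s 3 3 = s33 at h ⊢
    generalize r 3 4 = r34 at h ⊢
    generalize s 3 4 = s34 at h ⊢
    generalize r 3 5 = r35 at h ⊢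
    generalize s 3 5 = s35 at h ⊢
    generalize r 4 4 = r44 at h ⊢
    generalize s 4 4 = s44 at h ⊢
    generalize r 4 5 = r45 at h ⊢
    generalize s 4 5 = s45 at h ⊢
    generalize r 5 5 = r55 at h ⊢
    generalize s 5 5 = s55 at h ⊢
    -- The quartic sorted by monomials.
    have h' : ∀ x0 x1 x2 x3 : ℝ, (s00 * r03 + s01 * r04 + s01 * r13 + s02 * r05 + s02 * r23 + s11 * r14 + s12 * r15 + s12 *
      r24 - s22 * r03 - s22 * r14) * (x0 ^ 4) + (-r01 * s02 + r02 * s01 - r11 * s12 + r12 * s11 -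
      r12 * s22 + r22 * s12 + s01 * r35 - s02 * r34 + s11 * r45 - s12 * r44 + s12 * r55 - s22 *
      r45 + 2 * r03 * s24 + r04 * s05 - r05 * s04 + r13 * s05 + 2 * r14 * s15 + 2 * r14 * s24 -
      r15 * s03 - 2 * r15 * s14 - r23 * s04 - r24 * s03 - 2 * r24 * s14) * (x0 ^ 3 * x1) + (r00 *
      s02 + r01 * s12 - r02 * s00 + r02 * s22 - r12 * s01 - r22 * s02 - s00 * r35 - s01 * r45 +
      s02 * r33 - s02 * r55 + s12 * r34 + s22 * r35 - 2 * r03 * s05 - 2 * r03 * s23 - r04 * s15 +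
      2 * r05 * s03 + r05 * s14 - r13 * s15 - 2 * r14 * s23 + r15 * s13 + 2 * r23 * s03 + r23 *
      s14 + r24 * s13) * (x0 ^ 3 * x2) + (-r00 * s01 + r01 * s00 - r01 * s11 - r02 * s12 + r11 *
      s01 + r12 * s02 + s00 * r34 - s01 * r33 + s01 * r44 + s02 * r45 - s11 * r34 - s12 * r35 + 2
      * r03 * s04 - r04 * s03 + r04 * s14 + r05 * s24 - r13 * s03 + r13 * s14 - 2 * r14 * s13 -
      r15 * s23 + r23 * s24 - r24 * s23) * (x0 ^ 3 * x3) + (r01 * s04 + r02 * s05 + r11 * s03 + 2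
      * r11 * s14 + 2 * r12 * s15 + 2 * r12 * s24 - r22 * s03 - 2 * r22 * s14 + 2 * s00 * r03 +
      s01 * r04 + s01 * r13 + s02 * r05 + s02 * r23 - s11 * r03 - s11 * r14 - s12 * r15 - s12 *
      r24 + s22 * r14 - r03 * s44 - r14 * s44 + r14 * s55 - r15 * s45 - r24 * s45 + s03 * r44 -
      s03 * r55 + s04 * r34 + s05 * r35 + 2 * s14 * r44 - 2 * s14 * r55 + 2 * s15 * r45 + 2 * s24
      * r45) * (x0 ^ 2 * x1 ^ 2) + (-r00 * s04 - 3 * r01 * s03 - 3 * r01 * s14 - r02 * s15 - 2 *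
      r02 * s24 - r11 * s13 - r12 * s05 - 2 * r12 * s23 + r22 * s04 + r22 * s13 + s00 * r04 + s00
      * r13 + 4 * s01 * r03 + 4 * s01 * r14 + 2 * s02 * r15 + 2 * s02 * r24 + s11 * r04 + s11 *
      r13 + 2 * s12 * r05 + 2 * s12 * r23 - s22 * r04 - s22 * r13 + 2 * r03 * s34 - r04 * s55 +
      r05 * s45 - r13 * s55 + 2 * r14 * s34 + r15 * s35 + r23 * s45 + r24 * s35 - 3 * s03 * r34 -
      s04 * r33 + s04 * r55 - s05 * r45 - s13 * r44 + s13 * r55 - 3 * s14 * r34 - s15 * r35 - 2 *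
      s23 * r45 - 2 * s24 * r35) * (x0 ^ 2 * x1 * x2) + (-r00 * s05 - 2 * r01 * s15 - r01 * s24 +
      3 * r02 * s14 + r11 * s05 + r11 * s23 - r12 * s04 - 2 * r12 * s13 - r22 * s23 + s00 * r05 +
      s00 * r23 + 2 * s01 * r15 + 2 * s01 * r24 - 4 * s02 * r14 - s11 * r05 - s11 * r23 + 2 * s12
      * r04 + 2 * s12 * r13 + s22 * r05 + s22 * r23 + r04 * s45 - r05 * s44 + r13 * s45 - 2 * r14
      * s35 + r15 * s34 - r23 * s44 + r24 * s34 - s04 * r45 - s05 * r33 + s05 * r44 - 2 * s13 *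
      r45 + 3 * s14 * r35 - 2 * s15 * r34 + s23 * r44 - s23 * r55 - s24 * r34) * (x0 ^ 2 * x1 *
      x3) + (2 * r00 * s03 + r00 * s14 + r01 * s13 + 2 * r02 * s05 + 2 * r02 * s23 + r12 * s15 - 2
      * r22 * s03 - r22 * s14 - s00 * r03 - s00 * r14 + s01 * r04 + s01 * r13 - s02 * r05 - s02 *
      r23 + 2 * s11 * r14 + s12 * r15 + s12 * r24 + s22 * r03 - r03 * s33 + r03 * s55 - r05 * s35
      - r14 * s33 - r23 * s35 + 2 * s03 * r33 - 2 * s03 * r55 + 2 * s05 * r35 + s13 * r34 + s14 *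
      r33 - s14 * r55 + s15 * r45 + 2 * s23 * r35) * (x0 ^ 2 * x2 ^ 2) + (r00 * s15 + r00 * s24 -
      2 * r01 * s05 - r01 * s23 - 2 * r02 * s04 - r02 * s13 - r11 * s15 + 3 * r12 * s03 - r22 *
      s24 - s00 * r15 - s00 * r24 + 2 * s01 * r05 + 2 * s01 * r23 + 2 * s02 * r04 + 2 * s02 * r13
      + s11 * r15 + s11 * r24 - 4 * s12 * r03 + s22 * r15 + s22 * r24 - 2 * r03 * s45 + r04 * s35
      + r05 * s34 + r13 * s35 - r15 * s33 + r23 * s34 - r24 * s33 + 3 * s03 * r45 - 2 * s04 * r35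
      - 2 * s05 * r34 - s13 * r35 + s15 * r33 - s15 * r44 - s23 * r34 + s24 * r33 - s24 * r55) *
      (x0 ^ 2 * x2 * x3) + (r00 * s03 - r00 * s14 + 2 * r01 * s04 + 2 * r01 * s13 + r02 * s23 -
      r11 * s03 + r11 * s14 + r12 * s24 + s00 * r14 - s01 * r04 - s01 * r13 + s02 * r05 + s02 *
      r23 + s11 * r03 + s12 * r15 + s12 * r24 - 2 * s22 * r03 - 2 * s22 * r14 + r03 * s44 - r04 *
      s34 - r13 * s34 + r14 * s33 + s03 * r33 - s03 * r44 + 2 * s04 * r34 + 2 * s13 * r34 - s14 *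
      r33 + s14 * r44 + s23 * r35 + s24 * r45) * (x0 ^ 2 * x3 ^ 2) + (-r01 * s02 + r02 * s01 + r11
      * s45 - r12 * s44 + r12 * s55 - r22 * s45 + s01 * r35 - s02 * r34 - 2 * r03 * s15 + r04 *
      s05 - r05 * s04 + r13 * s05 - 2 * r14 * s15 - 2 * r14 * s24 + r15 * s03 + 2 * r15 * s14 -
      r23 * s04 + r24 * s03 + 2 * r24 * s14 + r44 * s45 - r45 * s44 + r45 * s55 - r55 * s45) * (x0
      * x1 ^ 3) + (r00 * s02 - r01 * s12 - 2 * r01 * s45 - r02 * s00 + r02 * s11 + r02 * s44 - r02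
      * s55 - r11 * s02 - r11 * s35 + r12 * s01 + 2 * r12 * s34 + r22 * s35 - s00 * r35 + s01 *
      r45 + s02 * r33 - s02 * r44 + s11 * r35 - s12 * r34 + r04 * s15 + 2 * r04 * s24 - 3 * r05 *
      s14 + r13 * s15 + 2 * r13 * s24 + 4 * r14 * s05 + 2 * r14 * s23 - 2 * r15 * s04 - r15 * s13
      - 3 * r23 * s14 - 2 * r24 * s04 - r24 * s13 - 2 * r34 * s45 + r35 * s44 - r35 * s55 - r44 *
      s35 + 2 * r45 * s34 + r55 * s35) * (x0 * x1 ^ 2 * x2) + (-r00 * s01 + r01 * s00 - r01 * s22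
      + r01 * s44 - r01 * s55 + r02 * s12 + 2 * r02 * s45 - r11 * s34 - r12 * s02 - 2 * r12 * s35
      + r22 * s01 + r22 * s34 + s00 * r34 - s01 * r33 + s01 * r55 - s02 * r45 + s12 * r35 - s22 *
      r34 + 4 * r03 * s04 + 2 * r03 * s13 - 3 * r04 * s03 - 3 * r04 * s14 - 2 * r05 * s15 - r05 *
      s24 - 3 * r13 * s03 - 3 * r13 * s14 + 4 * r14 * s04 + 2 * r14 * s13 + 2 * r15 * s05 + r15 *
      s23 - 2 * r23 * s15 - r23 * s24 + 2 * r24 * s05 + r24 * s23 + r34 * s44 - r34 * s55 + 2 *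
      r35 * s45 - r44 * s34 - 2 * r45 * s35 + r55 * s34) * (x0 * x1 ^ 2 * x3) + (r00 * s12 + r00 *
      s45 + r01 * s02 + 2 * r01 * s35 - r02 * s01 - 2 * r02 * s34 - r11 * s12 - r12 * s00 + r12 *
      s11 - r12 * s33 + r12 * s55 - r22 * s45 - s00 * r45 - s01 * r35 + s02 * r34 + s11 * r45 +
      s12 * r33 - s12 * r44 - 4 * r03 * s15 - 2 * r03 * s24 - r04 * s05 - 2 * r04 * s23 + r05 *
      s04 + 2 * r05 * s13 - r13 * s05 - 2 * r13 * s23 + 3 * r15 * s03 + r23 * s04 + 2 * r23 * s13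
      + 3 * r24 * s03 + r33 * s45 + 2 * r34 * s35 - 2 * r35 * s34 - r45 * s33 + r45 * s55 - r55 *
      s45) * (x0 * x1 * x2 ^ 2) + (-r00 * s11 + r00 * s22 - r00 * s44 + r00 * s55 + r11 * s00 -
      r11 * s22 + r11 * s33 - r11 * s55 - r22 * s00 + r22 * s11 - r22 * s33 + r22 * s44 + s00 *
      r44 - s00 * r55 - s11 * r33 + s11 * r55 + s22 * r33 - s22 * r44 + 12 * r03 * s14 - 12 * r14
      * s03 - r33 * s44 + r33 * s55 + r44 * s33 - r44 * s55 - r55 * s33 + r55 * s44) * (x0 * x1 *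
      x2 * x3) + (-r00 * s12 - r00 * s45 + r01 * s02 + 2 * r01 * s35 - r02 * s01 - 2 * r02 * s34 +
      r11 * s45 + r12 * s00 - r12 * s22 + r12 * s33 - r12 * s44 + r22 * s12 + s00 * r45 - s01 *
      r35 + s02 * r34 - s12 * r33 + s12 * r55 - s22 * r45 + 2 * r03 * s15 + 4 * r03 * s24 - r04 *
      s05 - 2 * r04 * s23 + r05 * s04 + 2 * r05 * s13 - r13 * s05 - 2 * r13 * s23 - 3 * r15 * s03
      + r23 * s04 + 2 * r23 * s13 - 3 * r24 * s03 - r33 * s45 + 2 * r34 * s35 - 2 * r35 * s34 +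
      r44 * s45 + r45 * s33 - r45 * s44) * (x0 * x1 * x3 ^ 2) + (-r00 * s35 + r01 * s12 + r02 *
      s33 - r02 * s55 - r12 * s01 + r22 * s35 - s01 * r45 + s12 * r34 + 2 * r03 * s05 + 2 * r03 *
      s23 - r04 * s15 - 2 * r05 * s03 - r05 * s14 - r13 * s15 + 2 * r14 * s05 + r15 * s13 - 2 *
      r23 * s03 - r23 * s14 + r24 * s13 - r33 * s35 + r35 * s33 - r35 * s55 + r55 * s35) * (x0 *
      x2 ^ 3) + (r00 * s34 - r01 * s11 + r01 * s22 - r01 * s33 + r01 * s55 + r02 * s12 + 2 * r02 *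
      s45 + r11 * s01 - r12 * s02 - 2 * r12 * s35 - r22 * s01 - r22 * s34 + s01 * r44 - s01 * r55
      - s02 * r45 - s11 * r34 + s12 * r35 + s22 * r34 - 2 * r03 * s04 - 4 * r03 * s13 + 3 * r04 *
      s03 + 3 * r04 * s14 - 2 * r05 * s15 - r05 * s24 + 3 * r13 * s03 + 3 * r13 * s14 - 2 * r14 *
      s04 - 4 * r14 * s13 + 2 * r15 * s05 + r15 * s23 - 2 * r23 * s15 - r23 * s24 + 2 * r24 * s05
      + r24 * s23 + r33 * s34 - r34 * s33 + r34 * s55 + 2 * r35 * s45 - 2 * r45 * s35 - r55 * s34)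
      * (x0 * x2 ^ 2 * x3) + (-r00 * s35 - r01 * s12 - 2 * r01 * s45 - r02 * s11 + r02 * s22 + r02
      * s33 - r02 * s44 + r11 * s02 + r11 * s35 + r12 * s01 + 2 * r12 * s34 - r22 * s02 + s01 *
      r45 + s02 * r44 - s02 * r55 - s11 * r35 - s12 * r34 + s22 * r35 + r04 * s15 + 2 * r04 * s24
      + 3 * r05 * s14 + r13 * s15 + 2 * r13 * s24 - 2 * r14 * s05 - 4 * r14 * s23 - 2 * r15 * s04
      - r15 * s13 + 3 * r23 * s14 - 2 * r24 * s04 - r24 * s13 - r33 * s35 - 2 * r34 * s45 + r35 *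
      s33 - r35 * s44 + r44 * s35 + 2 * r45 * s34) * (x0 * x2 * x3 ^ 2) + (r00 * s34 - r01 * s33 +
      r01 * s44 - r02 * s12 - r11 * s34 + r12 * s02 + s02 * r45 - s12 * r35 - 2 * r03 * s13 + r04
      * s03 - r04 * s14 + r05 * s24 + r13 * s03 - r13 * s14 + 2 * r14 * s04 - r15 * s23 + r23 *
      s24 - r24 * s23 + r33 * s34 - r34 * s33 + r34 * s44 - r44 * s34) * (x0 * x3 ^ 3) + (r01 *
      s04 + r02 * s05 + s00 * r03 - r03 * s55 + r14 * s44 - r14 * s55 + r15 * s45 + r24 * s45 +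
      s04 * r34 + s05 * r35) * (x1 ^ 4) + (-r00 * s04 - r01 * s03 + r01 * s14 + r02 * s15 + r11 *
      s04 + r12 * s05 + s00 * r04 + s00 * r13 + 2 * s01 * r03 - r04 * s44 - r05 * s45 - r13 * s44
      - 2 * r14 * s34 - r15 * s35 - r23 * s45 - r24 * s35 - s03 * r34 - s04 * r33 + s04 * r44 +
      s05 * r45 + s14 * r34 + s15 * r35) * (x1 ^ 3 * x2) + (-r00 * s05 + r01 * s24 - 2 * r02 * s03
      - r02 * s14 + r12 * s04 + r22 * s05 + s00 * r05 + s00 * r23 + 2 * s02 * r03 + 2 * r03 * s35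
      - r04 * s45 - r05 * s55 - r13 * s45 + 2 * r14 * s35 - r15 * s34 - r23 * s55 - r24 * s34 - 2
      * s03 * r35 + s04 * r45 - s05 * r33 + s05 * r55 - s14 * r35 + s24 * r34) * (x1 ^ 3 * x3) +
      (r00 * s03 - r00 * s14 - r01 * s04 - r01 * s13 + r02 * s05 - r11 * s03 + r11 * s14 + r12 *
      s15 + s00 * r14 + 2 * s01 * r04 + 2 * s01 * r13 + s11 * r03 + r03 * s44 - 2 * r03 * s55 + 2
      * r04 * s34 + r05 * s35 + 2 * r13 * s34 + r14 * s33 - 2 * r14 * s55 + r15 * s45 + r23 * s35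
      + r24 * s45 + s03 * r33 - s03 * r44 - s04 * r34 + s05 * r35 - s13 * r34 - s14 * r33 + s14 *
      r44 + s15 * r45) * (x1 ^ 2 * x2 ^ 2) + (-r00 * s15 - r00 * s24 - 2 * r01 * s05 - r01 * s23 -
      2 * r02 * s04 - r02 * s13 + r11 * s24 - 3 * r12 * s03 + r22 * s15 + s00 * r15 + s00 * r24 +
      2 * s01 * r05 + 2 * s01 * r23 + 2 * s02 * r04 + 2 * s02 * r13 + 2 * s12 * r03 + 4 * r03 *
      s45 + r04 * s35 + r05 * s34 + r13 * s35 + r15 * s33 - r15 * s44 - r15 * s55 + r23 * s34 +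
      r24 * s33 - r24 * s44 - r24 * s55 - 3 * s03 * r45 - 2 * s04 * r35 - 2 * s05 * r34 - s13 *
      r35 - s15 * r33 + s15 * r55 - s23 * r34 - s24 * r33 + s24 * r44) * (x1 ^ 2 * x2 * x3) + (2 *
      r00 * s03 + r00 * s14 + r01 * s04 - r02 * s05 - r02 * s23 + r12 * s24 - 2 * r22 * s03 - r22
      * s14 - s00 * r03 - s00 * r14 + 2 * s02 * r05 + 2 * s02 * r23 + s22 * r03 - r03 * s33 + r03
      * s55 + r04 * s34 + 2 * r05 * s35 + r13 * s34 - r14 * s33 + 2 * r14 * s44 + r15 * s45 + 2 *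
      r23 * s35 + r24 * s45 + 2 * s03 * r33 - 2 * s03 * r55 + s04 * r34 - s05 * r35 + s14 * r33 -
      s14 * r55 - s23 * r35 + s24 * r45) * (x1 ^ 2 * x3 ^ 2) + (r00 * s13 + r01 * s03 - r01 * s14
      + r02 * s15 - r11 * s13 + r12 * s05 + 2 * s01 * r14 + s11 * r04 + s11 * r13 - 2 * r03 * s34
      - r04 * s33 - r05 * s45 - r13 * s33 - r15 * s35 - r23 * s45 - r24 * s35 + s03 * r34 + s05 *
      r45 + s13 * r33 - s13 * r44 - s14 * r34 + s15 * r35) * (x1 * x2 ^ 3) + (r00 * s23 - 2 * r01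
      * s15 - r01 * s24 - 3 * r02 * s14 - r11 * s05 - r11 * s23 - r12 * s04 - 2 * r12 * s13 + r22
      * s05 + 2 * s01 * r15 + 2 * s01 * r24 + 2 * s02 * r14 + s11 * r05 + s11 * r23 + 2 * s12 *
      r04 + 2 * s12 * r13 + r04 * s45 - r05 * s33 + r05 * s44 - r05 * s55 + r13 * s45 + 4 * r14 *
      s35 + r15 * s34 - r23 * s33 + r23 * s44 - r23 * s55 + r24 * s34 - s04 * r45 - s05 * r44 +
      s05 * r55 - 2 * s13 * r45 - 3 * s14 * r35 - 2 * s15 * r34 + s23 * r33 - s23 * r44 - s24 *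
      r34) * (x1 * x2 ^ 2 * x3) + (r00 * s13 + 3 * r01 * s03 + 3 * r01 * s14 - r02 * s15 - 2 * r02
      * s24 + r11 * s04 - r12 * s05 - 2 * r12 * s23 - r22 * s04 - r22 * s13 - 2 * s01 * r03 - 2 *
      s01 * r14 + 2 * s02 * r15 + 2 * s02 * r24 + 2 * s12 * r05 + 2 * s12 * r23 + s22 * r04 + s22
      * r13 - 4 * r03 * s34 - r04 * s33 - r04 * s44 + r04 * s55 + r05 * s45 - r13 * s33 - r13 *
      s44 + r13 * s55 - 4 * r14 * s34 + r15 * s35 + r23 * s45 + r24 * s35 + 3 * s03 * r34 + s04 *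
      r44 - s04 * r55 - s05 * r45 + s13 * r33 - s13 * r55 + 3 * s14 * r34 - s15 * r35 - 2 * s23 *
      r45 - 2 * s24 * r35) * (x1 * x2 * x3 ^ 2) + (r00 * s23 + r01 * s24 + 2 * r02 * s03 + r02 *
      s14 + r12 * s04 - r22 * s23 - 2 * s02 * r03 - 2 * s02 * r14 + s22 * r05 + s22 * r23 - 2 *
      r03 * s35 - r04 * s45 - r05 * s33 - r13 * s45 - r15 * s34 - r23 * s33 - r24 * s34 + 2 * s03
      * r35 + s04 * r45 + s14 * r35 + s23 * r33 - s23 * r55 + s24 * r34) * (x1 * x3 ^ 3) + (r01 *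
      s13 + r12 * s15 + s11 * r14 + r03 * s33 - r03 * s55 + r05 * s35 - r14 * s55 + r23 * s35 +
      s13 * r34 + s15 * r45) * (x2 ^ 4) + (r01 * s23 + r02 * s13 - r11 * s15 - r12 * s03 - 2 * r12
      * s14 + r22 * s15 + s11 * r15 + s11 * r24 + 2 * s12 * r14 + 2 * r03 * s45 - r04 * s35 - r05
      * s34 - r13 * s35 + 2 * r14 * s45 - r15 * s55 - r23 * s34 - r24 * s55 - s03 * r45 + s13 *
      r35 - 2 * s14 * r45 - s15 * r44 + s15 * r55 + s23 * r34) * (x2 ^ 3 * x3) + (r01 * s13 + r02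
      * s23 + r11 * s03 + 2 * r11 * s14 - r12 * s15 - r12 * s24 - r22 * s03 - 2 * r22 * s14 - s11
      * r03 - s11 * r14 + 2 * s12 * r15 + 2 * s12 * r24 + s22 * r14 + 2 * r03 * s33 - r03 * s44 +
      r04 * s34 + r05 * s35 + r13 * s34 - r14 * s44 + r14 * s55 + 2 * r15 * s45 + r23 * s35 + 2 *
      r24 * s45 + s03 * r44 - s03 * r55 + s13 * r34 + 2 * s14 * r44 - 2 * s14 * r55 - s15 * r45 +
      s23 * r35 - s24 * r45) * (x2 ^ 2 * x3 ^ 2) + (r01 * s23 + r02 * s13 + r11 * s24 + r12 * s03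
      + 2 * r12 * s14 - r22 * s24 - 2 * s12 * r03 - 2 * s12 * r14 + s22 * r15 + s22 * r24 - r04 *
      s35 - r05 * s34 - r13 * s35 - 2 * r14 * s45 - r15 * s44 - r23 * s34 - r24 * s44 + s03 * r45
      + s13 * r35 + 2 * s14 * r45 + s23 * r34 + s24 * r44 - s24 * r55) * (x2 * x3 ^ 3) + (r02 *
      s23 + r12 * s24 - s22 * r03 - s22 * r14 + r03 * s33 + r04 * s34 + r13 * s34 + r14 * s44 +
      s23 * r35 + s24 * r45) * (x3 ^ 4) = 0 := by
      intro x0 x1 x2 x3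
      rw [← h x0 x1 x2 x3]
      ring
    obtain ⟨h0000, h0001, h0002, h0003, h0011, h0012, h0013, h0022, h0023, h0033, h0111, h0112, h0113,
      h0122, h0123, h0133, h0222, h0223, h0233, h0333, h1111, h1112, h1113, h1122, h1123, h1133,
      h1222, h1223, h1233, h1333, h2222, h2223, h2233, h2333, h3333⟩ := quartic_coeff_eq_zero h'
    clear h h'
    -- The relations are linear in the 35 coefficients. The first 25 are read off the harmonic part
    -- of the quartic, which under rotations is the tensor product of the two Weyl representations.
    -- The last one is, up to a factor, the twofold Laplacian of the quartic.
    refine ⟨?_, ?_, ?_, ?_, ?_, ?_, ?_, ?_, ?_, ?_, ?_, ?_, ?_, ?_, ?_, ?_, ?_, ?_, ?_, ?_, ?_, ?_, ?_,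
      ?_, ?_, ?_⟩
    · linear_combination (1/2) * h0000 + (-1/2) * h0033 + (-1/2) * h1111 + (1/2) * h1122 + (-1/2) * h2222 + (1/2) *
        h3333
    · linear_combination (1/4) * h0002 + (1/4) * h0013 + (-1/4) * h0112 + (1/4) * h0222 + (-1/4) * h0233 + (-1/4) *
        h1113 + (1/4) * h1223 + (-1/4) * h1333
    · linear_combination (-1/4) * h0001 + (1/4) * h0023 + (-1/4) * h0111 + (1/4) * h0122 + (1/4) * h0133 + (1/4) *
        h1123 + (-1/4) * h2223 + (-1/4) * h2333
    · linear_combination h0003 + (-1) * h0333 + h1112 + (-1) * h1222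
    · linear_combination (-1/2) * h0003 + (1/2) * h0012 + (1/2) * h0113 + (-1/2) * h0223 + (1/2) * h0333 + (-1/2) *
        h1112 + (1/2) * h1222 + (-1/2) * h1233
    · linear_combination (-1/4) * h0002 + (1/4) * h0013 + (1/4) * h0112 + (-1/4) * h0222 + (1/4) * h0233 + (-1/4) *
        h1113 + (1/4) * h1223 + (-1/4) * h1333
    · linear_combination (1/2) * h0000 + (-1/2) * h0011 + (1/2) * h1111 + (-1/2) * h2222 + (1/2) * h2233 + (-1/2) *
        h3333
    · linear_combination (1/4) * h0003 + (1/4) * h0012 + (-1/4) * h0113 + (-1/4) * h0223 + (1/4) * h0333 + (-1/4) *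
        h1112 + (-1/4) * h1222 + (1/4) * h1233
    · linear_combination (-1/2) * h0001 + (-1/2) * h0023 + (1/2) * h0111 + (-1/2) * h0122 + (1/2) * h0133 + (1/2) *
        h1123 + (-1/2) * h2223 + (1/2) * h2333
    · linear_combination h0001 + (-1) * h0111 + h2223 + (-1) * h2333
    · linear_combination (1/4) * h0001 + (1/4) * h0023 + (1/4) * h0111 + (-1/4) * h0122 + (-1/4) * h0133 + (1/4) *
        h1123 + (-1/4) * h2223 + (-1/4) * h2333
    · linear_combination (-1/4) * h0003 + (1/4) * h0012 + (1/4) * h0113 + (1/4) * h0223 + (-1/4) * h0333 + (-1/4) *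
        h1112 + (-1/4) * h1222 + (1/4) * h1233
    · linear_combination (1/2) * h0000 + (-1/2) * h0022 + (-1/2) * h1111 + (1/2) * h1133 + (1/2) * h2222 + (-1/2) *
        h3333
    · linear_combination (-1/2) * h0002 + (1/2) * h0013 + (-1/2) * h0112 + (1/2) * h0222 + (1/2) * h0233 + (1/2) *
        h1113 + (-1/2) * h1223 + (-1/2) * h1333
    · linear_combination (-1/2) * h0002 + (-1/2) * h0013 + (1/2) * h0112 + (1/2) * h0222 + (-1/2) * h0233 + (1/2) *
        h1113 + (1/2) * h1223 + (-1/2) * h1333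
    · linear_combination (-1) * h0003 + h0333 + h1112 + (-1) * h1222
    · linear_combination (1/2) * h0001 + (-1/2) * h0023 + (-1/2) * h0111 + (1/2) * h0122 + (-1/2) * h0133 + (1/2) *
        h1123 + (-1/2) * h2223 + (1/2) * h2333
    · linear_combination (1/2) * h0002 + (1/2) * h0013 + (1/2) * h0112 + (-1/2) * h0222 + (-1/2) * h0233 + (1/2) *
        h1113 + (-1/2) * h1223 + (-1/2) * h1333
    · linear_combination 2 * h0000 + (-2) * h0033 + 2 * h1111 + (-2) * h1122 + 2 * h2222 + 2 * h3333
    · linear_combination (-1) * h0000 + h0011 + (-1) * h0022 + h0033 + (-1) * h0123 + (-1) * h1111 + h1122 + (-1) *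
        h1133 + (-1) * h2222 + h2233 + (-1) * h3333
    · linear_combination (1/2) * h0003 + (1/2) * h0012 + (-1/2) * h0113 + (1/2) * h0223 + (-1/2) * h0333 + (-1/2) *
        h1112 + (1/2) * h1222 + (-1/2) * h1233
    · linear_combination (-1) * h0001 + h0111 + h2223 + (-1) * h2333
    · linear_combination (1/2) * h0002 + (-1/2) * h0013 + (-1/2) * h0112 + (-1/2) * h0222 + (1/2) * h0233 + (1/2) *
        h1113 + (1/2) * h1223 + (-1/2) * h1333
    · linear_combination (-1) * h0000 + h0011 + (-1) * h0022 + h0033 + h0123 + (-1) * h1111 + h1122 + (-1) * h1133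
        + (-1) * h2222 + h2233 + (-1) * h3333
    · linear_combination 2 * h0000 + (-2) * h0011 + 2 * h1111 + 2 * h2222 + (-2) * h2233 + 2 * h3333
    · linear_combination 2 * h0000 + (2/3) * h0011 + (2/3) * h0022 + (2/3) * h0033 + 2 * h1111 + (2/3) * h1122 +
        (2/3) * h1133 + 2 * h2222 + (2/3) * h2233 + 2 * h3333
  obtain ⟨a00, a01, a02, a03, a04, a10, a11, a12, a13, a14, a20, a21, a22, a23, a24, a30, a31, a32, a33,
    a34, a40, a41, a42, a43, a44, b⟩ := H
  refine ⟨fun i j => ?_, b⟩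
  fin_cases i <;> fin_cases j
  exacts [a00, a01, a02, a03, a04, a10, a11, a12, a13, a14, a20, a21, a22, a23, a24, a30, a31, a32, a33,
    a34, a40, a41, a42, a43, a44]

end Weyl

end KSVariety

namespace KSVariety

/-! ### Curvature tensors as symmetric matrices on bivectors -/

section CurvatureOperator

variable {V : Type*} [NormedAddCommGroup V] [InnerProductSpace ℝ V]

/-- First entry of the basis bivectors `01, 02, 03, 23, 31, 12`. -/
def pairFst : Fin 6 → Fin 4 := ![0, 0, 0, 2, 3, 1]

/-- Second entry of the basis bivectors. -/
def pairSnd : Fin 6 → Fin 4 := ![1, 2, 3, 3, 1, 2]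

/-- The matrix of a curvature tensor as a bilinear form on bivectors. -/
noncomputable def pairMatrix (e : OrthonormalBasis (Fin 4) ℝ V) (R : Tensor4 V) (p q : Fin 6) : ℝ :=
  R (e (pairFst p)) (e (pairSnd p)) (e (pairFst q)) (e (pairSnd q))

theorem IsAlgCurv.pairMatrix_symm {R : Tensor4 V} (hR : IsAlgCurv R)
    (e : OrthonormalBasis (Fin 4) ℝ V) (p q : Fin 6) : pairMatrix e R q p = pairMatrix e R p q :=
  hR.pair_symm _ _ _ _

theorem IsAlgCurv.pairMatrix_bianchi {R : Tensor4 V} (hR : IsAlgCurv R)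
    (e : OrthonormalBasis (Fin 4) ℝ V) :
    pairMatrix e R 2 5 = - pairMatrix e R 0 3 - pairMatrix e R 1 4 := by
  have h := hR.bianchi (e 0) (e 1) (e 2) (e 3)
  simp only [pairMatrix, pairFst, pairSnd, Matrix.cons_val]
  linarith

theorem IsAlgCurv.expand {R : Tensor4 V} (hR : IsAlgCurv R) (e : OrthonormalBasis (Fin 4) ℝ V)
    (a b c d : V) : R a b c d = ∑ p, wedgeCoord e a b (pairFst p) (pairSnd p)
      * ∑ q, wedgeCoord e c d (pairFst q) (pairSnd q) * pairMatrix e R p q := by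
  have h1 := antisymm_expand e (curvForm R c d) (fun a b => hR.antisymm_left a b c d) a b
  have h2 := fun i j => antisymm_expand e (R (e i) (e j)) (fun c d => hR.antisymm_right _ _ c d) c d
  simp only [curvForm_apply] at h1
  rw [h1]
  simp only [h2, Fin.sum_univ_six, pairMatrix, pairFst, pairSnd, Matrix.cons_val]

theorem starTrace_curvOp (e : OrthonormalBasis (Fin 4) ℝ V) (R R' : Tensor4 V) (x : V) :
    starTrace e R x (curvOp e R' x)
      = ∑ i, ∑ j, R' x (e i) x (e j) * starPair e (curvForm R x (e j)) x (e i) := by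
  refine Finset.sum_congr rfl fun i _ => ?_
  simp only [curvOp_apply, starPair, curvForm_apply, map_add, map_smul, smul_eq_mul,
    Fin.sum_univ_four]
  ring

/-- In the chosen order of the bivectors the Hodge star is addition of `3` modulo `6`. -/
theorem IsAlgCurv.starPair_expand {R : Tensor4 V} (hR : IsAlgCurv R)
    (e : OrthonormalBasis (Fin 4) ℝ V) (x v c d : V) : starPair e (curvForm R c d) x v =
      ∑ p : Fin 6, wedgeCoord e x v (pairFst (p + 3)) (pairSnd (p + 3))
      * ∑ q, wedgeCoord e c d (pairFst q) (pairSnd q) * pairMatrix e R p q := by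
  have h2 := fun i j => antisymm_expand e (R (e i) (e j)) (fun c d => hR.antisymm_right _ _ c d) c d
  simp only [starPair, curvForm_apply, h2, Fin.sum_univ_six, pairMatrix, pairFst, pairSnd,
    Matrix.cons_val, Fin.reduceAdd, zero_add]

set_option maxHeartbeats 2000000 in
theorem starTrace_eq_magElec {R R' : Tensor4 V} (hR : IsAlgCurv R) (hR' : IsAlgCurv R')
    (e : OrthonormalBasis (Fin 4) ℝ V) (x0 x1 x2 x3 : ℝ) :
    starTrace e R (x0 • e 0 + x1 • e 1 + x2 • e 2 + x3 • e 3)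
      (curvOp e R' (x0 • e 0 + x1 • e 1 + x2 • e 2 + x3 • e 3))
      = magElec (pairMatrix e R) (pairMatrix e R') x0 x1 x2 x3 := by
  rw [starTrace_curvOp]
  set x := x0 • e 0 + x1 • e 1 + x2 • e 2 + x3 • e 3 with hx
  have c0 : inner ℝ (e 0) x = x0 := by simp [hx, inner_add_right, inner_smul_right, e.inner_eq_ite]
  have c1 : inner ℝ (e 1) x = x1 := by simp [hx, inner_add_right, inner_smul_right, e.inner_eq_ite]
  have c2 : inner ℝ (e 2) x = x2 := by simp [hx, inner_add_right, inner_smul_right, e.inner_eq_ite]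
  have c3 : inner ℝ (e 3) x = x3 := by simp [hx, inner_add_right, inner_smul_right, e.inner_eq_ite]
  simp only [hR'.expand e, hR.starPair_expand e]
  have hs := hR.pairMatrix_symm e
  have hs' := hR'.pairMatrix_symm e
  have hb := hR.pairMatrix_bianchi e
  have hb' := hR'.pairMatrix_bianchi e
  generalize pairMatrix e R = r at *
  generalize pairMatrix e R' = s at *
  simp only [Fin.sum_univ_six, Fin.sum_univ_four, wedgeCoord, pairFst, pairSnd, Matrix.cons_val,
    Fin.reduceAdd, zero_add, c0, c1, c2, c3, e.inner_eq_ite, Fin.reduceEq, if_true, if_false, mul_one, mul_zero,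
    sub_zero, zero_sub, add_zero, zero_add, zero_mul]
  simp only [hs 0 1, hs 0 2, hs 0 3, hs 0 4, hs 0 5, hs 1 2, hs 1 3, hs 1 4, hs 1 5, hs 2 3, hs 2
    4, hs 2 5, hs 3 4, hs 3 5, hs 4 5, hs' 0 1, hs' 0 2, hs' 0 3, hs' 0 4, hs' 0 5, hs' 1 2, hs' 1
    3, hs' 1 4, hs' 1 5, hs' 2 3, hs' 2 4, hs' 2 5, hs' 3 4, hs' 3 5, hs' 4 5, hb, hb']
  clear hs hs' hb hb'
  unfold magElec
  ring

end CurvatureOperator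

end KSVariety

namespace KSVariety

/-! ### Members of a Stäckel system with vanishing Weyl tensor -/

section WeylFree

variable {V : Type*} [NormedAddCommGroup V] [InnerProductSpace ℝ V]

/-- The self-dual and the anti-self-dual Weyl part of the curvature tensor vanish. -/
def IsWeylFree (e : OrthonormalBasis (Fin 4) ℝ V) (R : Tensor4 V) : Prop :=
  weylPlus (pairMatrix e R) = 0 ∧ weylMinus (pairMatrix e R) = 0

theorem weylPlus_add_smul (e : OrthonormalBasis (Fin 4) ℝ V) (R R' : Tensor4 V) (c : ℝ) (i : Fin 5) :
    weylPlus (pairMatrix e (R + c • R')) i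
      = weylPlus (pairMatrix e R) i + c * weylPlus (pairMatrix e R') i := by
  fin_cases i <;> simp [weylPlus, pairMatrix] <;> ring

theorem eq_zero_of_weylInner_self {v : Fin 5 → ℝ} (h : weylInner v v = 0) : v = 0 := by
  simp only [weylInner] at h
  have h' : v 0 ^ 2 + v 1 ^ 2 + v 2 ^ 2 + v 3 ^ 2 + v 4 ^ 2 ≤ 0 := by
    nlinarith [sq_nonneg (v 0), sq_nonneg (v 1), sq_nonneg (v 2), sq_nonneg (v 3 + v 4),
      sq_nonneg (v 3), sq_nonneg (v 4)]
  funext i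
  have : v i ^ 2 ≤ 0 := by
    fin_cases i <;> simp only [Fin.zero_eta, Fin.mk_one, Fin.reduceFinMk] <;>
      linarith [sq_nonneg (v 0), sq_nonneg (v 1), sq_nonneg (v 2), sq_nonneg (v 3), sq_nonneg (v 4)]
  exact pow_eq_zero_iff two_ne_zero |>.mp (le_antisymm this (sq_nonneg _))

theorem weylInner_zero_left (v : Fin 5 → ℝ) : weylInner 0 v = 0 := by
  simp [weylInner]

/-- `R` is the Kulkarni-Nomizu product of `h` and the metric. -/
def IsKulkarniNomizu (h : V →ₗ[ℝ] V) (R : Tensor4 V) : Prop :=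
  ∀ a b c d, R a b c d = inner ℝ (h a) c * inner ℝ b d - inner ℝ (h a) d * inner ℝ b c
    + inner ℝ a c * inner ℝ (h b) d - inner ℝ a d * inner ℝ (h b) c

/-- The endomorphism with a given matrix in an orthonormal basis. -/
noncomputable def ofMatrix (e : OrthonormalBasis (Fin 4) ℝ V) (H : Fin 4 → Fin 4 → ℝ) : V →ₗ[ℝ] V :=
  ∑ i, ∑ j, H i j • (innerₛₗ ℝ (e j)).smulRight (e i)

theorem inner_ofMatrix (e : OrthonormalBasis (Fin 4) ℝ V) (H : Fin 4 → Fin 4 → ℝ) (a c : V) :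
    inner ℝ (ofMatrix e H a) c = ∑ i, ∑ j, H i j * (inner ℝ (e j) a * inner ℝ (e i) c) := by
  simp [ofMatrix, LinearMap.sum_apply, sum_inner, inner_smul_left]

set_option maxHeartbeats 1000000 in
-- Without its Weyl part a curvature tensor is determined by its Ricci tensor. The endomorphism is
-- the Schouten tensor, recovered here from `R(eᵢ, eⱼ, eᵢ, eⱼ) = Hᵢᵢ + Hⱼⱼ` and `R(eᵢ, eₖ, eⱼ, eₖ) =
-- Hᵢⱼ`.
theorem IsWeylFree.exists_isKulkarniNomizu {e : OrthonormalBasis (Fin 4) ℝ V} {R : Tensor4 V}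
    (hR : IsAlgCurv R) (hW : IsWeylFree e R) :
    ∃ h : V →ₗ[ℝ] V, h.IsSymmetric ∧ IsKulkarniNomizu h R := by
  have hs := hR.pairMatrix_symm e
  have hb := hR.pairMatrix_bianchi e
  have hx := hR.expand e
  obtain ⟨hp, hm⟩ := hW
  have p0 := congrFun hp 0
  have p1 := congrFun hp 1
  have p2 := congrFun hp 2
  have p3 := congrFun hp 3
  have p4 := congrFun hp 4
  have m0 := congrFun hm 0
  have m1 := congrFun hm 1
  have m2 := congrFun hm 2
  have m3 := congrFun hm 3
  have m4 := congrFun hm 4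
  simp only [weylPlus, weylMinus, Matrix.cons_val, Pi.zero_apply] at p0 p1 p2 p3 p4 m0 m1 m2 m3 m4
  clear hp hm
  generalize pairMatrix e R = r at *
  have e34 : r 3 4 = - r 0 1 := by linarith
  have e13 : r 1 3 = - r 0 4 := by linarith
  have e45 : r 4 5 = - r 1 2 := by linarith
  have e24 : r 2 4 = - r 1 5 := by linarith
  have e35 : r 3 5 = - r 0 2 := by linarith
  have e23 : r 2 3 = - r 0 5 := by linarith
  have e03 : r 0 3 = 0 := by linarith
  have e14 : r 1 4 = 0 := by linarith
  have e25 : r 2 5 = 0 := by linarith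
  have e44 : r 4 4 = r 0 0 + r 3 3 - r 1 1 := by linarith
  have e55 : r 5 5 = r 0 0 + r 3 3 - r 2 2 := by linarith
  -- This is `H₀₀`, since `r 1 1 + r 2 2 - r 3 3 = (H₀₀ + H₂₂) + (H₀₀ + H₃₃) - (H₂₂ + H₃₃)`.
  let m := (r 0 0 + r 1 1 + r 2 2 - (r 0 0 + r 3 3)) / 2
  let H : Fin 4 → Fin 4 → ℝ := ![![m, r 1 5, - r 0 5, r 0 4], ![r 1 5, r 0 0 - m, r 0 1, r 0 2],
    ![- r 0 5, r 0 1, r 1 1 - m, r 1 2], ![r 0 4, r 0 2, r 1 2, r 2 2 - m]]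
  have hH : ∀ i j, H i j = H j i := by
    intro i j; fin_cases i <;> fin_cases j <;> rfl
  refine ⟨ofMatrix e H, fun v w => ?_, fun a b c d => ?_⟩
  · rw [real_inner_comm _ v, inner_ofMatrix, inner_ofMatrix, Finset.sum_comm]
    exact Finset.sum_congr rfl fun i _ => Finset.sum_congr rfl fun j _ => by rw [hH]; ring
  · rw [hx, inner_eq_coord e b d, inner_eq_coord e b c, inner_eq_coord e a c, inner_eq_coord e a d]
    simp only [inner_ofMatrix, Fin.sum_univ_six, Fin.sum_univ_four, wedgeCoord, pairFst, pairSnd,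
      Matrix.cons_val, H, hs 0 1, hs 0 2, hs 0 3, hs 0 4, hs 0 5, hs 1 2, hs 1 3, hs 1 4, hs 1 5,
      hs 2 3, hs 2 4, hs 2 5, hs 3 4, hs 3 5, hs 4 5, e34, e13, e45, e24, e35, e23, e03, e14, e25,
      e44, e55]
    simp only [m]
    generalize r 0 0 = r00
    generalize r 1 1 = r11
    generalize r 2 2 = r22
    generalize r 3 3 = r33
    generalize r 0 1 = r01
    generalize r 0 2 = r02
    generalize r 1 2 = r12
    generalize r 0 4 = r04
    generalize r 0 5 = r05
    generalize r 1 5 = r15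
    ring

variable [Fact (finrank ℝ V = 3 + 1)]

theorem IsStaeckelSystem.weyl {S : Submodule ℝ (EndField V)} (hS : IsStaeckelSystem S)
    {K K' : EndField V} (hK : K ∈ S) (hK' : K' ∈ S) {R R' : Tensor4 V} (hR : IsCurvOf K R)
    (hR' : IsCurvOf K' R') (e : OrthonormalBasis (Fin 4) ℝ V) :
    (∀ i j, weylPlus (pairMatrix e R) i * weylMinus (pairMatrix e R') j
      = weylPlus (pairMatrix e R') i * weylMinus (pairMatrix e R) j) ∧
    weylInner (weylPlus (pairMatrix e R)) (weylPlus (pairMatrix e R'))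
      = weylInner (weylMinus (pairMatrix e R)) (weylMinus (pairMatrix e R')) :=
  weyl_of_magElec_eq_zero _ _ fun x0 x1 x2 x3 => by
    rw [← starTrace_eq_magElec hR.1 hR'.1, hS.starTrace_eq_zero hK hK' hR hR']

/-- The second Weyl relation for a tensor and itself says that its two Weyl parts have the same
norm. -/
theorem IsStaeckelSystem.isWeylFree_of_weylPlus {S : Submodule ℝ (EndField V)}
    (hS : IsStaeckelSystem S) {K : EndField V} (hK : K ∈ S) {R : Tensor4 V} (hR : IsCurvOf K R)
    {e : OrthonormalBasis (Fin 4) ℝ V} (h : weylPlus (pairMatrix e R) = 0) : IsWeylFree e R := by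
  refine ⟨h, eq_zero_of_weylInner_self ?_⟩
  rw [← (hS.weyl hK hK hR hR e).2, h, weylInner_zero_left]

theorem IsStaeckelSystem.isWeylFree_of_weylMinus {S : Submodule ℝ (EndField V)}
    (hS : IsStaeckelSystem S) {K : EndField V} (hK : K ∈ S) {R : Tensor4 V} (hR : IsCurvOf K R)
    {e : OrthonormalBasis (Fin 4) ℝ V} (h : weylMinus (pairMatrix e R) = 0) : IsWeylFree e R := by
  refine ⟨eq_zero_of_weylInner_self ?_, h⟩
  rw [(hS.weyl hK hK hR hR e).2, h, weylInner_zero_left]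

/-- Up to multiples of one member, the members of a Stäckel system have vanishing Weyl tensor. -/
theorem IsStaeckelSystem.exists_isWeylFree {S : Submodule ℝ (EndField V)}
    (hS : IsStaeckelSystem S) (e : OrthonormalBasis (Fin 4) ℝ V) :
    ∃ K₀ ∈ S, ∀ K ∈ S, ∃ c : ℝ, ∃ R, IsCurvOf (K + c • K₀) R ∧ IsWeylFree e R := by
  by_cases h : ∀ K ∈ S, ∀ R, IsCurvOf K R → weylPlus (pairMatrix e R) = 0
  · refine ⟨0, S.zero_mem, fun K hK => ⟨0, ?_⟩⟩
    obtain ⟨R, hR⟩ := (hS.killing K hK).exists_isCurvOf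
    refine ⟨R, by simpa using hR, hS.isWeylFree_of_weylPlus hK hR (h K hK R hR)⟩
  push Not at h
  obtain ⟨K₀, hK₀, R₀, hR₀, h0⟩ := h
  refine ⟨K₀, hK₀, fun K hK => ?_⟩
  obtain ⟨R, hR⟩ := (hS.killing K hK).exists_isCurvOf
  obtain ⟨i, hi⟩ := Function.ne_iff.mp h0
  rw [Pi.zero_apply] at hi
  -- Chosen to cancel the entry `i` of the self-dual part. As that entry of `R₀` is nonzero, the
  -- first Weyl relation then kills the whole anti-self-dual part.
  set c := - weylPlus (pairMatrix e R) i / weylPlus (pairMatrix e R₀) i with hc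
  have hmem : K + c • K₀ ∈ S := S.add_mem hK (S.smul_mem c hK₀)
  have hR' : IsCurvOf (K + c • K₀) (R + c • R₀) := hR.add (hR₀.smul c)
  refine ⟨c, R + c • R₀, hR', hS.isWeylFree_of_weylMinus hmem hR' (funext fun j => ?_)⟩
  have h1 := (hS.weyl hK₀ hmem hR₀ hR' e).1 i j
  have h2 : weylPlus (pairMatrix e (R + c • R₀)) i = 0 := by
    rw [weylPlus_add_smul, hc]
    field_simp
    ring
  rw [h2, zero_mul] at h1
  exact (mul_eq_zero.mp h1).resolve_left hi

theorem IsKulkarniNomizu.eq_smul_tangentProj {K : EndField V} (hK : IsSymField K) {R : Tensor4 V}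
    (hR : IsCurvOf K R) {c : ℝ} (h : IsKulkarniNomizu (c • LinearMap.id) R) :
    K = (2 * c) • tangentProj := by
  funext x
  ext1 v
  refine ext_inner_right ℝ fun w => ?_
  rw [hR.inner_eq hK, h]
  have hx : inner ℝ (x : V) (x : V) = (1 : ℝ) := by
    rw [real_inner_self_eq_norm_sq, norm_eq_of_mem_sphere x, one_pow]
  simp only [LinearMap.smul_apply, LinearMap.id_apply, inner_smul_left, Pi.smul_apply,
    smul_apply, tangentProj_apply, inner_sub_left, hx, RCLike.conj_to_real,
    real_inner_comm (x : V) v]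
  ring

/-- A Stäckel system contains the Kulkarni-Nomizu product of the metric and an endomorphism which is
not a multiple of the identity. -/
theorem IsStaeckelSystem.exists_kulkarniNomizu {S : Submodule ℝ (EndField V)}
    (hS : IsStaeckelSystem S) (e : OrthonormalBasis (Fin 4) ℝ V) :
    ∃ K₀ ∈ S, (∀ K ∈ S, ∃ c : ℝ, ∃ R, IsCurvOf (K + c • K₀) R ∧
      ∃ h : V →ₗ[ℝ] V, h.IsSymmetric ∧ IsKulkarniNomizu h R) ∧
    ∃ K ∈ S, ∃ R, IsCurvOf K R ∧ ∃ h : V →ₗ[ℝ] V, h.IsSymmetric ∧ IsKulkarniNomizu h R ∧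
      ∀ c : ℝ, h ≠ c • LinearMap.id := by
  classical
  obtain ⟨K₀, hK₀, h⟩ := hS.exists_isWeylFree e
  have h' : ∀ K ∈ S, ∃ c : ℝ, ∃ R, IsCurvOf (K + c • K₀) R ∧
      ∃ h : V →ₗ[ℝ] V, h.IsSymmetric ∧ IsKulkarniNomizu h R := fun K hK => by
    obtain ⟨c, R, hR, hW⟩ := h K hK
    exact ⟨c, R, hR, hW.exists_isKulkarniNomizu hR.1⟩
  refine ⟨K₀, hK₀, h', ?_⟩
  by_contra hcon
  push Not at hcon
  -- If every such endomorphism were a multiple of the identity, the system would be spanned by `K₀`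
  -- and the metric, against its dimension three.
  have hle : S ≤ Submodule.span ℝ {K₀, tangentProj} := fun K hK => by
    obtain ⟨c, R, hR, η, hη, hKN⟩ := h' K hK
    have hmem : K + c • K₀ ∈ S := S.add_mem hK (S.smul_mem c hK₀)
    obtain ⟨d, rfl⟩ := hcon _ hmem R hR η hη hKN
    have := hKN.eq_smul_tangentProj (hS.killing _ hmem).1 hR
    rw [Submodule.mem_span_pair]
    exact ⟨-c, 2 * d, by rw [← this]; simp⟩
  have hfin : Module.Finite ℝ (Submodule.span ℝ ({K₀, tangentProj} : Set (EndField V))) :=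
    FiniteDimensional.span_of_finite ℝ (Set.toFinite _)
  have h1 := Submodule.finrank_mono hle
  have h2 := finrank_span_le_card (R := ℝ) ({K₀, tangentProj} : Set (EndField V))
  have h3 : ({K₀, tangentProj} : Set (EndField V)).toFinset.card ≤ 2 := by
    rw [show ({K₀, tangentProj} : Set (EndField V)).toFinset = {K₀, tangentProj} by simp]
    exact Finset.card_le_two
  have := hS.finrank_eq
  omega

end WeylFree

end KSVariety

namespace KSVariety

/-! ### Simultaneous diagonalisation -/

section Diagonalisation

variable {V : Type*} [NormedAddCommGroup V] [InnerProductSpace ℝ V]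

/-- Two symmetric operators have a common basis of which the first operator is diagonal and the second
one is diagonal on each eigenspace of the first one. -/
theorem exists_eigenbasis_compression [FiniteDimensional ℝ V] {n : ℕ} (hn : finrank ℝ V = n)
    {h ρ : V →ₗ[ℝ] V} (hh : h.IsSymmetric) (hρ : ρ.IsSymmetric) :
    ∃ (f : OrthonormalBasis (Fin n) ℝ V) (μ : Fin n → ℝ), (∀ i, h (f i) = μ i • f i) ∧
      ∀ i j, i ≠ j → μ i = μ j → inner ℝ (ρ (f i)) (f j) = (0 : ℝ) := by
  classical
  let E : End.Eigenvalues h → Submodule ℝ V := fun μ => End.eigenspace h μ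
  -- The compressions of `ρ` to the eigenspaces of `h` are symmetric. Their eigenbases together form
  -- an eigenbasis of `h`.
  let comp : ∀ μ, E μ →ₗ[ℝ] E μ := fun μ =>
    ((E μ).orthogonalProjectionOnto : V →ₗ[ℝ] E μ) ∘ₗ ρ ∘ₗ (E μ).subtype
  have hcomp : ∀ μ (v w : E μ), inner ℝ (comp μ v) w = (inner ℝ (ρ v) (w : V) : ℝ) := fun μ v w => by
    simp [comp]
  have hsymm : ∀ μ, (comp μ).IsSymmetric := fun μ v w => by
    rw [hcomp, hρ, real_inner_comm, ← hcomp, real_inner_comm]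
  let b := hh.direct_sum_isInternal.collectedOrthonormalBasis hh.orthogonalFamily_eigenspaces'
    (fun μ => (hsymm μ).eigenvectorBasis rfl)
  have hb : ∀ a, b a = ((hsymm a.1).eigenvectorBasis rfl a.2 : V) := fun a => by
    simp [b, DirectSum.IsInternal.collectedOrthonormalBasis]
  have hcard : Fintype.card (Σ μ, Fin (finrank ℝ (E μ))) = n := by
    rw [← hn, finrank_eq_card_basis b.toBasis]
  let g := Fintype.equivFinOfCardEq hcard
  refine ⟨b.reindex g, fun i => ((g.symm i).1 : ℝ), fun i => ?_, fun i j hij hμ => ?_⟩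
  · rw [OrthonormalBasis.reindex_apply]
    have := hh.direct_sum_isInternal.collectedOrthonormalBasis_mem hh.orthogonalFamily_eigenspaces'
      (fun μ => (hsymm μ).eigenvectorBasis rfl) (g.symm i)
    exact End.mem_eigenspace_iff.mp this
  · simp only [OrthonormalBasis.reindex_apply]
    have hne : g.symm i ≠ g.symm j := fun h => hij (g.symm.injective h)
    replace hμ : ((g.symm i).1 : ℝ) = ((g.symm j).1 : ℝ) := hμ
    generalize g.symm i = p at *
    generalize g.symm j = q at *
    obtain ⟨μ, p⟩ := p
    obtain ⟨μ', q⟩ := q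
    obtain rfl : μ = μ' := Subtype.ext hμ
    rw [hb, hb, ← hcomp]
    simp only
    rw [(hsymm μ).apply_eigenvectorBasis, inner_smul_left, OrthonormalBasis.inner_eq_ite, if_neg,
      mul_zero]
    rintro rfl
    exact hne rfl

/-- The Ricci endomorphism. -/
noncomputable def ricci (e : OrthonormalBasis (Fin 4) ℝ V) (R : Tensor4 V) : V →ₗ[ℝ] V :=
  ∑ i, curvOp e R (e i)

theorem inner_ricci (e : OrthonormalBasis (Fin 4) ℝ V) (R : Tensor4 V) (v w : V) :
    inner ℝ (ricci e R v) w = ∑ i, R (e i) v (e i) w := by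
  simp [ricci, LinearMap.sum_apply, sum_inner, inner_curvOp]

theorem IsAlgCurv.isSymmetric_ricci {R : Tensor4 V} (hR : IsAlgCurv R)
    (e : OrthonormalBasis (Fin 4) ℝ V) : (ricci e R).IsSymmetric := fun v w => by
  rw [real_inner_comm _ v, inner_ricci, inner_ricci]
  exact Finset.sum_congr rfl fun i _ => hR.sectional_symm _ _ _

theorem inner_ricci_eq (e f : OrthonormalBasis (Fin 4) ℝ V) (R : Tensor4 V) (v w : V) :
    inner ℝ (ricci e R v) w = ∑ i, R (f i) v (f i) w := by
  rw [inner_ricci]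
  exact (sum_bilin_orthonormalBasis e f (LinearMap.mk₂ ℝ (fun a b => R a v b w) (by simp) (by simp)
    (by simp) (by simp))).symm

theorem curvOp_of_isKulkarniNomizu {h : V →ₗ[ℝ] V} {R : Tensor4 V}
    (hR : IsKulkarniNomizu h R) (e : OrthonormalBasis (Fin 4) ℝ V) (x w : V) :
    curvOp e R x w = (inner ℝ (h x) x : ℝ) • w - (inner ℝ x w : ℝ) • h x
      + (inner ℝ x x : ℝ) • h w - (inner ℝ (h w) x : ℝ) • x := by
  refine ext_inner_right ℝ fun u => ?_
  rw [inner_curvOp, hR]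
  simp only [inner_add_left, inner_sub_left, inner_smul_left, RCLike.conj_to_real,
    real_inner_comm x w]
  ring

variable {h : V →ₗ[ℝ] V} {R R₁ : Tensor4 V} {f : OrthonormalBasis (Fin 4) ℝ V} {μ : Fin 4 → ℝ}

/-- The relations between a curvature tensor and an endomorphism `h` which express that the first
one commutes with the Kulkarni-Nomizu product of `h` and the metric. -/
theorem CurvCommute.kulkarniNomizu (hR : IsAlgCurv R) (hR₁ : IsKulkarniNomizu h R₁)
    (hc : CurvCommute R R₁) (f : OrthonormalBasis (Fin 4) ℝ V) (x v w : V) :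
    inner ℝ x x * R x v x (h w) - inner ℝ x w * R x v x (h x)
      = inner ℝ x x * R x w x (h v) - inner ℝ x v * R x w x (h x) := by
  have h1 := hc f x v w
  rw [curvOp_of_isKulkarniNomizu hR₁, curvOp_of_isKulkarniNomizu hR₁] at h1
  simp only [map_add, map_sub, map_smul, smul_eq_mul, hR.self_right] at h1
  have := hR.sectional_symm x v w
  rw [this] at h1
  linarith

/-- At the base point `f k` the commutation relation reads `(μ j - μ i) R(f k, f i, f k, f j) = 0`.
-/
theorem sectional_eq_zero_of_ne (hR : IsAlgCurv R) (hR₁ : IsKulkarniNomizu h R₁)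
    (hc : CurvCommute R R₁) (hf : ∀ i, h (f i) = μ i • f i) {i j k : Fin 4} (hki : k ≠ i)
    (hkj : k ≠ j) (hμ : μ i ≠ μ j) : R (f k) (f i) (f k) (f j) = 0 := by
  have h1 := hc.kulkarniNomizu hR hR₁ f (f k) (f i) (f j)
  simp only [hf, map_smul, smul_eq_mul, f.inner_eq_ite, if_neg hki, if_neg hkj,
    hR.sectional_symm (f k) (f j) (f i)] at h1
  have h2 : (μ j - μ i) * R (f k) (f i) (f k) (f j) = 0 := by norm_num at h1; grind
  exact (mul_eq_zero.mp h2).resolve_left (sub_ne_zero.mpr hμ.symm)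

/-- The same relation at the base point `f k + f l`, where the pure terms vanish and the mixed terms
remain. -/
theorem polar_eq_zero_of_ne (hR : IsAlgCurv R) (hR₁ : IsKulkarniNomizu h R₁)
    (hc : CurvCommute R R₁) (hf : ∀ i, h (f i) = μ i • f i) {i j k l : Fin 4} (hki : k ≠ i)
    (hkj : k ≠ j) (hli : l ≠ i) (hlj : l ≠ j) (hμ : μ i ≠ μ j) :
    R (f k) (f i) (f l) (f j) + R (f l) (f i) (f k) (f j) = 0 := by
  have h1 := hc.kulkarniNomizu hR hR₁ f (f k + f l) (f i) (f j)
  have hn : inner ℝ (f k + f l) (f k + f l) ≠ (0 : ℝ) := by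
    rw [inner_self_ne_zero]
    intro h0
    have := congrArg (fun v => (inner ℝ (f k) v : ℝ)) h0
    simp only [inner_add_right, f.inner_eq_ite, inner_zero_right] at this
    split_ifs at this <;> norm_num at this
  have z1 : inner ℝ (f k + f l) (f i) = (0 : ℝ) := by
    simp [inner_add_left, f.inner_eq_ite, hki, hli]
  have z2 : inner ℝ (f k + f l) (f j) = (0 : ℝ) := by
    simp [inner_add_left, f.inner_eq_ite, hkj, hlj]
  rw [z1, z2, hf, hf, map_smul, map_smul, hR.sectional_symm _ (f j)] at h1
  simp only [smul_eq_mul, zero_mul, sub_zero] at h1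
  have h2 : inner ℝ (f k + f l) (f k + f l) * ((μ j - μ i) * R (f k + f l) (f i) (f k + f l) (f j))
      = 0 := by linarith
  have h3 := (mul_eq_zero.mp ((mul_eq_zero.mp h2).resolve_left hn)).resolve_left
    (sub_ne_zero.mpr hμ.symm)
  simp only [map_add, LinearMap.add_apply, sectional_eq_zero_of_ne hR hR₁ hc hf hki hkj hμ,
    sectional_eq_zero_of_ne hR hR₁ hc hf hli hlj hμ] at h3
  linarith

/-- For `i` and `j` in one eigenspace and `k` outside it, the base point `f k` gives nothing. The
base point `f i + f k` is not an eigenvector, and there the relation yields the factor `μ k - μ i`.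
-/
theorem sectional_eq_zero_of_eq (hR : IsAlgCurv R) (hR₁ : IsKulkarniNomizu h R₁)
    (hc : CurvCommute R R₁) (hf : ∀ i, h (f i) = μ i • f i) {i j k : Fin 4} (hij : i ≠ j)
    (hki : k ≠ i) (hkj : k ≠ j) (hμ : μ i = μ j) (hμ' : μ k ≠ μ i) :
    R (f k) (f i) (f k) (f j) = 0 := by
  have h1 := hc.kulkarniNomizu hR hR₁ f (f i + f k) (f j) (f i)
  have n : inner ℝ (f i + f k) (f i + f k) = (2 : ℝ) := by
    simp only [inner_add_left, inner_add_right, f.inner_eq_ite, if_neg hki, if_neg hki.symm]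
    norm_num
  have z1 : inner ℝ (f i + f k) (f i) = (1 : ℝ) := by
    simp [inner_add_left, f.inner_eq_ite, hki]
  have z2 : inner ℝ (f i + f k) (f j) = (0 : ℝ) := by
    simp [inner_add_left, f.inner_eq_ite, hij, hkj]
  have hx : h (f i + f k) = μ i • f i + μ k • f k := by rw [map_add, hf, hf]
  rw [n, z1, z2, hx, hf, hf, map_smul, map_smul, hR.sectional_symm _ (f j) (f i)] at h1
  have h2 := sectional_eq_zero_of_ne hR hR₁ hc hf (i := k) (j := j) (k := i) hki.symm hij
    (by rw [← hμ]; exact hμ')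
  simp only [map_add, map_smul, LinearMap.add_apply, smul_eq_mul, hR.self_left, hR.self_right,
    hR.antisymm_left (f i) (f k) (f i), hR.antisymm_right (f i) (f j) (f i) (f k), h2, ← hμ] at h1
  have h3 : (μ k - μ i) * R (f k) (f i) (f k) (f j) = 0 := by
    rw [hR.antisymm_right (f k) (f j) (f k) (f i), hR.sectional_symm (f k) (f j) (f i),
      hR.sectional_symm (f i) (f j) (f k), h2] at h1
    linear_combination h1
  exact (mul_eq_zero.mp h3).resolve_left (sub_ne_zero.mpr hμ')

/-- The three components with four distinct indices add up to zero by the Bianchi identity. Each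
pair of different eigenvalues makes two of them equal, and with two such equalities all three
vanish. -/
theorem weylCoord_eq_zero_of_ne (hR : IsAlgCurv R) (hR₁ : IsKulkarniNomizu h R₁)
    (hc : CurvCommute R R₁) (hf : ∀ i, h (f i) = μ i • f i) (hμ : ∃ p q, μ p ≠ μ q)
    {i j k l : Fin 4} (hij : i ≠ j) (hik : i ≠ k) (hil : i ≠ l) (hjk : j ≠ k) (hjl : j ≠ l)
    (hkl : k ≠ l) : R (f i) (f j) (f k) (f l) = 0 := by
  have key : ∀ a b c d : Fin 4, a ≠ c → a ≠ d → b ≠ c → b ≠ d → μ a ≠ μ b →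
      R (f a) (f c) (f b) (f d) = R (f a) (f d) (f c) (f b) := fun a b c d hac had hbc hbd hab => by
    have h1 := polar_eq_zero_of_ne hR hR₁ hc hf hac.symm hbc.symm had.symm hbd.symm hab
    have h2 := hR.antisymm_left (f a) (f c) (f d) (f b)
    have h3 := hR.antisymm_right (f a) (f c) (f b) (f d)
    have h4 := hR.antisymm_left (f a) (f d) (f c) (f b)
    linarith
  have b1 := hR.bianchi (f i) (f j) (f k) (f l)
  have sw := hR.pair_symm
  have al := hR.antisymm_left
  have ar := hR.antisymm_right
  have cover : ∀ p, p = i ∨ p = j ∨ p = k ∨ p = l := by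
    have : ∀ i j k l : Fin 4, i ≠ j → i ≠ k → i ≠ l → j ≠ k → j ≠ l → k ≠ l →
      ∀ p, p = i ∨ p = j ∨ p = k ∨ p = l := by decide
    exact this i j k l hij hik hil hjk hjl hkl
  -- A non-constant `μ` on four indices breaks at least two of the three pairings of the indices.
  have hex : (μ i ≠ μ j ∨ μ k ≠ μ l) ∧ (μ i ≠ μ k ∨ μ j ≠ μ l)
      ∨ (μ i ≠ μ j ∨ μ k ≠ μ l) ∧ (μ i ≠ μ l ∨ μ j ≠ μ k)
      ∨ (μ i ≠ μ k ∨ μ j ≠ μ l) ∧ (μ i ≠ μ l ∨ μ j ≠ μ k) := by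
    by_contra hcon
    obtain ⟨p, q, hpq⟩ := hμ
    have : μ i = μ j ∧ μ i = μ k ∧ μ i = μ l := by grind
    have hall : ∀ p, μ p = μ i := fun p => by
      rcases cover p with rfl | rfl | rfl | rfl
      exacts [rfl, this.1.symm, this.2.1.symm, this.2.2.symm]
    exact hpq ((hall p).trans (hall q).symm)
  have e1 : (μ i ≠ μ j ∨ μ k ≠ μ l) → R (f i) (f k) (f l) (f j) = R (f i) (f l) (f j) (f k) := by
    rintro (h | h)
    · linarith [key i j k l hik hil hjk hjl h, ar (f i) (f k) (f l) (f j), ar (f i) (f l) (f j) (f k)]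
    · linarith [key k l i j hik.symm hjk.symm hil.symm hjl.symm h, al (f i) (f k) (f l) (f j),
        ar (f i) (f l) (f j) (f k), sw (f i) (f l) (f k) (f j)]
  have e2 : (μ i ≠ μ k ∨ μ j ≠ μ l) → R (f i) (f j) (f k) (f l) = R (f i) (f l) (f j) (f k) := by
    rintro (h | h)
    · exact key i k j l hij hil hjk.symm hkl h
    · linarith [key j l i k hij.symm hjk hil.symm hkl.symm h, al (f i) (f j) (f l) (f k),
        ar (f i) (f j) (f k) (f l), sw (f i) (f l) (f j) (f k)]
  have e3 : (μ i ≠ μ l ∨ μ j ≠ μ k) → R (f i) (f j) (f k) (f l) = R (f i) (f k) (f l) (f j) := by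
    rintro (h | h)
    · linarith [key i l j k hij hik hjl.symm hkl.symm h, ar (f i) (f j) (f k) (f l),
        ar (f i) (f k) (f l) (f j)]
    · linarith [key j k i l hij.symm hjl hik.symm hkl h, al (f i) (f j) (f k) (f l),
        ar (f i) (f k) (f l) (f j), sw (f i) (f k) (f j) (f l)]
  rcases hex with ⟨h1, h2⟩ | ⟨h1, h2⟩ | ⟨h1, h2⟩
  · linarith [e1 h1, e2 h2]
  · linarith [e1 h1, e3 h2]
  · linarith [e2 h1, e3 h2]

/-- Commutation leaves open only the entries with `i, j, k` in one eigenspace and `l` outside. For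
these, `hsec` transfers the vanishing from `l`, which commutation does reach, to `k`. -/
theorem isDiagonal_of_kulkarniNomizu (hR : IsAlgCurv R) (hR₁ : IsKulkarniNomizu h R₁)
    (hc : CurvCommute R R₁) (hf : ∀ i, h (f i) = μ i • f i) (hμ : ∃ p q, μ p ≠ μ q)
    (hsec : ∀ i j k l : Fin 4, i ≠ j → i ≠ k → i ≠ l → j ≠ k → j ≠ l → k ≠ l →
      μ i = μ j → R (f l) (f i) (f l) (f j) = 0 → R (f k) (f i) (f k) (f j) = 0) :
    IsDiagonal f R := by
  have cover : ∀ i j k : Fin 4, i ≠ j → i ≠ k → j ≠ k → ∃ l, i ≠ l ∧ j ≠ l ∧ k ≠ l ∧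
      ∀ p, p = i ∨ p = j ∨ p = k ∨ p = l := by decide
  have h3 : ∀ i j k : Fin 4, i ≠ j → k ≠ i → k ≠ j → R (f k) (f i) (f k) (f j) = 0 :=
      fun i j k hij hki hkj => by
    by_cases hμij : μ i = μ j
    · by_cases hμk : μ k = μ i
      · obtain ⟨l, hil, hjl, hkl, hall⟩ := cover i j k hij hki.symm hkj.symm
        refine hsec i j k l hij hki.symm hil hkj.symm hjl hkl hμij
          (sectional_eq_zero_of_eq hR hR₁ hc hf hij hil.symm hjl.symm hμij fun hl => ?_)
        obtain ⟨p, q, hpq⟩ := hμ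
        have hall' : ∀ p, μ p = μ i := fun p => by
          rcases hall p with rfl | rfl | rfl | rfl
          exacts [rfl, hμij.symm, hμk, hl]
        exact hpq ((hall' p).trans (hall' q).symm)
      · exact sectional_eq_zero_of_eq hR hR₁ hc hf hij hki hkj hμij hμk
    · exact sectional_eq_zero_of_ne hR hR₁ hc hf hki hkj hμij
  intro i j k l hne
  by_cases hij : i = j
  · rw [hij, hR.self_left]
  by_cases hkl : k = l
  · rw [hkl, hR.self_right]
  by_cases hik : i = k
  · subst hik
    by_cases hjl : j = l
    · exact absurd (by rw [hjl]) hne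
    · exact h3 j l i hjl hij hkl
  by_cases hil : i = l
  · subst hil
    by_cases hjk : j = k
    · exact absurd (by rw [hjk, Set.pair_comm]) hne
    · rw [hR.antisymm_right, h3 j k i hjk hij hik, neg_zero]
  by_cases hjk : j = k
  · subst hjk
    rw [hR.antisymm_left, h3 i l j hil (Ne.symm hij) hkl, neg_zero]
  by_cases hjl : j = l
  · subst hjl
    rw [hR.antisymm_left, hR.antisymm_right, h3 i k j hik (Ne.symm hij) (Ne.symm hkl), neg_zero,
      neg_zero]
  exact weylCoord_eq_zero_of_ne hR hR₁ hc hf hμ hij hik hil hjk hjl hkl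

variable [Fact (finrank ℝ V = 3 + 1)]

theorem exists_orthonormalBasis : Nonempty (OrthonormalBasis (Fin 4) ℝ V) := by
  have hn : finrank ℝ V = 4 := Fact.out
  have : FiniteDimensional ℝ V := .of_finrank_pos (by omega)
  exact ⟨(stdOrthonormalBasis ℝ V).reindex (finCongr hn)⟩

/-- The curvature tensors of the members of a Stäckel system are simultaneously diagonalisable. -/
theorem IsStaeckelSystem.exists_diagonal {S : Submodule ℝ (EndField V)} (hS : IsStaeckelSystem S) :
    ∃ e : OrthonormalBasis (Fin 4) ℝ V, ∀ K ∈ S, HasDiagonalCurv e K := by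
  obtain ⟨e⟩ := exists_orthonormalBasis (V := V)
  have hn : finrank ℝ V = 4 := Fact.out
  have : FiniteDimensional ℝ V := .of_finrank_pos (by omega)
  obtain ⟨K₀, hK₀, hall, K₁, hK₁, R₁, hR₁, h, hh, hKN, hns⟩ := hS.exists_kulkarniNomizu e
  obtain ⟨R₀, hR₀⟩ := (hS.killing K₀ hK₀).exists_isCurvOf
  obtain ⟨f, μ, hf, hric⟩ := exists_eigenbasis_compression hn hh (hR₀.1.isSymmetric_ricci e)
  have hμ : ∃ p q, μ p ≠ μ q := by
    by_contra hcon
    push Not at hcon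
    exact hns (μ 0) (f.toBasis.ext fun i => by simp [hf, hcon i 0])
  have hc : ∀ K ∈ S, ∀ R, IsCurvOf K R → CurvCommute R R₁ := fun K hK R hR =>
    curvCommute_of_commute (hS.killing K hK).1 hR (hS.killing K₁ hK₁).1 hR₁
      (hS.commute K hK K₁ hK₁)
  have hd₀ : IsDiagonal f R₀ := by
    -- An off-diagonal Ricci entry is the sum of the two entries at `k` and at `l`, and the basis
    -- makes the Ricci entry vanish within an eigenspace.
    refine isDiagonal_of_kulkarniNomizu hR₀.1 hKN (hc K₀ hK₀ R₀ hR₀) hf hμ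
      fun i j k l hij hik hil hjk hjl hkl hμij h0 => ?_
    have h1 := hric i j hij hμij
    rw [inner_ricci_eq e f] at h1
    have huniv : (Finset.univ : Finset (Fin 4)) = {i, j, k, l} := by
      have : ∀ i j k l : Fin 4, i ≠ j → i ≠ k → i ≠ l → j ≠ k → j ≠ l → k ≠ l →
        Finset.univ = ({i, j, k, l} : Finset (Fin 4)) := by decide
      exact this i j k l hij hik hil hjk hjl hkl
    rw [huniv, Finset.sum_insert (by simp [*]), Finset.sum_insert (by simp [*]),
      Finset.sum_insert (by simp [*]), Finset.sum_singleton] at h1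
    simpa [h0, hR₀.1.self_left, hR₀.1.self_right] using h1
  refine ⟨f, fun K hK => ?_⟩
  obtain ⟨c, R, hR, η, -, hη⟩ := hall K hK
  have hmem : K + c • K₀ ∈ S := S.add_mem hK (S.smul_mem c hK₀)
  have hd : IsDiagonal f R := by
    refine isDiagonal_of_kulkarniNomizu hR.1 hKN (hc _ hmem R hR) hf hμ
      fun i j k l hij hik hil hjk hjl hkl hμij h0 => ?_
    -- For a Kulkarni-Nomizu product with the metric both entries equal the entry of `η` at `f i, f
    -- j`.
    rw [hη] at h0 ⊢
    simpa [f.inner_eq_ite, hik, hjk.symm, hil, hjl.symm, hij, hik.symm, hil.symm] using h0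
  refine ⟨R + (-c) • R₀, by simpa using hR.add (hR₀.smul (-c)), fun i j k l hne => ?_⟩
  simp [hd i j k l hne, hd₀ i j k l hne]

end Diagonalisation

end KSVariety

namespace KSVariety

/-! ### Diagonal curvature tensors as sums of squares of rotations -/

section DiagonalTensors

variable {V : Type*} [NormedAddCommGroup V] [InnerProductSpace ℝ V]

/-- The basis bivectors as alternating forms. -/
noncomputable def wedgeForm (e : OrthonormalBasis (Fin 4) ℝ V) (p : Fin 6) : V →ₗ[ℝ] V →ₗ[ℝ] ℝ :=
  LinearMap.mk₂ ℝ (fun a b => wedgeCoord e a b (pairFst p) (pairSnd p))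
    (fun a a' b => by simp only [wedgeCoord, inner_add_right]; ring)
    (fun c a b => by simp only [wedgeCoord, inner_smul_right, smul_eq_mul]; ring)
    (fun a b b' => by simp only [wedgeCoord, inner_add_right]; ring)
    (fun c a b => by simp only [wedgeCoord, inner_smul_right, smul_eq_mul]; ring)

theorem wedgeForm_apply (e : OrthonormalBasis (Fin 4) ℝ V) (p : Fin 6) (a b : V) :
    wedgeForm e p a b = wedgeCoord e a b (pairFst p) (pairSnd p) := rfl

/-- The diagonal curvature tensor with given diagonal components. -/
noncomputable def diagTensor (e : OrthonormalBasis (Fin 4) ℝ V) (k : Fin 6 → ℝ) : Tensor4 V :=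
  ∑ p, k p • LinearMap.mk₂ ℝ (fun a b => wedgeForm e p a b • wedgeForm e p)
    (fun a a' b => by simp only [map_add, LinearMap.add_apply, add_smul])
    (fun c a b => by simp only [map_smul, LinearMap.smul_apply, smul_eq_mul, mul_smul])
    (fun a b b' => by simp only [map_add, add_smul])
    (fun c a b => by simp only [map_smul, smul_eq_mul, mul_smul])

theorem diagTensor_apply (e : OrthonormalBasis (Fin 4) ℝ V) (k : Fin 6 → ℝ) (a b c d : V) :
    diagTensor e k a b c d = ∑ p, k p * (wedgeForm e p a b * wedgeForm e p c d) := by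
  simp [diagTensor, LinearMap.sum_apply]

theorem isAlgCurv_diagTensor (e : OrthonormalBasis (Fin 4) ℝ V) (k : Fin 6 → ℝ) :
    IsAlgCurv (diagTensor e k) := by
  constructor <;> intro a b c d <;>
    simp only [diagTensor_apply, ← Finset.sum_neg_distrib, ← Finset.sum_add_distrib]
  · exact Finset.sum_congr rfl fun p _ => by simp only [wedgeForm_apply, wedgeCoord]; ring
  · exact Finset.sum_congr rfl fun p _ => by simp only [wedgeForm_apply, wedgeCoord]; ring
  · exact Finset.sum_congr rfl fun p _ => by ring
  · exact Finset.sum_eq_zero fun p _ => by simp only [wedgeForm_apply, wedgeCoord]; ring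

theorem wedgeForm_basis_eq_zero (e : OrthonormalBasis (Fin 4) ℝ V) {p : Fin 6} {i j : Fin 4}
    (h : ({i, j} : Set (Fin 4)) ≠ {pairFst p, pairSnd p}) : wedgeForm e p (e i) (e j) = 0 := by
  simp only [wedgeForm_apply, wedgeCoord, e.inner_eq_ite]
  by_cases h1 : pairFst p = i
  · have h2 : pairSnd p ≠ j := fun h2 => h (by rw [h1, h2])
    rw [if_neg h2]
    by_cases h3 : pairSnd p = i
    · have h4 : ∀ p, pairSnd p ≠ pairFst p := by decide
      exact absurd (h3.trans h1.symm) (h4 p)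
    · simp [h3]
  · by_cases h3 : pairFst p = j
    · have h2 : pairSnd p ≠ i := fun h2 => h (by rw [h3, h2, Set.pair_comm])
      simp [h1, h2]
    · simp [h1, h3]

theorem isDiagonal_diagTensor (e : OrthonormalBasis (Fin 4) ℝ V) (k : Fin 6 → ℝ) :
    IsDiagonal e (diagTensor e k) := by
  intro i j k' l hne
  rw [diagTensor_apply]
  refine Finset.sum_eq_zero fun p _ => ?_
  by_cases h : ({i, j} : Set (Fin 4)) = {pairFst p, pairSnd p}
  · rw [wedgeForm_basis_eq_zero e (i := k') (j := l) fun h' => hne (h.trans h'.symm), mul_zero, mul_zero]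
  · rw [wedgeForm_basis_eq_zero e h, zero_mul, mul_zero]

theorem pairMatrix_diagTensor (e : OrthonormalBasis (Fin 4) ℝ V) (k : Fin 6 → ℝ) (p : Fin 6) :
    pairMatrix e (diagTensor e k) p p = k p := by
  rw [pairMatrix, diagTensor_apply]
  fin_cases p <;> simp [Fin.sum_univ_six, wedgeForm_apply, wedgeCoord, pairFst, pairSnd,
    e.inner_eq_ite]

theorem IsDiagonal.eq_diagTensor {e : OrthonormalBasis (Fin 4) ℝ V} {R : Tensor4 V}
    (hd : IsDiagonal e R) (hR : IsAlgCurv R) : R = diagTensor e fun p => pairMatrix e R p p := by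
  have hpq : ∀ p q, p ≠ q → pairMatrix e R p q = 0 := fun p q hpq => hd _ _ _ _ fun h => by
    rw [Set.pair_eq_pair_iff] at h
    revert p q
    decide
  refine LinearMap.ext fun a => LinearMap.ext fun b => LinearMap.ext fun c => LinearMap.ext fun d => ?_
  rw [hR.expand e, diagTensor_apply]
  refine Finset.sum_congr rfl fun p _ => ?_
  rw [Finset.sum_eq_single p (fun q _ hq => by rw [hpq p q hq.symm, mul_zero]) (by simp)]
  simp only [wedgeForm_apply]
  ring

/-- The infinitesimal rotation in the plane of a basis bivector. -/
noncomputable def rotVec (e : OrthonormalBasis (Fin 4) ℝ V) (p : Fin 6) (x : V) : V :=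
  (inner ℝ (e (pairFst p)) x : ℝ) • e (pairSnd p) - (inner ℝ (e (pairSnd p)) x : ℝ) • e (pairFst p)

theorem inner_rotVec (e : OrthonormalBasis (Fin 4) ℝ V) (p : Fin 6) (x v : V) :
    inner ℝ (rotVec e p x) v = wedgeForm e p x v := by
  simp [rotVec, wedgeForm_apply, wedgeCoord, inner_sub_left, inner_smul_left]

/-- The tensor field with a given diagonal curvature tensor. -/
noncomputable def diagField (e : OrthonormalBasis (Fin 4) ℝ V) : (Fin 6 → ℝ) →ₗ[ℝ] EndField V where
  toFun k x := ∑ p, k p • (innerSL ℝ (rotVec e p x)).smulRight (rotVec e p x)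
  map_add' k k' := by
    funext x
    simp only [Pi.add_apply, add_smul, Finset.sum_add_distrib]
  map_smul' c k := by
    funext x
    simp only [Pi.smul_apply, smul_eq_mul, mul_smul, Finset.smul_sum, RingHom.id_apply]

theorem inner_diagField (e : OrthonormalBasis (Fin 4) ℝ V) (k : Fin 6 → ℝ)
    (x : Metric.sphere (0 : V) 1) (v w : V) :
    inner ℝ (diagField e k x v) w = diagTensor e k x v x w := by
  simp [diagField, diagTensor_apply, sum_inner, inner_smul_left, inner_rotVec]

theorem isCurvOf_diagField (e : OrthonormalBasis (Fin 4) ℝ V) (k : Fin 6 → ℝ) :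
    IsCurvOf (diagField e k) (diagTensor e k) :=
  ⟨isAlgCurv_diagTensor e k, fun x v w _ _ => inner_diagField e k x v w⟩

variable [Fact (finrank ℝ V = 3 + 1)]

theorem isSymField_diagField (e : OrthonormalBasis (Fin 4) ℝ V) (k : Fin 6 → ℝ) :
    IsSymField (diagField e k) where
  smooth := by
    have h : ContDiff ℝ ∞ fun x : V =>
        ∑ p, k p • (innerSL ℝ (rotVec e p x)).smulRight (rotVec e p x) := by
      have hr : ∀ p, ContDiff ℝ ∞ (rotVec e p) := fun p => by
        exact ((contDiff_const.inner ℝ contDiff_id).smul contDiff_const).sub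
          ((contDiff_const.inner ℝ contDiff_id).smul contDiff_const)
      refine ContDiff.sum fun p _ => ContDiff.const_smul _ ?_
      exact ((innerSL ℝ).contDiff.comp (hr p)).smulRight (hr p)
    exact h.contMDiff.comp contMDiff_coe_sphere
  symm x v w := by
    rw [real_inner_comm _ v, inner_diagField, inner_diagField]
    exact (isAlgCurv_diagTensor e k).sectional_symm _ _ _
  normal x := by
    refine ext_inner_right ℝ fun w => ?_
    rw [inner_diagField, (isAlgCurv_diagTensor e k).self_left, inner_zero_left]

/-- Inserting `inner_covDeriv`, the six terms of the cyclic sum cancel by the Bianchi identity and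
the other symmetries of `R`. No derivative of `K` beyond this formula enters. -/
theorem IsCurvOf.killingEq {K : EndField V} {R : Tensor4 V} (hK : IsSymField K) (hR : IsCurvOf K R) :
    KillingEq K := by
  intro x u v w hu hv hw
  rw [hR.inner_covDeriv hK hu hv hw, hR.inner_covDeriv hK hv hw hu, hR.inner_covDeriv hK hw hu hv]
  have h1 := hR.1.pair_symm u v x w
  have h2 := hR.1.pair_symm v w x u
  have h3 := hR.1.pair_symm w u x v
  have h4 := hR.1.bianchi x u v w
  have h5 := hR.1.antisymm_right x u v w
  have h6 := hR.1.antisymm_right x v w u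
  have h7 := hR.1.antisymm_right x w u v
  linarith

theorem isKilling_diagField (e : OrthonormalBasis (Fin 4) ℝ V) (k : Fin 6 → ℝ) :
    IsKilling (diagField e k) :=
  ⟨isSymField_diagField e k, (isCurvOf_diagField e k).killingEq (isSymField_diagField e k)⟩

theorem IsCurvOf.eq_diagField {K : EndField V} (hK : IsSymField K) {e : OrthonormalBasis (Fin 4) ℝ V}
    {k : Fin 6 → ℝ} (hR : IsCurvOf K (diagTensor e k)) : K = diagField e k := by
  funext x
  ext1 v
  exact ext_inner_right ℝ fun w => by rw [hR.inner_eq hK, inner_diagField]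

/-- The curvature tensor of a Killing tensor is determined on the planes of a basis. -/
theorem IsCurvOf.sectional_eq {K : EndField V} {R R' : Tensor4 V} (hK : IsSymField K)
    (hR : IsCurvOf K R) (hR' : IsCurvOf K R') (e : OrthonormalBasis (Fin 4) ℝ V) (i j : Fin 4) :
    R (e i) (e j) (e i) (e j) = R' (e i) (e j) (e i) (e j) := by
  let x : Metric.sphere (0 : V) 1 := ⟨e i, by simp⟩
  exact (hR.inner_eq hK x (e j) (e j)).symm.trans (hR'.inner_eq hK x (e j) (e j))

theorem diagField_injective (e : OrthonormalBasis (Fin 4) ℝ V) :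
    Function.Injective (diagField e) := fun k k' h => by
  funext p
  rw [← pairMatrix_diagTensor e k, ← pairMatrix_diagTensor e k']
  refine (isCurvOf_diagField e k).sectional_eq (isSymField_diagField e k) ?_ e _ _
  rw [h]
  exact isCurvOf_diagField e k'

end DiagonalTensors

end KSVariety

namespace KSVariety

/-! ### Integrability and commutation of diagonal tensors -/

section DiagonalIntegrable

variable {V : Type*} [NormedAddCommGroup V] [InnerProductSpace ℝ V]

/-- The Killing-Stäckel matrix in terms of the diagonal components of the curvature tensor. -/
noncomputable def paramMatrix : (Fin 6 → ℝ) →ₗ[ℝ] Matrix (Fin 3) (Fin 3) ℝ where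
  toFun k := !![(k 1 + k 4 - k 2 - k 5) / 2, -((k 2 - k 5) / 2), (k 1 - k 4) / 2;
    (k 2 - k 5) / 2, (k 2 + k 5 - k 0 - k 3) / 2, -((k 0 - k 3) / 2);
    -((k 1 - k 4) / 2), (k 0 - k 3) / 2, (k 0 + k 3 - k 1 - k 4) / 2]
  map_add' k k' := by
    ext i j
    fin_cases i <;> fin_cases j <;> simp <;> ring
  map_smul' c k := by
    ext i j
    fin_cases i <;> fin_cases j <;> simp <;> ring

theorem ksMatrix_eq (e : OrthonormalBasis (Fin 4) ℝ V) (R : Tensor4 V) :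
    ksMatrix e R = paramMatrix fun p => pairMatrix e R p p := by
  ext i j
  fin_cases i <;> fin_cases j <;> simp [ksMatrix, paramMatrix, wPar, tPar, scal, diagComp,
    pairMatrix, pairFst, pairSnd] <;> ring

theorem ksMatrix_diagTensor (e : OrthonormalBasis (Fin 4) ℝ V) (k : Fin 6 → ℝ) :
    ksMatrix e (diagTensor e k) = paramMatrix k := by
  simp only [ksMatrix_eq, pairMatrix_diagTensor]

/-- The matrix of the operator `R(x, ·, x, ·)` for a diagonal curvature tensor. -/
noncomputable def diagOpMatrix (k : Fin 6 → ℝ) (x : Fin 4 → ℝ) : Matrix (Fin 4) (Fin 4) ℝ :=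
  !![k 0 * x 1 ^ 2 + k 1 * x 2 ^ 2 + k 2 * x 3 ^ 2, - k 0 * x 0 * x 1, - k 1 * x 0 * x 2,
      - k 2 * x 0 * x 3;
    - k 0 * x 0 * x 1, k 0 * x 0 ^ 2 + k 5 * x 2 ^ 2 + k 4 * x 3 ^ 2, - k 5 * x 1 * x 2,
      - k 4 * x 1 * x 3;
    - k 1 * x 0 * x 2, - k 5 * x 1 * x 2, k 1 * x 0 ^ 2 + k 5 * x 1 ^ 2 + k 3 * x 3 ^ 2,
      - k 3 * x 2 * x 3;
    - k 2 * x 0 * x 3, - k 4 * x 1 * x 3, - k 3 * x 2 * x 3,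
      k 2 * x 0 ^ 2 + k 4 * x 1 ^ 2 + k 3 * x 2 ^ 2]

theorem diagTensor_sectional (e : OrthonormalBasis (Fin 4) ℝ V) (k : Fin 6 → ℝ) (x : V)
    (i j : Fin 4) : diagTensor e k x (e i) x (e j)
      = diagOpMatrix k (fun m => inner ℝ (e m) x) i j := by
  rw [diagTensor_apply]
  fin_cases i <;> fin_cases j <;> simp [Fin.sum_univ_six, wedgeForm_apply, wedgeCoord, pairFst,
    pairSnd, e.inner_eq_ite, diagOpMatrix] <;> ring

theorem starPair_diagTensor (e : OrthonormalBasis (Fin 4) ℝ V) (k : Fin 6 → ℝ) (x y v : V) :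
    starPair e (curvForm (diagTensor e k) x y) x v
      = ∑ p : Fin 6, k p * (wedgeForm e (p + 3) x v * wedgeForm e p x y) := by
  simp only [starPair, curvForm_apply, diagTensor_apply, Fin.sum_univ_six, wedgeForm_apply,
    wedgeCoord, pairFst, pairSnd, Matrix.cons_val, e.inner_eq_ite, Fin.reduceEq, if_true, if_false,
    Fin.reduceAdd, zero_add]
  ring

/-- The trace of the magnetic part of a diagonal curvature tensor against a matrix. -/
noncomputable def diagStarTrace (k : Fin 6 → ℝ) (x : Fin 4 → ℝ) (t : Fin 4 → Fin 4 → ℝ) : ℝ :=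
  k 0 * ((x 2 * (x 0 * t 3 1 - x 1 * t 3 0)) - (x 3 * (x 0 * t 2 1 - x 1 * t 2 0)))
  + k 1 * ((x 3 * (x 0 * t 1 2 - x 2 * t 1 0)) - (x 1 * (x 0 * t 3 2 - x 2 * t 3 0)))
  + k 2 * ((x 1 * (x 0 * t 2 3 - x 3 * t 2 0)) - (x 2 * (x 0 * t 1 3 - x 3 * t 1 0)))
  + k 3 * ((x 0 * (x 2 * t 1 3 - x 3 * t 1 2)) - (x 1 * (x 2 * t 0 3 - x 3 * t 0 2)))
  + k 4 * ((x 0 * (x 3 * t 2 1 - x 1 * t 2 3)) - (x 2 * (x 3 * t 0 1 - x 1 * t 0 3)))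
  + k 5 * ((x 0 * (x 1 * t 3 2 - x 2 * t 3 1)) - (x 3 * (x 1 * t 0 2 - x 2 * t 0 1)))

theorem starTrace_diagTensor (e : OrthonormalBasis (Fin 4) ℝ V) (k : Fin 6 → ℝ) (x : V)
    (T : V → V) : starTrace e (diagTensor e k) x T
      = diagStarTrace k (fun m => inner ℝ (e m) x) fun i m => inner ℝ (e m) (T (e i)) := by
  simp only [starTrace, starPair_diagTensor, Fin.sum_univ_six, Fin.sum_univ_four, wedgeForm_apply,
    wedgeCoord, pairFst, pairSnd, Matrix.cons_val, e.inner_eq_ite, Fin.reduceEq, if_true, if_false,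
    Fin.reduceAdd, zero_add, diagStarTrace]
  ring

/-- For diagonal tensors `tr BE = 0` is automatic, so integrability rests on `tr BE²` alone. -/
theorem diagStarTrace_diagOpMatrix (k : Fin 6 → ℝ) (x : Fin 4 → ℝ) :
    diagStarTrace k x (diagOpMatrix k x) = 0 := by
  simp only [diagStarTrace, diagOpMatrix, Matrix.of_apply, Matrix.cons_val]
  ring

/-- This identity is the origin of the determinant: up to a universal quartic factor times
`|x|²`-homogenisation, which together form `x₀x₁x₂x₃ |x|²`, the trace `tr BE²` is the determinant of
the Killing-Stäckel matrix. -/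
theorem diagStarTrace_diagOpMatrix_sq (k : Fin 6 → ℝ) (x : Fin 4 → ℝ) :
    diagStarTrace k x (diagOpMatrix k x * diagOpMatrix k x) = 2 * (paramMatrix k).det
      * (x 0 * x 1 * x 2 * x 3) * (x 0 ^ 2 + x 1 ^ 2 + x 2 ^ 2 + x 3 ^ 2) := by
  simp only [diagStarTrace, diagOpMatrix, Matrix.of_apply, Matrix.cons_val, Matrix.mul_apply,
    Fin.sum_univ_four, paramMatrix, LinearMap.coe_mk, AddHom.coe_mk, Matrix.det_fin_three]
  ring

/-- Two diagonal curvature tensors with these components give commuting fields. -/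
def ParamCommute (k k' : Fin 6 → ℝ) : Prop :=
  k 0 * (k' 1 - k' 5) + k 1 * (k' 5 - k' 0) + k 5 * (k' 0 - k' 1) = 0 ∧
  k 1 * (k' 2 - k' 3) + k 2 * (k' 3 - k' 1) + k 3 * (k' 1 - k' 2) = 0 ∧
  k 2 * (k' 0 - k' 4) + k 0 * (k' 4 - k' 2) + k 4 * (k' 2 - k' 0) = 0 ∧
  k 3 * (k' 4 - k' 5) + k 4 * (k' 5 - k' 3) + k 5 * (k' 3 - k' 4) = 0

theorem ParamCommute.diagOpMatrix_mul {k k' : Fin 6 → ℝ} (h : ParamCommute k k') (x : Fin 4 → ℝ) :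
    diagOpMatrix k x * diagOpMatrix k' x = diagOpMatrix k' x * diagOpMatrix k x := by
  obtain ⟨h1, h2, h3, h4⟩ := h
  ext i j
  rw [Matrix.mul_apply, Matrix.mul_apply, Fin.sum_univ_four, Fin.sum_univ_four]
  fin_cases i <;> fin_cases j <;> simp only [diagOpMatrix, Matrix.of_apply, Matrix.cons_val,
    Fin.zero_eta, Fin.mk_one, Fin.reduceFinMk]
  · ring
  · linear_combination x 0 * x 1 * (x 2 ^ 2 * h1 - x 3 ^ 2 * h3)
  · linear_combination x 0 * x 2 * (x 3 ^ 2 * h2 - x 1 ^ 2 * h1)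
  · linear_combination x 0 * x 3 * (x 1 ^ 2 * h3 - x 2 ^ 2 * h2)
  · linear_combination - x 0 * x 1 * (x 2 ^ 2 * h1 - x 3 ^ 2 * h3)
  · ring
  · linear_combination x 1 * x 2 * (x 0 ^ 2 * h1 - x 3 ^ 2 * h4)
  · linear_combination - x 1 * x 3 * (x 0 ^ 2 * h3 - x 2 ^ 2 * h4)
  · linear_combination - x 0 * x 2 * (x 3 ^ 2 * h2 - x 1 ^ 2 * h1)
  · linear_combination - x 1 * x 2 * (x 0 ^ 2 * h1 - x 3 ^ 2 * h4)
  · ring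
  · linear_combination x 2 * x 3 * (x 0 ^ 2 * h2 - x 1 ^ 2 * h4)
  · linear_combination - x 0 * x 3 * (x 1 ^ 2 * h3 - x 2 ^ 2 * h2)
  · linear_combination x 1 * x 3 * (x 0 ^ 2 * h3 - x 2 ^ 2 * h4)
  · linear_combination - x 2 * x 3 * (x 0 ^ 2 * h2 - x 1 ^ 2 * h4)
  · ring

theorem CurvCommute.paramCommute {e : OrthonormalBasis (Fin 4) ℝ V} {k k' : Fin 6 → ℝ}
    (h : CurvCommute (diagTensor e k) (diagTensor e k')) : ParamCommute k k' := by
  have key : ∀ (x : Fin 4 → ℝ) (i j : Fin 4), ∑ m, diagOpMatrix k x i m * diagOpMatrix k' x j m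
      = ∑ m, diagOpMatrix k x j m * diagOpMatrix k' x i m := fun x i j => by
    have h1 := h e (∑ m, x m • e m) (e i) (e j)
    have hx : (fun m => inner ℝ (e m) (∑ m, x m • e m)) = x := by
      funext m
      simp [inner_sum, inner_smul_right, e.inner_eq_ite]
    rw [curvOp_apply, curvOp_apply] at h1
    simp only [map_add, map_smul, smul_eq_mul, diagTensor_sectional, hx] at h1
    rw [Fin.sum_univ_four, Fin.sum_univ_four]
    linarith
  -- Each off-diagonal entry of the commutator combines two of the four relations. A vanishing
  -- coordinate of `x` isolates one of them.
  have h1 := key ![1, 1, 1, 0] 0 1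
  have h2 := key ![1, 0, 1, 1] 0 2
  have h3 := key ![1, 1, 0, 1] 0 3
  have h4 := key ![0, 1, 1, 1] 1 2
  simp only [Fin.sum_univ_four, diagOpMatrix, Matrix.of_apply, Matrix.cons_val] at h1 h2 h3 h4
  refine ⟨?_, ?_, ?_, ?_⟩
  · linear_combination h1
  · linear_combination h2
  · linear_combination h3
  · linear_combination -h4

theorem inner_diagField_basis (e : OrthonormalBasis (Fin 4) ℝ V) (k : Fin 6 → ℝ)
    (x : Metric.sphere (0 : V) 1) (i j : Fin 4) : inner ℝ (e j) (diagField e k x (e i))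
      = diagOpMatrix k (fun m => inner ℝ (e m) (x : V)) i j := by
  rw [real_inner_comm, inner_diagField, diagTensor_sectional]

variable [Fact (finrank ℝ V = 3 + 1)]

theorem inner_diagField_comp_basis (e : OrthonormalBasis (Fin 4) ℝ V) (k k' : Fin 6 → ℝ)
    (x : Metric.sphere (0 : V) 1) (i j : Fin 4) :
    inner ℝ (e j) (diagField e k x (diagField e k' x (e i)))
      = (diagOpMatrix k' (fun m => inner ℝ (e m) (x : V))
        * diagOpMatrix k (fun m => inner ℝ (e m) (x : V))) i j := by
  rw [← (isSymField_diagField e k).symm, inner_eq_coord e, Matrix.mul_apply, Fin.sum_univ_four]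
  have hs := fun m => (isSymField_diagField e k).symm x (e m) (e j)
  have h2 := fun m => inner_diagField_basis e k x m j
  simp only [inner_diagField_basis]
  have h3 : ∀ m, diagOpMatrix k (fun m => inner ℝ (e m) (x : V)) j m
      = diagOpMatrix k (fun m => inner ℝ (e m) (x : V)) m j := fun m => by
    rw [← inner_diagField_basis, ← inner_diagField_basis, ← (isSymField_diagField e k).symm,
      real_inner_comm]
  simp only [h3]
  ring

theorem ParamCommute.commute {k k' : Fin 6 → ℝ} (h : ParamCommute k k')
    (e : OrthonormalBasis (Fin 4) ℝ V) (x : Metric.sphere (0 : V) 1) :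
    diagField e k x ∘L diagField e k' x = diagField e k' x ∘L diagField e k x := by
  refine ContinuousLinearMap.coe_injective (e.toBasis.ext fun i => ?_)
  refine ext_inner_left ℝ fun u => ?_
  simp only [OrthonormalBasis.coe_toBasis, ContinuousLinearMap.coe_coe,
    ContinuousLinearMap.comp_apply]
  rw [inner_eq_coord e u (diagField e k x _), inner_eq_coord e u (diagField e k' x _)]
  simp only [inner_diagField_comp_basis, h.diagOpMatrix_mul]

theorem isIntegrable_diagField (e : OrthonormalBasis (Fin 4) ℝ V) {k : Fin 6 → ℝ}
    (hk : (paramMatrix k).det = 0) : IsIntegrable (diagField e k) := by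
  intro x u v w hu hv hw
  have hK := isSymField_diagField e k
  have hR := isCurvOf_diagField e k
  obtain ⟨f, hf, hstar⟩ := exists_basis_magTrace_eq e (norm_eq_of_mem_sphere x)
  have t1 : magTrace (diagTensor e k) f (diagField e k x) = 0 := by
    have := hstar _ hR.1 (diagField e k x : V →ₗ[ℝ] V)
    rw [starTrace_diagTensor] at this
    simp only [ContinuousLinearMap.coe_coe, inner_diagField_basis] at this
    rw [this]
    exact diagStarTrace_diagOpMatrix k _
  have t2 : magTrace (diagTensor e k) f (fun v => diagField e k x (diagField e k x v)) = 0 := by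
    have := hstar _ hR.1 ((diagField e k x : V →ₗ[ℝ] V) ∘ₗ (diagField e k x : V →ₗ[ℝ] V))
    rw [starTrace_diagTensor] at this
    simp only [LinearMap.comp_apply, ContinuousLinearMap.coe_coe, inner_diagField_comp_basis] at this
    refine Eq.trans this ((diagStarTrace_diagOpMatrix_sq k _).trans ?_)
    rw [hk]
    ring
  obtain ⟨c, d, e', h0, h1, h2⟩ := hR.cyclic_nijenhuis hK hf
  rw [t1] at h0 h1 h2
  rw [t2] at h1 h2
  simp only [mul_zero, add_zero] at h0 h1 h2
  have ant : ∀ u v, nijenhuisBilin (diagField e k) x v u = - nijenhuisBilin (diagField e k) x u v :=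
    fun u v => nijenhuis_antisymm _ x u v
  have eu := isTangent_iff_eq_sum hf hu
  have ev := isTangent_iff_eq_sum hf hv
  have ew := isTangent_iff_eq_sum hf hw
  exact ⟨cyclic_sum_eq_zero _ ant LinearMap.id _ _ _ h0 _ _ _ _ _ _ _ _ _ eu ev ew,
    cyclic_sum_eq_zero _ ant (diagField e k x : V →ₗ[ℝ] V) _ _ _ h1 _ _ _ _ _ _ _ _ _ eu ev ew,
    cyclic_sum_eq_zero _ ant ((diagField e k x : V →ₗ[ℝ] V) ∘ₗ (diagField e k x : V →ₗ[ℝ] V)) _ _ _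
      h2 _ _ _ _ _ _ _ _ _ eu ev ew⟩

end DiagonalIntegrable

end KSVariety

namespace KSVariety

/-! ### Matrices with a given kernel and Stäckel lines -/

section StaeckelLines

theorem mem_ksSpace_iff {A : Matrix (Fin 3) (Fin 3) ℝ} : A ∈ ksSpace ↔
    A 0 1 = - A 1 0 ∧ A 2 0 = - A 0 2 ∧ A 1 2 = - A 2 1 ∧ A 0 0 + A 1 1 + A 2 2 = 0 := by
  simp only [ksSpace, Set.mem_ofPred_eq, Matrix.trace, Matrix.diag, Fin.sum_univ_three]
  refine ⟨fun ⟨h, h'⟩ => ⟨h 0 1 (by decide), h 2 0 (by decide), h 1 2 (by decide), h'⟩,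
    fun ⟨h1, h2, h3, h'⟩ => ⟨fun i j hij => ?_, h'⟩⟩
  fin_cases i <;> fin_cases j <;> first | exact absurd rfl hij | simp [h1, h2, h3]

/-- `ksSpace` as a subspace. -/
def ksSubmodule : Submodule ℝ (Matrix (Fin 3) (Fin 3) ℝ) where
  carrier := ksSpace
  add_mem' {A B} hA hB := by
    rw [mem_ksSpace_iff] at *
    simp only [Matrix.add_apply]
    refine ⟨?_, ?_, ?_, ?_⟩ <;> linarith
  zero_mem' := by simp [mem_ksSpace_iff]
  smul_mem' c A hA := by
    rw [mem_ksSpace_iff] at *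
    obtain ⟨h1, h2, h3, h4⟩ := hA
    simp only [Matrix.smul_apply, smul_eq_mul]
    refine ⟨by rw [h1]; ring, by rw [h2]; ring, by rw [h3]; ring, by linear_combination c * h4⟩

theorem mem_ksSubmodule {A : Matrix (Fin 3) (Fin 3) ℝ} : A ∈ ksSubmodule ↔ A ∈ ksSpace := Iff.rfl

/-- The matrices of `ksSpace` which annihilate `n`. -/
def isokernel (n : Fin 3 → ℝ) : Submodule ℝ (Matrix (Fin 3) (Fin 3) ℝ) :=
  ksSubmodule ⊓ LinearMap.ker ((Matrix.mulVecBilin ℝ ℝ).flip n)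

theorem mem_isokernel {n : Fin 3 → ℝ} {A : Matrix (Fin 3) (Fin 3) ℝ} :
    A ∈ isokernel n ↔ A ∈ ksSpace ∧ A.mulVec n = 0 := by
  simp [isokernel, mem_ksSubmodule, LinearMap.mem_ker]

theorem iota_mem_isokernel (n : Fin 3 → ℝ) : iota n ∈ isokernel n := by
  rw [mem_isokernel, mem_ksSpace_iff]
  refine ⟨by simp [iota], ?_⟩
  funext i
  fin_cases i <;> simp [iota, Matrix.mulVec, dotProduct, Fin.sum_univ_three] <;> ring

theorem nu_mem_isokernel (n : Fin 3 → ℝ) : nu n ∈ isokernel n := by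
  rw [mem_isokernel, mem_ksSpace_iff]
  refine ⟨by simp [nu], ?_⟩
  funext i
  fin_cases i <;> simp [nu, Matrix.mulVec, dotProduct, Fin.sum_univ_three] <;> ring

theorem mulVec_eq_zero_iff {n : Fin 3 → ℝ} {A : Matrix (Fin 3) (Fin 3) ℝ} : A.mulVec n = 0 ↔
    A 0 0 * n 0 + A 0 1 * n 1 + A 0 2 * n 2 = 0 ∧ A 1 0 * n 0 + A 1 1 * n 1 + A 1 2 * n 2 = 0 ∧
      A 2 0 * n 0 + A 2 1 * n 1 + A 2 2 * n 2 = 0 := by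
  simp [funext_iff, Fin.forall_fin_succ, Matrix.mulVec, dotProduct, Fin.sum_univ_three]

theorem det_eq_zero_of_mem_isokernel {n : Fin 3 → ℝ} (hn : n ≠ 0) {A : Matrix (Fin 3) (Fin 3) ℝ}
    (hA : A ∈ isokernel n) : A.det = 0 :=
  Matrix.exists_mulVec_eq_zero_iff.mp ⟨n, hn, (mem_isokernel.mp hA).2⟩

/-- A matrix of `ksSpace` with zero diagonal is skew, hence a cross product with some vector, and
the kernel condition makes that vector parallel to `n`. -/
theorem eq_smul_iota {n : Fin 3 → ℝ} (hn : n ≠ 0) {A : Matrix (Fin 3) (Fin 3) ℝ}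
    (hA : A ∈ isokernel n) (h0 : A 0 0 = 0) (h2 : A 2 2 = 0) : ∃ c : ℝ, A = c • iota n := by
  rw [mem_isokernel, mem_ksSpace_iff, mulVec_eq_zero_iff] at hA
  obtain ⟨⟨e1, e2, e3, e4⟩, h5, h6, h7⟩ := hA
  have h1 : A 1 1 = 0 := by linarith
  rw [h0, e1] at h5
  rw [h1, e3] at h6
  rw [h2, e2] at h7
  have hn0 : n 0 ^ 2 + n 1 ^ 2 + n 2 ^ 2 ≠ 0 := fun h => hn (by
    have a0 : n 0 = 0 := by nlinarith [sq_nonneg (n 0), sq_nonneg (n 1), sq_nonneg (n 2)]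
    have a1 : n 1 = 0 := by nlinarith [sq_nonneg (n 0), sq_nonneg (n 1), sq_nonneg (n 2)]
    have a2 : n 2 = 0 := by nlinarith [sq_nonneg (n 0), sq_nonneg (n 1), sq_nonneg (n 2)]
    funext i
    fin_cases i <;> assumption)
  -- The coefficient of the projection onto `n` of the vector `(A 2 1, A 0 2, A 1 0)` of the skew
  -- matrix.
  set d := (A 2 1 * n 0 + A 0 2 * n 1 + A 1 0 * n 2) / (n 0 ^ 2 + n 1 ^ 2 + n 2 ^ 2) with hd
  have d0 : A 2 1 = d * n 0 := by
    rw [hd]; field_simp; linear_combination n 1 * h7 - n 2 * h6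
  have d1 : A 0 2 = d * n 1 := by
    rw [hd]; field_simp; linear_combination n 2 * h5 - n 0 * h7
  have d2 : A 1 0 = d * n 2 := by
    rw [hd]; field_simp; linear_combination n 0 * h6 - n 1 * h5
  refine ⟨d, ?_⟩
  ext i j
  fin_cases i <;> fin_cases j <;> simp [iota] <;> linarith

/-- If the squares of the entries of `n` are not all equal, then the matrices with kernel `n` are the
combinations of `iota n` and `nu n`. -/
theorem isokernel_le_span {n : Fin 3 → ℝ} (hn : ¬ (n 0 ^ 2 = n 1 ^ 2 ∧ n 1 ^ 2 = n 2 ^ 2)) :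
    isokernel n ≤ Submodule.span ℝ {iota n, nu n} := by
  intro A hA
  obtain ⟨⟨h1, h2, h3, h4⟩, h5, h6, h7⟩ : _ ∧ _ := by
    rwa [mem_isokernel, mem_ksSpace_iff, mulVec_eq_zero_iff] at hA
  rw [h1] at h5
  rw [h3] at h6
  rw [h2] at h7
  set u := n 1 ^ 2 - n 2 ^ 2 with hu
  set v := n 2 ^ 2 - n 0 ^ 2 with hv
  have huv : u ^ 2 + v ^ 2 + (u + v) ^ 2 ≠ 0 := fun h => hn (by
    constructor <;> nlinarith [sq_nonneg u, sq_nonneg v, sq_nonneg (u + v)])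
  have hn0 : n ≠ 0 := by
    rintro rfl
    simp at hn
  -- From `nᵀ A n = 0` and the zero trace, the diagonal of `A` is orthogonal to `(nᵢ²)` and to `(1,
  -- 1, 1)`. It is therefore proportional to their cross product `(u, v, -u - v)`, which is the
  -- diagonal of `nu n`.
  have ha : A 0 0 * v = A 1 1 * u := by
    rw [hu, hv]
    linear_combination (-n 0) * h5 - n 1 * h6 - n 2 * h7 + n 2 ^ 2 * h4
  set c := (A 0 0 * u + A 1 1 * v + (A 0 0 + A 1 1) * (u + v)) / (u ^ 2 + v ^ 2 + (u + v) ^ 2)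
    with hc
  have c0 : A 0 0 = c * u := by
    rw [hc]; field_simp; linear_combination (2 * v + u) * ha
  have c1 : A 1 1 = c * v := by
    rw [hc]; field_simp; linear_combination (- 2 * u - v) * ha
  obtain ⟨d, hd⟩ := eq_smul_iota hn0 (Submodule.sub_mem _ hA
    (Submodule.smul_mem _ c (nu_mem_isokernel n))) (by simp [nu, c0, hu]) (by
      simp [nu]; linarith)
  exact Submodule.mem_span_pair.mpr ⟨d, c, by rw [← hd, sub_add_cancel]⟩

theorem iota_ne_zero {n : Fin 3 → ℝ} (hn : n ≠ 0) : iota n ≠ 0 := fun h => hn (by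
  have h0 := congrFun (congrFun h 2) 1
  have h1 := congrFun (congrFun h 0) 2
  have h2 := congrFun (congrFun h 1) 0
  simp [iota] at h0 h1 h2
  funext i
  fin_cases i <;> simp [h0, h1, h2])

theorem linearIndependent_iota_nu {n : Fin 3 → ℝ}
    (hn : ¬ (n 0 ^ 2 = n 1 ^ 2 ∧ n 1 ^ 2 = n 2 ^ 2)) :
    LinearIndependent ℝ ![iota n, nu n] := by
  have hn0 : n ≠ 0 := by
    rintro rfl
    simp at hn
  rw [LinearIndependent.pair_iff]
  intro s t hst
  have h0 := congrFun (congrFun hst 0) 0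
  have h1 := congrFun (congrFun hst 2) 2
  simp [iota, nu] at h0 h1
  have ht : t = 0 := by
    by_contra ht
    simp only [ht, false_or] at h0 h1
    exact hn ⟨by linarith, by linarith⟩
  rw [ht, zero_smul, add_zero] at hst
  exact ⟨(smul_eq_zero.mp hst).resolve_right (iota_ne_zero hn0), ht⟩

/-- For special kernels the two embeddings of the projective plane agree. -/
theorem nu_eq_smul_iota {n : Fin 3 → ℝ} (hn : n 0 ^ 2 = n 1 ^ 2 ∧ n 1 ^ 2 = n 2 ^ 2) :
    ∃ c : ℝ, nu n = c • iota n := by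
  obtain ⟨h1, h2⟩ := hn
  by_cases h0 : n 0 = 0
  · have h3 : n 1 = 0 := by rw [h0] at h1; nlinarith
    have h4 : n 2 = 0 := by rw [h3] at h2; nlinarith
    refine ⟨0, ?_⟩
    ext i j
    fin_cases i <;> fin_cases j <;> simp [nu, h0, h3, h4]
  have h3 : n 2 ^ 2 = n 0 ^ 2 := by rw [h1, h2]
  have h4 : n 1 ^ 2 = n 0 ^ 2 := h1.symm
  refine ⟨n 1 * n 2 / n 0, ?_⟩
  ext i j
  fin_cases i <;> fin_cases j <;> simp [nu, iota] <;> field_simp <;>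
    simp only [h3, h4] <;> ring

theorem det_add_smul (M A : Matrix (Fin 3) (Fin 3) ℝ) (t : ℝ) : (M + t • A).det
    = M.det + (M.adjugate * A).trace * t + (M * A.adjugate).trace * t ^ 2 + A.det * t ^ 3 := by
  simp only [Matrix.det_fin_three, Matrix.adjugate_fin_three, Matrix.trace, Matrix.diag,
    Matrix.mul_apply, Fin.sum_univ_three, Matrix.add_apply, Matrix.smul_apply, smul_eq_mul,
    Matrix.of_apply, Matrix.cons_val]
  ring

theorem deriv_det_line (M A : Matrix (Fin 3) (Fin 3) ℝ) :
    deriv (fun t : ℝ => (M + t • A).det) 0 = (M.adjugate * A).trace := by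
  simp only [det_add_smul]
  have h := (((hasDerivAt_const (0 : ℝ) M.det).add
    ((hasDerivAt_id (0 : ℝ)).const_mul (M.adjugate * A).trace)).add
    ((hasDerivAt_pow 2 (0 : ℝ)).const_mul (M * A.adjugate).trace)).add
    ((hasDerivAt_pow 3 (0 : ℝ)).const_mul A.det)
  exact h.deriv.trans (by simp)

/-- The adjugate of `iota n` is `n nᵀ`, so the derivative of the determinant at `c • iota n` in the
direction `A` is `c² nᵀ A n`. -/
theorem trace_adjugate_smul_iota (c : ℝ) (n : Fin 3 → ℝ) {A : Matrix (Fin 3) (Fin 3) ℝ}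
    (hA : A ∈ ksSpace) : ((c • iota n).adjugate * A).trace
      = c ^ 2 * (A 0 0 * n 0 ^ 2 + A 1 1 * n 1 ^ 2 + A 2 2 * n 2 ^ 2) := by
  obtain ⟨h1, h2, h3, h4⟩ := mem_ksSpace_iff.mp hA
  simp only [iota, Matrix.adjugate_fin_three, Matrix.trace, Matrix.diag,
    Matrix.mul_apply, Fin.sum_univ_three, Matrix.smul_apply, smul_eq_mul,
    Matrix.of_apply, Matrix.cons_val, h1, h2, h3]
  ring

/-- The data of a Stäckel line, without the matrix operations. -/
theorem IsStaeckelLine.exists_kernel {L : Submodule ℝ (Matrix (Fin 3) (Fin 3) ℝ)}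
    (hL : IsStaeckelLine L) : ∃ (M : Matrix (Fin 3) (Fin 3) ℝ) (n : Fin 3 → ℝ), n ≠ 0 ∧
      M ∈ isokernel n ∧ (∀ c : ℝ, n 0 ^ 2 = n 1 ^ 2 ∧ n 1 ^ 2 = n 2 ^ 2 → M ≠ c • iota n) ∧
      L = Submodule.span ℝ {M, iota n, nu n} := by
  obtain ⟨M, n, ⟨⟨hM, hdet⟩, hM0, A, hA, hder⟩, hker, rfl⟩ := hL
  have hMn : M.mulVec n = 0 := by
    have : n ∈ LinearMap.ker M.mulVecLin := hker ▸ Submodule.mem_span_singleton_self n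
    simpa using this
  have hn : n ≠ 0 := by
    rintro rfl
    obtain ⟨v, hv, hMv⟩ := Matrix.exists_mulVec_eq_zero_iff.mpr hdet
    have : v ∈ LinearMap.ker M.mulVecLin := by simpa using hMv
    rw [hker] at this
    exact hv (by simpa using this)
  refine ⟨M, n, hn, mem_isokernel.mpr ⟨hM, hMn⟩, fun c hsq hMc => hder ?_, rfl⟩
  -- With equal `nᵢ²` the derivative is a multiple of the trace of `A`, so multiples of `iota n` are
  -- singular.
  rw [deriv_det_line, hMc, trace_adjugate_smul_iota c n hA, ← hsq.2, ← hsq.1]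
  obtain ⟨-, -, -, h4⟩ := mem_ksSpace_iff.mp hA
  linear_combination c ^ 2 * n 0 ^ 2 * h4

theorem span_triple_eq_of_general {M : Matrix (Fin 3) (Fin 3) ℝ} {n : Fin 3 → ℝ}
    (hM : M ∈ isokernel n) (hn : ¬ (n 0 ^ 2 = n 1 ^ 2 ∧ n 1 ^ 2 = n 2 ^ 2)) :
    Submodule.span ℝ {M, iota n, nu n} = Submodule.span ℝ {iota n, nu n} :=
  Submodule.span_insert_eq_span (isokernel_le_span hn hM)

theorem span_triple_eq_of_special (M : Matrix (Fin 3) (Fin 3) ℝ) {n : Fin 3 → ℝ}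
    (hn : n 0 ^ 2 = n 1 ^ 2 ∧ n 1 ^ 2 = n 2 ^ 2) :
    Submodule.span ℝ {M, iota n, nu n} = Submodule.span ℝ {M, iota n} := by
  obtain ⟨c, hc⟩ := nu_eq_smul_iota hn
  rw [show ({M, iota n, nu n} : Set (Matrix (Fin 3) (Fin 3) ℝ)) = insert (nu n) {M, iota n} by
    ext; simp; tauto]
  refine Submodule.span_insert_eq_span ?_
  rw [hc]
  exact Submodule.smul_mem _ c (Submodule.subset_span (by simp))

theorem finrank_span_pair_of_linearIndependent {E : Type*} [AddCommGroup E] [Module ℝ E] {a b : E}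
    (h : LinearIndependent ℝ ![a, b]) : finrank ℝ (Submodule.span ℝ {a, b}) = 2 := by
  have := finrank_span_eq_card h
  rwa [Matrix.range_cons_cons_empty, Fintype.card_fin] at this

theorem IsStaeckelLine.finrank_eq_two {L : Submodule ℝ (Matrix (Fin 3) (Fin 3) ℝ)}
    (hL : IsStaeckelLine L) : finrank ℝ L = 2 := by
  obtain ⟨M, n, hn, hM, hsing, rfl⟩ := hL.exists_kernel
  by_cases hsq : n 0 ^ 2 = n 1 ^ 2 ∧ n 1 ^ 2 = n 2 ^ 2
  · rw [span_triple_eq_of_special M hsq]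
    refine finrank_span_pair_of_linearIndependent (LinearIndependent.pair_iff.mpr fun s t hst => ?_)
    have hs : s = 0 := by
      by_contra hs
      refine hsing (-(t / s)) hsq ?_
      calc M = s⁻¹ • s • M := (inv_smul_smul₀ hs M).symm
        _ = -(t / s) • iota n := by
          rw [eq_neg_of_add_eq_zero_left hst, smul_neg, smul_smul, ← neg_smul, div_eq_inv_mul]
    rw [hs, zero_smul, zero_add] at hst
    exact ⟨hs, (smul_eq_zero.mp hst).resolve_right (iota_ne_zero hn)⟩
  · rw [span_triple_eq_of_general hM hsq]
    exact finrank_span_pair_of_linearIndependent (linearIndependent_iota_nu hsq)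

theorem IsStaeckelLine.le_isokernel {L : Submodule ℝ (Matrix (Fin 3) (Fin 3) ℝ)}
    (hL : IsStaeckelLine L) : ∃ n : Fin 3 → ℝ, n ≠ 0 ∧ L ≤ isokernel n := by
  obtain ⟨M, n, hn, hM, -, rfl⟩ := hL.exists_kernel
  refine ⟨n, hn, Submodule.span_le.mpr ?_⟩
  rintro A (rfl | rfl | rfl)
  exacts [hM, iota_mem_isokernel n, nu_mem_isokernel n]

/-- Two vectors in the plane orthogonal to two independent vectors are proportional. -/
theorem mul_eq_mul_of_orthogonal {ε n a a' : Fin 3 → ℝ} (h : ¬ ∀ i j, ε i * n j = ε j * n i)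
    (h1 : a 0 * ε 0 + a 1 * ε 1 + a 2 * ε 2 = 0) (h2 : a 0 * n 0 + a 1 * n 1 + a 2 * n 2 = 0)
    (h3 : a' 0 * ε 0 + a' 1 * ε 1 + a' 2 * ε 2 = 0)
    (h4 : a' 0 * n 0 + a' 1 * n 1 + a' 2 * n 2 = 0) : a 0 * a' 1 = a 1 * a' 0 := by
  set c : Fin 3 → ℝ := ![a 1 * a' 2 - a 2 * a' 1, a 2 * a' 0 - a 0 * a' 2, a 0 * a' 1 - a 1 * a' 0]
    with hc
  have key : ∀ m : Fin 3 → ℝ, a 0 * m 0 + a 1 * m 1 + a 2 * m 2 = 0 →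
      a' 0 * m 0 + a' 1 * m 1 + a' 2 * m 2 = 0 → ∀ i j, c i * m j = c j * m i := by
    intro m e1 e2 i j
    fin_cases i <;> fin_cases j <;> simp [hc] <;>
      first
        | linear_combination a' 0 * e1 - a 0 * e2
        | linear_combination a' 1 * e1 - a 1 * e2
        | linear_combination a' 2 * e1 - a 2 * e2
        | linear_combination a 0 * e2 - a' 0 * e1
        | linear_combination a 1 * e2 - a' 1 * e1
        | linear_combination a 2 * e2 - a' 2 * e1
  have kε := key ε h1 h3
  have kn := key n h2 h4
  push Not at h
  obtain ⟨i, j, hij⟩ := h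
  have h0 : c 2 * (ε i * n j - ε j * n i) = 0 := by
    have e1 := kn 2 j
    have e2 := kn 2 i
    have e3 := kε i j
    linear_combination ε i * e1 - ε j * e2 + n 2 * (kε j i)
  have h5 := (mul_eq_zero.mp h0).resolve_right (sub_ne_zero.mpr hij)
  simp only [hc, Matrix.cons_val] at h5
  linarith

/-- The skew part of `A` drops out of `εᵀ A ε`, and `εᵢ² = 1` turns the diagonal part into the
trace. -/
theorem vecMul_dot_eq_zero {A : Matrix (Fin 3) (Fin 3) ℝ} (hA : A ∈ ksSpace) {ε : Fin 3 → ℝ}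
    (hε : ∀ i, ε i ^ 2 = 1) :
    A.vecMul ε 0 * ε 0 + A.vecMul ε 1 * ε 1 + A.vecMul ε 2 * ε 2 = 0 := by
  obtain ⟨h1, h2, h3, h4⟩ := mem_ksSpace_iff.mp hA
  simp only [Matrix.vecMul, dotProduct, Fin.sum_univ_three, h1, h2, h3]
  linear_combination A 0 0 * hε 0 + A 1 1 * hε 1 + A 2 2 * hε 2 + h4

theorem vecMul_dot_kernel {n : Fin 3 → ℝ} {A : Matrix (Fin 3) (Fin 3) ℝ} (hA : A ∈ isokernel n)
    (ε : Fin 3 → ℝ) :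
    A.vecMul ε 0 * n 0 + A.vecMul ε 1 * n 1 + A.vecMul ε 2 * n 2 = 0 := by
  obtain ⟨h1, h2, h3⟩ := mulVec_eq_zero_iff.mp (mem_isokernel.mp hA).2
  simp only [Matrix.vecMul, dotProduct, Fin.sum_univ_three]
  linear_combination ε 0 * h1 + ε 1 * h2 + ε 2 * h3

/-- If `ε` and `n` are independent, the rows `εᵀA` and `εᵀB` are orthogonal to both, hence parallel.
If `n` is parallel to `ε`, the kernel is special and `εᵀ ι(n) = 0`, so that both rows are multiples
of `εᵀM`. -/
theorem IsStaeckelLine.vecMul_eq {L : Submodule ℝ (Matrix (Fin 3) (Fin 3) ℝ)}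
    (hL : IsStaeckelLine L) {A B : Matrix (Fin 3) (Fin 3) ℝ} (hA : A ∈ L) (hB : B ∈ L)
    {ε : Fin 3 → ℝ} (hε : ∀ i, ε i ^ 2 = 1) :
    A.vecMul ε 0 * B.vecMul ε 1 = A.vecMul ε 1 * B.vecMul ε 0 := by
  obtain ⟨M, n, hn, hM, -, rfl⟩ := hL.exists_kernel
  by_cases h : ∀ i j, ε i * n j = ε j * n i
  · have hi : ∀ j, (iota n).vecMul ε j = 0 := fun j => by
      have h1 := h 0 1
      have h2 := h 1 2
      have h3 := h 2 0
      fin_cases j <;> simp [iota, Matrix.vecMul, dotProduct, Fin.sum_univ_three] <;> linarith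
    have hsq : n 0 ^ 2 = n 1 ^ 2 ∧ n 1 ^ 2 = n 2 ^ 2 := by
      constructor
      · linear_combination (ε 0 * n 1 + ε 1 * n 0) * h 1 0 - n 0 ^ 2 * hε 1 + n 1 ^ 2 * hε 0
      · linear_combination (ε 1 * n 2 + ε 2 * n 1) * h 2 1 - n 1 ^ 2 * hε 2 + n 2 ^ 2 * hε 1
    rw [span_triple_eq_of_special M hsq, Submodule.mem_span_pair] at hA hB
    obtain ⟨a, b, rfl⟩ := hA
    obtain ⟨a', b', rfl⟩ := hB
    simp only [Matrix.vecMul_add, Matrix.vecMul_smul, Pi.add_apply, Pi.smul_apply, hi, smul_eq_mul,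
      mul_zero, add_zero]
    ring
  · have hle : Submodule.span ℝ {M, iota n, nu n} ≤ isokernel n := by
      rw [Submodule.span_le]
      rintro A (rfl | rfl | rfl)
      exacts [hM, iota_mem_isokernel n, nu_mem_isokernel n]
    exact mul_eq_mul_of_orthogonal h (vecMul_dot_eq_zero (mem_isokernel.mp (hle hA)).1 hε)
      (vecMul_dot_kernel (hle hA) ε) (vecMul_dot_eq_zero (mem_isokernel.mp (hle hB)).1 hε)
      (vecMul_dot_kernel (hle hB) ε)

/-- The commutation relations in terms of the Killing-Stäckel matrices. -/
theorem paramCommute_iff (k k' : Fin 6 → ℝ) : ParamCommute k k' ↔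
    ∀ ε : Fin 3 → ℝ, (∀ i, ε i ^ 2 = 1) →
      (paramMatrix k).vecMul ε 0 * (paramMatrix k').vecMul ε 1
        = (paramMatrix k).vecMul ε 1 * (paramMatrix k').vecMul ε 0 := by
  simp only [paramMatrix, LinearMap.coe_mk, AddHom.coe_mk, Matrix.vecMul, dotProduct,
    Fin.sum_univ_three, Matrix.of_apply, Matrix.cons_val]
  constructor
  · rintro ⟨h1, h2, h3, h4⟩ ε hε
    have h : ∀ i, ε i = 1 ∨ ε i = -1 := fun i => mul_self_eq_one_iff.mp (by rw [← sq]; exact hε i)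
    rcases h 0 with e0 | e0 <;> rcases h 1 with e1 | e1 <;> rcases h 2 with e2 | e2 <;>
      rw [e0, e1, e2] <;>
      first
        | linear_combination h1
        | linear_combination h2
        | linear_combination h3
        | linear_combination h4
        | linear_combination -h1
        | linear_combination -h2
        | linear_combination -h3
  · intro h
    have h1 := h ![1, 1, 1] (by simp [Fin.forall_fin_succ])
    have h2 := h ![1, -1, -1] (by simp [Fin.forall_fin_succ])
    have h3 := h ![-1, 1, -1] (by simp [Fin.forall_fin_succ])
    have h4 := h ![-1, -1, 1] (by simp [Fin.forall_fin_succ])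
    simp only [Matrix.cons_val] at h1 h2 h3 h4
    refine ⟨?_, ?_, ?_, ?_⟩ <;>
      first
        | linear_combination h1
        | linear_combination h2
        | linear_combination h3
        | linear_combination h4
        | linear_combination -h1
        | linear_combination -h2
        | linear_combination -h3

theorem paramMatrix_mem (k : Fin 6 → ℝ) : paramMatrix k ∈ ksSpace := by
  rw [mem_ksSpace_iff]
  simp only [paramMatrix, LinearMap.coe_mk, AddHom.coe_mk, Matrix.of_apply, Matrix.cons_val]
  exact ⟨trivial, trivial, trivial, by ring⟩

theorem range_paramMatrix : LinearMap.range paramMatrix = ksSubmodule := by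
  refine le_antisymm ?_ fun A hA => ?_
  · rintro _ ⟨k, rfl⟩
    exact paramMatrix_mem k
  · obtain ⟨h1, h2, h3, h4⟩ := mem_ksSpace_iff.mp hA
    -- The preimage with zero scalar part: `w₁ = (A 2 2 - A 1 1) / 3` and `t₁ = A 2 1` and
    -- cyclically, with diagonal components `w ± t`.
    refine ⟨![(A 2 2 - A 1 1) / 3 + A 2 1, (A 0 0 - A 2 2) / 3 + A 0 2,
      (A 1 1 - A 0 0) / 3 + A 1 0, (A 2 2 - A 1 1) / 3 - A 2 1, (A 0 0 - A 2 2) / 3 - A 0 2,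
      (A 1 1 - A 0 0) / 3 - A 1 0], ?_⟩
    ext i j
    fin_cases i <;> fin_cases j <;> simp [paramMatrix] <;> linarith

/-- Constant components belong to the multiples of the metric. They account for the difference in
dimension between a line, as a space of matrices, and a Stäckel system. -/
theorem ker_paramMatrix : LinearMap.ker paramMatrix = Submodule.span ℝ {1} := by
  ext k
  rw [LinearMap.mem_ker, Submodule.mem_span_singleton]
  constructor
  · intro h
    have e := fun i j => congrFun (congrFun h i) j
    have e0 := e 0 0
    have e1 := e 1 1
    have e3 := e 1 0
    have e4 := e 0 2
    have e5 := e 2 1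
    simp [paramMatrix] at e0 e1 e3 e4 e5
    refine ⟨k 0, ?_⟩
    funext p
    fin_cases p <;> simp <;> linarith
  · rintro ⟨c, rfl⟩
    ext i j
    fin_cases i <;> fin_cases j <;> simp [paramMatrix]

theorem finrank_map_add_finrank_inf_ker {E F : Type*} [AddCommGroup E] [Module ℝ E]
    [AddCommGroup F] [Module ℝ F] [FiniteDimensional ℝ E] (f : E →ₗ[ℝ] F) (C : Submodule ℝ E) :
    finrank ℝ (C.map f) + finrank ℝ (C ⊓ LinearMap.ker f : Submodule ℝ E) = finrank ℝ C := by
  have h := LinearMap.finrank_range_add_finrank_ker (f.domRestrict C)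
  rw [LinearMap.range_domRestrict, LinearMap.ker_domRestrict] at h
  rw [← h, ← Submodule.map_comap_subtype, Submodule.finrank_map_subtype_eq]

theorem finrank_ker_paramMatrix : finrank ℝ (LinearMap.ker paramMatrix) = 1 := by
  rw [ker_paramMatrix]
  exact finrank_span_singleton one_ne_zero

theorem finrank_comap_paramMatrix {L : Submodule ℝ (Matrix (Fin 3) (Fin 3) ℝ)}
    (hL : L ≤ ksSubmodule) : finrank ℝ (L.comap paramMatrix) = finrank ℝ L + 1 := by
  rw [← finrank_map_add_finrank_inf_ker paramMatrix, Submodule.map_comap_eq, range_paramMatrix,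
    inf_eq_right.mpr hL, inf_eq_right.mpr (LinearMap.ker_le_comap paramMatrix),
    finrank_ker_paramMatrix]

theorem finrank_le_finrank_map_paramMatrix (T : Submodule ℝ (Fin 6 → ℝ)) :
    finrank ℝ T ≤ finrank ℝ (T.map paramMatrix) + 1 := by
  rw [← finrank_map_add_finrank_inf_ker paramMatrix, ← finrank_ker_paramMatrix]
  exact Nat.add_le_add_left (Submodule.finrank_mono inf_le_right) _

end StaeckelLines

end KSVariety

namespace KSVariety

/-! ### From Stäckel lines to Stäckel systems -/

section LinesToSystems

variable {V : Type*} [NormedAddCommGroup V] [InnerProductSpace ℝ V]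
  [Fact (finrank ℝ V = 3 + 1)]

theorem IsCurvOf.exists_eq_diagField {e : OrthonormalBasis (Fin 4) ℝ V} {K : EndField V}
    (hK : IsSymField K) {R : Tensor4 V} (hR : IsCurvOf K R) (hd : IsDiagonal e R) :
    ∃ k, K = diagField e k ∧ ksMatrix e R = paramMatrix k := by
  refine ⟨_, IsCurvOf.eq_diagField hK (e := e) (k := fun p => pairMatrix e R p p) ?_,
    ksMatrix_eq e R⟩
  rwa [← hd.eq_diagTensor hR.1]

/-- All matrices of a Stäckel line share a kernel vector, so their determinants vanish and
integrability is automatic. This is why the preimage is a linear space. -/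
theorem IsStaeckelLine.ksPreimage_eq {L : Submodule ℝ (Matrix (Fin 3) (Fin 3) ℝ)}
    (hL : IsStaeckelLine L) (e : OrthonormalBasis (Fin 4) ℝ V) :
    (((L.comap paramMatrix).map (diagField e) : Submodule ℝ (EndField V)) : Set (EndField V))
      = ksPreimage e L := by
  obtain ⟨n, hn, hLn⟩ := hL.le_isokernel
  ext K
  constructor
  · rintro ⟨k, hk, rfl⟩
    refine ⟨isKilling_diagField e k,
      isIntegrable_diagField e (det_eq_zero_of_mem_isokernel hn (hLn hk)), diagTensor e k,
      isCurvOf_diagField e k, isDiagonal_diagTensor e k, ?_⟩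
    rw [ksMatrix_diagTensor]
    exact hk
  · rintro ⟨hK, -, R, hR, hd, hmem⟩
    obtain ⟨k, rfl, hk⟩ := hR.exists_eq_diagField hK.1 hd
    exact ⟨k, by rwa [hk] at hmem, rfl⟩

theorem IsStaeckelLine.le_ksSubmodule {L : Submodule ℝ (Matrix (Fin 3) (Fin 3) ℝ)}
    (hL : IsStaeckelLine L) : L ≤ ksSubmodule := by
  obtain ⟨n, -, hLn⟩ := hL.le_isokernel
  exact hLn.trans inf_le_left

theorem IsStaeckelLine.isStaeckelSystem {L : Submodule ℝ (Matrix (Fin 3) (Fin 3) ℝ)}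
    (hL : IsStaeckelLine L) (e : OrthonormalBasis (Fin 4) ℝ V) :
    IsStaeckelSystem ((L.comap paramMatrix).map (diagField e)) where
  finrank_eq := by
    rw [← (Submodule.equivMapOfInjective _ (diagField_injective e) _).finrank_eq,
      finrank_comap_paramMatrix hL.le_ksSubmodule, hL.finrank_eq_two]
  killing := by
    rintro _ ⟨k, -, rfl⟩
    exact isKilling_diagField e k
  integrable := by
    obtain ⟨n, hn, hLn⟩ := hL.le_isokernel
    rintro _ ⟨k, hk, rfl⟩
    exact isIntegrable_diagField e (det_eq_zero_of_mem_isokernel hn (hLn hk))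
  commute := by
    rintro _ ⟨k, hk, rfl⟩ _ ⟨k', hk', rfl⟩ x
    exact ((paramCommute_iff k k').mpr fun ε hε => hL.vecMul_eq hk hk' hε).commute e x

end LinesToSystems

/-! ### Kernels forced by commutation, and non-singular points -/

section SystemsToLines

theorem eq_iota {A : Matrix (Fin 3) (Fin 3) ℝ} (hA : A ∈ ksSpace) (h0 : A 0 0 = 0)
    (h2 : A 2 2 = 0) : A = iota ![A 2 1, A 0 2, A 1 0] := by
  obtain ⟨e1, e2, e3, e4⟩ := mem_ksSpace_iff.mp hA
  ext i j
  fin_cases i <;> fin_cases j <;> simp [iota] <;> linarith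

/-- A nonzero skew matrix which satisfies the commutation relations with a Killing-Stäckel matrix
determines the kernel of the latter. -/
theorem mem_isokernel_of_vecMul_eq {n : Fin 3 → ℝ} (hn : n ≠ 0) {A : Matrix (Fin 3) (Fin 3) ℝ}
    (hA : A ∈ ksSpace) (h : ∀ ε : Fin 3 → ℝ, (∀ i, ε i ^ 2 = 1) →
      (iota n).vecMul ε 0 * A.vecMul ε 1 = (iota n).vecMul ε 1 * A.vecMul ε 0) :
    A ∈ isokernel n := by
  set y := A.mulVec n with hy
  -- For each sign vector, the row `b = εᵀA` is parallel to `a = εᵀ ι(n)`, and `a` is orthogonal to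
  -- `n`. So either `a = 0`, which means that `ε` is parallel to `n`, or `εᵀ A n = 0`.
  have key : ∀ ε : Fin 3 → ℝ, (∀ i, ε i ^ 2 = 1) →
      (ε 0 * n 1 = ε 1 * n 0 ∧ ε 0 * n 2 = ε 2 * n 0) ∨ ε 0 * y 0 + ε 1 * y 1 + ε 2 * y 2 = 0 := by
    intro ε hε
    have h1 := h ε hε
    have o1 := vecMul_dot_eq_zero (mem_isokernel.mp (iota_mem_isokernel n)).1 hε
    have o2 := vecMul_dot_eq_zero hA hε
    have o3 := vecMul_dot_kernel (iota_mem_isokernel n) ε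
    have hb : ε 0 * y 0 + ε 1 * y 1 + ε 2 * y 2
        = A.vecMul ε 0 * n 0 + A.vecMul ε 1 * n 1 + A.vecMul ε 2 * n 2 := by
      simp only [hy, Matrix.vecMul, Matrix.mulVec, dotProduct, Fin.sum_univ_three]
      ring
    rw [hb]
    have i1 : (iota n).vecMul ε 1 = ε 2 * n 0 - ε 0 * n 2 := by
      simp [iota, Matrix.vecMul, dotProduct, Fin.sum_univ_three]; ring
    have i2 : (iota n).vecMul ε 2 = ε 0 * n 1 - ε 1 * n 0 := by
      simp [iota, Matrix.vecMul, dotProduct, Fin.sum_univ_three]; ring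
    generalize (iota n).vecMul ε = a at *
    generalize A.vecMul ε = b at *
    -- The third coordinates follow from the first two because both rows are orthogonal to `ε`.
    have c02 : a 0 * b 2 = a 2 * b 0 := by
      linear_combination (-(a 0 * b 2) + a 2 * b 0) * hε 2 + ε 2 * (a 0 * o2 - b 0 * o1) - ε 2 * ε 1 * h1
    have c12 : a 1 * b 2 = a 2 * b 1 := by
      linear_combination (-(a 1 * b 2) + a 2 * b 1) * hε 2 + ε 2 * (a 1 * o2 - b 1 * o1) + ε 2 * ε 0 * h1
    have z1 : a 1 * (b 0 * n 0 + b 1 * n 1 + b 2 * n 2) = 0 := by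
      linear_combination b 1 * o3 - n 0 * h1 + n 2 * c12
    have z2 : a 2 * (b 0 * n 0 + b 1 * n 1 + b 2 * n 2) = 0 := by
      linear_combination b 2 * o3 - n 0 * c02 - n 1 * c12
    by_cases hz : b 0 * n 0 + b 1 * n 1 + b 2 * n 2 = 0
    · exact Or.inr hz
    · left
      have y1 := (mul_eq_zero.mp z1).resolve_right hz
      have y2 := (mul_eq_zero.mp z2).resolve_right hz
      exact ⟨by linarith, by linarith⟩
  have k1 := key ![1, 1, 1] (by simp [Fin.forall_fin_succ])
  have k2 := key ![1, -1, -1] (by simp [Fin.forall_fin_succ])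
  have k3 := key ![-1, 1, -1] (by simp [Fin.forall_fin_succ])
  have k4 := key ![-1, -1, 1] (by simp [Fin.forall_fin_succ])
  simp only [Matrix.cons_val] at k1 k2 k3 k4
  have hn' : ¬ (n 0 = 0 ∧ n 1 = 0 ∧ n 2 = 0) := fun ⟨h0, h1, h2⟩ => hn (by
    funext i
    fin_cases i <;> assumption)
  -- At most one of the four sign vectors is parallel to `n ≠ 0`, and any three of them are
  -- independent, so `A n = 0`.
  have hy0 : y 0 = 0 ∧ y 1 = 0 ∧ y 2 = 0 := by
    rcases k1 with ⟨p1, q1⟩ | k1 <;> rcases k2 with ⟨p2, q2⟩ | k2 <;>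
      rcases k3 with ⟨p3, q3⟩ | k3 <;> rcases k4 with ⟨p4, q4⟩ | k4 <;>
      first
        | exact ⟨by linarith, by linarith, by linarith⟩
        | exact absurd ⟨by linarith, by linarith, by linarith⟩ hn'
  rw [mem_isokernel]
  refine ⟨hA, funext fun i => ?_⟩
  fin_cases i
  exacts [hy0.1, hy0.2.1, hy0.2.2]

theorem ker_iota {n : Fin 3 → ℝ} (hn : n ≠ 0) :
    LinearMap.ker (iota n).mulVecLin = Submodule.span ℝ {n} := by
  ext v
  rw [LinearMap.mem_ker, Matrix.mulVecLin_apply, Submodule.mem_span_singleton]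
  constructor
  · intro h
    have hv : iota v ∈ isokernel n := by
      rw [mem_isokernel]
      refine ⟨(mem_isokernel.mp (iota_mem_isokernel v)).1, ?_⟩
      rw [mulVec_eq_zero_iff] at h ⊢
      simp only [iota, Matrix.of_apply, Matrix.cons_val] at h ⊢
      exact ⟨by linarith [h.1], by linarith [h.2.1], by linarith [h.2.2]⟩
    obtain ⟨c, hc⟩ := eq_smul_iota hn hv (by simp [iota]) (by simp [iota])
    refine ⟨c, ?_⟩
    have h0 := congrFun (congrFun hc 2) 1
    have h1 := congrFun (congrFun hc 0) 2
    have h2 := congrFun (congrFun hc 1) 0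
    simp [iota] at h0 h1 h2
    funext i
    fin_cases i <;> simp [h0, h1, h2]
  · rintro ⟨c, rfl⟩
    rw [Matrix.mulVec_smul, (mem_isokernel.mp (iota_mem_isokernel n)).2, smul_zero]

theorem diagonal_mem_ksSpace {a : Fin 3 → ℝ} (ha : a 0 + a 1 + a 2 = 0) :
    Matrix.diagonal a ∈ ksSpace := by
  rw [mem_ksSpace_iff]
  simpa using ha

/-- Here `iota n` itself is a non-singular point: the form `A ↦ nᵀ A n` is nonzero on trace free
diagonal matrices unless the `nᵢ²` coincide. -/
theorem isStaeckelLine_of_general {n : Fin 3 → ℝ}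
    (hn : ¬ (n 0 ^ 2 = n 1 ^ 2 ∧ n 1 ^ 2 = n 2 ^ 2)) :
    IsStaeckelLine (Submodule.span ℝ {iota n, nu n}) := by
  have hn0 : n ≠ 0 := by
    rintro rfl
    simp at hn
  have hmem := iota_mem_isokernel n
  refine ⟨iota n, n, ⟨⟨(mem_isokernel.mp hmem).1, det_eq_zero_of_mem_isokernel hn0 hmem⟩,
    iota_ne_zero hn0, ?_⟩, ker_iota hn0, by rw [span_triple_eq_of_general hmem hn]⟩
  have key : ∀ a : Fin 3 → ℝ, a 0 + a 1 + a 2 = 0 →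
      deriv (fun t : ℝ => (iota n + t • Matrix.diagonal a).det) 0
        = a 0 * n 0 ^ 2 + a 1 * n 1 ^ 2 + a 2 * n 2 ^ 2 := fun a ha => by
    have := trace_adjugate_smul_iota 1 n (diagonal_mem_ksSpace ha)
    rw [one_smul] at this
    rw [deriv_det_line, this]
    simp
  by_contra hcon
  push Not at hcon
  have h1 := hcon _ (diagonal_mem_ksSpace (a := ![1, -1, 0]) (by simp))
  have h2 := hcon _ (diagonal_mem_ksSpace (a := ![0, 1, -1]) (by simp))
  rw [key _ (by simp)] at h1 h2
  simp at h1 h2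
  exact hn ⟨by linarith, by linarith⟩

/-- The matrices which annihilate `(1, σ, τ)`, up to multiples of the skew one. -/
noncomputable def specialMatrix (σ τ p q : ℝ) : Matrix (Fin 3) (Fin 3) ℝ :=
  !![q - p, -(σ * q), τ * p;
    σ * q, -p - 2 * q, σ * τ * (p + q);
    -(τ * p), -(σ * τ * (p + q)), 2 * p + q]

/-- The condition `ht` removes the component along `iota n`. What remains of the matrices killing
`(1, σ, τ)` is a two-parameter family. -/
theorem exists_eq_specialMatrix {n : Fin 3 → ℝ} (hn0 : n ≠ 0)
    (hn : n 0 ^ 2 = n 1 ^ 2 ∧ n 1 ^ 2 = n 2 ^ 2) {M : Matrix (Fin 3) (Fin 3) ℝ}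
    (hM : M ∈ isokernel n) (ht : M 2 1 * n 0 + M 0 2 * n 1 + M 1 0 * n 2 = 0) :
    ∃ σ τ p q : ℝ, (σ = 1 ∨ σ = -1) ∧ (τ = 1 ∨ τ = -1) ∧ n 0 ≠ 0 ∧ n = n 0 • ![1, σ, τ] ∧
      M = specialMatrix σ τ p q := by
  obtain ⟨⟨e1, e2, e3, e4⟩, h5, h6, h7⟩ : _ ∧ _ := by
    rwa [mem_isokernel, mem_ksSpace_iff, mulVec_eq_zero_iff] at hM
  obtain ⟨m, hm⟩ : ∃ m, m = n 0 := ⟨_, rfl⟩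
  have hm0 : m ≠ 0 := fun h => hn0 (by
    rw [hm] at h
    have h1 : n 1 = 0 := by rw [h] at hn; nlinarith [hn.1]
    have h2 : n 2 = 0 := by rw [h1] at hn; nlinarith [hn.2]
    funext i
    fin_cases i <;> assumption)
  obtain ⟨σ, hσ, n1⟩ : ∃ σ, (σ = 1 ∨ σ = -1) ∧ n 1 = σ * m := by
    rcases sq_eq_sq_iff_eq_or_eq_neg.mp hn.1.symm with h | h
    · exact ⟨1, Or.inl rfl, by rw [h, hm, one_mul]⟩
    · exact ⟨-1, Or.inr rfl, by rw [h, hm, neg_one_mul]⟩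
  obtain ⟨τ, hτ, n2⟩ : ∃ τ, (τ = 1 ∨ τ = -1) ∧ n 2 = τ * m := by
    rcases sq_eq_sq_iff_eq_or_eq_neg.mp (hn.1.trans hn.2).symm with h | h
    · exact ⟨1, Or.inl rfl, by rw [h, hm, one_mul]⟩
    · exact ⟨-1, Or.inr rfl, by rw [h, hm, neg_one_mul]⟩
  have hσ2 : σ * σ = 1 := mul_self_eq_one_iff.mpr hσ
  have hτ2 : τ * τ = 1 := mul_self_eq_one_iff.mpr hτ
  refine ⟨σ, τ, τ * M 0 2, σ * M 1 0, hσ, hτ, hm ▸ hm0, ?_, ?_⟩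
  · funext i
    fin_cases i <;> simp [n1, n2, ← hm, mul_comm]
  obtain ⟨p, hp⟩ : ∃ p, p = τ * M 0 2 := ⟨_, rfl⟩
  obtain ⟨q, hq⟩ : ∃ q, q = σ * M 1 0 := ⟨_, rfl⟩
  rw [← hm, n1, n2] at h5 h6 h7 ht
  rw [← hp, ← hq]
  have m02 : M 0 2 = τ * p := by rw [hp]; linear_combination (-M 0 2) * hτ2
  have m10 : M 1 0 = σ * q := by rw [hq]; linear_combination (-M 1 0) * hσ2
  have m20 : M 2 0 = -(τ * p) := by rw [e2, m02]
  have m01 : M 0 1 = -(σ * q) := by rw [e1, m10]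
  have m21 : M 2 1 = -(σ * τ * (p + q)) := mul_right_cancel₀ hm0 (by
    rw [m02, m10] at ht; linear_combination ht)
  have m12 : M 1 2 = σ * τ * (p + q) := by rw [e3, m21, neg_neg]
  have m00 : M 0 0 = q - p := mul_right_cancel₀ hm0 (by
    rw [m01, m02] at h5; linear_combination h5 + q * m * hσ2 - p * m * hτ2)
  have m22 : M 2 2 = 2 * p + q := mul_right_cancel₀ hm0 (by
    rw [m20, m21] at h7
    linear_combination τ * h7 + (p * m - M 2 2 * m + σ * σ * (p + q) * m) * hτ2 + (p + q) * m * hσ2)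
  have m11 : M 1 1 = -p - 2 * q := by linarith
  ext i j
  fin_cases i <;> fin_cases j <;>
    simp [specialMatrix, m00, m01, m02, m10, m11, m12, m20, m21, m22]

variable {σ τ p q : ℝ}

/-- The form `p² + pq + q²` is positive definite, so every nonzero member of the family has rank
two. It appears as a factor when the equations are solved for `v 1` and `v 2`. -/
theorem ker_specialMatrix (hσ : σ = 1 ∨ σ = -1) (hτ : τ = 1 ∨ τ = -1)
    (hpq : p ^ 2 + p * q + q ^ 2 ≠ 0) {v : Fin 3 → ℝ}
    (hv : (specialMatrix σ τ p q).mulVec v = 0) : v = v 0 • ![1, σ, τ] := by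
  obtain ⟨r0, r1, r2⟩ := mulVec_eq_zero_iff.mp hv
  simp only [specialMatrix, Matrix.of_apply, Matrix.cons_val] at r0 r1 r2
  have hσ2 : σ * σ = 1 := mul_self_eq_one_iff.mpr hσ
  have hτ2 : τ * τ = 1 := mul_self_eq_one_iff.mpr hτ
  have s1 : (p ^ 2 + p * q + q ^ 2) * (v 1 - σ * v 0) = 0 := by
    rcases hσ with rfl | rfl <;> rcases hτ with rfl | rfl
    · linear_combination (-1) * ((2 * p + q) * r1 - (p + q) * r2 + (p * r2 - (2 * p + q) * r0)
        + ((p + q) * r0 - p * r1))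
    · linear_combination (-1) * ((2 * p + q) * r1 + (p + q) * r2 - p * r2 - (2 * p + q) * r0
        + (p + q) * r0 - p * r1)
    · linear_combination (-1) * ((2 * p + q) * r1 + (p + q) * r2 - p * r2 + (2 * p + q) * r0
        - (p + q) * r0 - p * r1)
    · linear_combination (-1) * ((2 * p + q) * r1 - (p + q) * r2 + p * r2 + (2 * p + q) * r0
        - (p + q) * r0 - p * r1)
  have s2 : (p ^ 2 + p * q + q ^ 2) * (v 2 - τ * v 0) = 0 := by
    rcases hσ with rfl | rfl <;> rcases hτ with rfl | rfl
    · linear_combination (p + 2 * q) * r2 - (p + q) * r1 + (p + q) * r0 - q * r2 + q * r1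
        - (p + 2 * q) * r0
    · linear_combination (p + 2 * q) * r2 + (p + q) * r1 - (p + q) * r0 - q * r2 - q * r1
        + (p + 2 * q) * r0
    · linear_combination (p + 2 * q) * r2 + (p + q) * r1 + (p + q) * r0 - q * r2 - q * r1
        - (p + 2 * q) * r0
    · linear_combination (p + 2 * q) * r2 - (p + q) * r1 - (p + q) * r0 - q * r2 + q * r1
        + (p + 2 * q) * r0
  have w1 := (mul_eq_zero.mp s1).resolve_left hpq
  have w2 := (mul_eq_zero.mp s2).resolve_left hpq
  funext i
  fin_cases i <;> simp <;> linarith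

theorem exists_deriv_specialMatrix_ne_zero (hσ : σ = 1 ∨ σ = -1) (hτ : τ = 1 ∨ τ = -1)
    (hpq : p ^ 2 + p * q + q ^ 2 ≠ 0) :
    ∃ A ∈ ksSpace, deriv (fun t : ℝ => (specialMatrix σ τ p q + t • A).det) 0 ≠ 0 := by
  have hσ2 : σ * σ = 1 := mul_self_eq_one_iff.mpr hσ
  have hτ2 : τ * τ = 1 := mul_self_eq_one_iff.mpr hτ
  have key : ∀ a : Fin 3 → ℝ, deriv (fun t : ℝ => (specialMatrix σ τ p q
      + t • Matrix.diagonal a).det) 0 = a 0 * (-p ^ 2 - 3 * p * q - q ^ 2)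
        + a 1 * (-p ^ 2 + p * q + q ^ 2) + a 2 * (p ^ 2 + p * q - q ^ 2) := fun a => by
    rw [deriv_det_line]
    simp only [specialMatrix, Matrix.trace, Matrix.diag, Fin.sum_univ_three,
      Matrix.adjugate_fin_three, Matrix.mul_diagonal, Matrix.of_apply, Matrix.cons_val]
    linear_combination (a 0 * (p + q) ^ 2 * τ * τ + a 2 * q ^ 2) * hσ2
      + (a 0 * (p + q) ^ 2 + a 1 * p ^ 2) * hτ2
  by_contra hcon
  push Not at hcon
  -- Trace free diagonal directions already suffice to detect non-singularity.
  have h1 := hcon _ (diagonal_mem_ksSpace (a := ![1, -1, 0]) (by simp))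
  have h2 := hcon _ (diagonal_mem_ksSpace (a := ![0, 1, -1]) (by simp))
  rw [key] at h1 h2
  simp only [Matrix.cons_val] at h1 h2
  have h3 : p ^ 2 = q ^ 2 := by linarith
  have h4 : q * (2 * p + q) = 0 := by linarith
  rcases mul_eq_zero.mp h4 with h | h
  · rw [h] at h3 hpq
    exact hpq (by simpa using h3)
  · obtain rfl : q = -2 * p := by linarith
    exact hpq (by nlinarith)

/-- A nonsingular point over a special kernel. -/
theorem isNonsingularPoint_of_special {n : Fin 3 → ℝ} (hn0 : n ≠ 0)
    (hn : n 0 ^ 2 = n 1 ^ 2 ∧ n 1 ^ 2 = n 2 ^ 2) {M : Matrix (Fin 3) (Fin 3) ℝ}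
    (hM : M ∈ isokernel n) (hM0 : M ≠ 0) (ht : M 2 1 * n 0 + M 0 2 * n 1 + M 1 0 * n 2 = 0) :
    IsNonsingularPoint M ∧ LinearMap.ker M.mulVecLin = Submodule.span ℝ {n} := by
  have hdet : M.det = 0 := det_eq_zero_of_mem_isokernel hn0 hM
  obtain ⟨hks, hMn⟩ := mem_isokernel.mp hM
  obtain ⟨σ, τ, p, q, hσ, hτ, hm, hn', rfl⟩ := exists_eq_specialMatrix hn0 hn hM ht
  have hpq : p ^ 2 + p * q + q ^ 2 ≠ 0 := fun h => hM0 (by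
    have hp : p = 0 := by nlinarith [sq_nonneg (p + 2 * q), sq_nonneg p]
    have hq : q = 0 := by nlinarith [sq_nonneg (2 * p + q), sq_nonneg q]
    ext i j
    fin_cases i <;> fin_cases j <;> simp [specialMatrix, hp, hq])
  refine ⟨⟨⟨hks, hdet⟩, hM0, exists_deriv_specialMatrix_ne_zero hσ hτ hpq⟩, ?_⟩
  ext v
  rw [LinearMap.mem_ker, Matrix.mulVecLin_apply, Submodule.mem_span_singleton]
  constructor
  · intro hv
    refine ⟨v 0 / n 0, ?_⟩
    refine (congrArg (fun u => (v 0 / n 0) • u) hn').trans ?_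
    rw [smul_smul, div_mul_cancel₀ _ hm, ← ker_specialMatrix hσ hτ hpq hv]
  · rintro ⟨c, rfl⟩
    rw [Matrix.mulVec_smul, hMn, smul_zero]

end SystemsToLines

end KSVariety

namespace KSVariety

/-! ### Recognising Stäckel lines among spaces of matrices -/

section SpacesOfMatrices

variable {L : Submodule ℝ (Matrix (Fin 3) (Fin 3) ℝ)}

/-- A space of Killing-Stäckel matrices with proportional diagonals contains a skew matrix. -/
theorem exists_iota_mem (hL : L ≤ ksSubmodule) (h2 : 2 ≤ finrank ℝ L)
    (hd : ∀ A ∈ L, ∀ B ∈ L, A 0 0 * B 2 2 = B 0 0 * A 2 2) : ∃ n, n ≠ 0 ∧ iota n ∈ L := by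
  have hex : ∃ C ∈ L, C ≠ 0 ∧ C 0 0 = 0 ∧ C 2 2 = 0 := by
    have hbot : L ≠ ⊥ := by
      rintro rfl
      simp at h2
    obtain ⟨A, hA, hA0⟩ := Submodule.exists_mem_ne_zero_of_ne_bot hbot
    by_cases hAd : A 0 0 = 0 ∧ A 2 2 = 0
    · exact ⟨A, hA, hA0, hAd⟩
    have hnle : ¬ L ≤ Submodule.span ℝ {A} := fun hle => by
      have := Submodule.finrank_mono hle
      rw [finrank_span_singleton hA0] at this
      omega
    obtain ⟨B, hB, hBA⟩ := SetLike.not_le_iff_exists.mp hnle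
    have hne : ∀ a b : ℝ, a ≠ 0 → a • B - b • A ≠ 0 := fun a b ha h => hBA (by
      rw [Submodule.mem_span_singleton]
      refine ⟨a⁻¹ * b, ?_⟩
      rw [mul_smul, ← sub_eq_zero.mp h, inv_smul_smul₀ ha])
    have hm : ∀ a b : ℝ, a • B - b • A ∈ L := fun a b =>
      L.sub_mem (L.smul_mem a hB) (L.smul_mem b hA)
    have hAB := hd A hA B hB
    -- As the diagonals are proportional, a suitable combination of two independent members has zero
    -- diagonal.
    by_cases h0 : A 0 0 = 0
    · refine ⟨_, hm (A 2 2) (B 2 2), hne _ _ fun h => hAd ⟨h0, h⟩, ?_, ?_⟩ <;>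
        simp only [Matrix.sub_apply, Matrix.smul_apply, smul_eq_mul] <;> linarith
    · refine ⟨_, hm (A 0 0) (B 0 0), hne _ _ h0, ?_, ?_⟩ <;>
        simp only [Matrix.sub_apply, Matrix.smul_apply, smul_eq_mul] <;> linarith
  obtain ⟨C, hC, hC0, h00, h22⟩ := hex
  have hCi := eq_iota (hL hC) h00 h22
  refine ⟨_, fun hn => hC0 ?_, hCi ▸ hC⟩
  rw [hCi, hn]
  ext i j
  fin_cases i <;> fin_cases j <;> simp [iota]

/-- A space of Killing-Stäckel matrices which have a common kernel and proportional diagonals is a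
Stäckel line. -/
theorem isStaeckelLine_of_le_isokernel {n : Fin 3 → ℝ} (hn : n ≠ 0) (hL : L ≤ isokernel n)
    (hi : iota n ∈ L) (h2 : 2 ≤ finrank ℝ L)
    (hd : ∀ A ∈ L, ∀ B ∈ L, A 0 0 * B 2 2 = B 0 0 * A 2 2) : IsStaeckelLine L := by
  by_cases hsq : n 0 ^ 2 = n 1 ^ 2 ∧ n 1 ^ 2 = n 2 ^ 2
  swap
  -- For a general kernel all matrices that annihilate `n` form a two-dimensional space, and the
  -- dimension of `L` forces equality.
  · have hline := isStaeckelLine_of_general hsq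
    rwa [Submodule.eq_of_le_of_finrank_le (hL.trans (isokernel_le_span hsq))
      (by rw [hline.finrank_eq_two]; exact h2)]
  have hex : ∃ B ∈ L, ¬ (B 0 0 = 0 ∧ B 2 2 = 0) := by
    by_contra hcon
    push Not at hcon
    have hle : L ≤ Submodule.span ℝ {iota n} := fun A hA => by
      obtain ⟨h00, h22⟩ : A 0 0 = 0 ∧ A 2 2 = 0 := by
        by_contra h
        exact h (hcon A hA)
      obtain ⟨c, rfl⟩ := eq_smul_iota hn (hL hA) h00 h22
      exact Submodule.smul_mem _ c (Submodule.mem_span_singleton_self _)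
    have := Submodule.finrank_mono hle
    rw [finrank_span_singleton (iota_ne_zero hn)] at this
    omega
  obtain ⟨B, hB, hBd⟩ := hex
  have hle : L ≤ Submodule.span ℝ {B, iota n} := fun A hA => by
    obtain ⟨c, h00, h22⟩ : ∃ c, A 0 0 = c * B 0 0 ∧ A 2 2 = c * B 2 2 := by
      have hAB := hd A hA B hB
      by_cases h0 : B 0 0 = 0
      · have hB2 : B 2 2 ≠ 0 := fun h => hBd ⟨h0, h⟩
        refine ⟨A 2 2 / B 2 2, ?_, by field_simp⟩
        rw [h0, zero_mul, mul_eq_zero] at hAB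
        rw [h0, mul_zero, hAB.resolve_right hB2]
      · exact ⟨A 0 0 / B 0 0, by field_simp, by field_simp; linarith⟩
    obtain ⟨d, hd⟩ := eq_smul_iota hn (hL (L.sub_mem hA (L.smul_mem c hB))) (by simp [h00])
      (by simp [h22])
    exact Submodule.mem_span_pair.mpr ⟨c, d, by rw [← hd, add_sub_cancel]⟩
  have hle2 : finrank ℝ L ≤ 2 := by
    classical
    refine (Submodule.finrank_mono hle).trans ((finrank_span_le_card _).trans ?_)
    rw [show ({B, iota n} : Set (Matrix (Fin 3) (Fin 3) ℝ)).toFinset = {B, iota n} by simp]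
    exact Finset.card_le_two
  have hn0 : n 0 ^ 2 + n 1 ^ 2 + n 2 ^ 2 ≠ 0 := fun h => hn (by
    funext i
    have : n i ^ 2 ≤ 0 := by
      fin_cases i <;> simp only [Fin.zero_eta, Fin.mk_one, Fin.reduceFinMk] <;>
        linarith [sq_nonneg (n 0), sq_nonneg (n 1), sq_nonneg (n 2)]
    exact pow_eq_zero_iff two_ne_zero |>.mp (le_antisymm this (sq_nonneg _)))
  -- Chosen so that `B + s • iota n` has no component along `iota n`, which is the normalisation
  -- under which a nonzero matrix over a special kernel is non-singular.
  set s := - (B 2 1 * n 0 + B 0 2 * n 1 + B 1 0 * n 2) / (n 0 ^ 2 + n 1 ^ 2 + n 2 ^ 2) with hs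
  have hM : B + s • iota n ∈ L := L.add_mem hB (L.smul_mem s hi)
  have hM0 : B + s • iota n ≠ 0 := fun h => hBd (by
    have h00 := congrFun (congrFun h 0) 0
    have h22 := congrFun (congrFun h 2) 2
    simp [iota] at h00 h22
    exact ⟨h00, h22⟩)
  obtain ⟨hns, hker⟩ := isNonsingularPoint_of_special hn hsq (hL hM) hM0 (by
    simp [iota]
    rw [hs]
    field_simp
    ring)
  have hline : IsStaeckelLine (Submodule.span ℝ {B + s • iota n, iota n, nu n}) :=
    ⟨_, n, hns, hker, rfl⟩
  rwa [← Submodule.eq_of_le_of_finrank_le (S₁ := Submodule.span ℝ {B + s • iota n, iota n, nu n})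
    (S₂ := L) _ (by rw [hline.finrank_eq_two]; exact hle2)]
  rw [span_triple_eq_of_special _ hsq, Submodule.span_le]
  rintro _ (rfl | rfl)
  exacts [hM, hi]

end SpacesOfMatrices

/-! ### From diagonal Stäckel systems to Stäckel lines -/

section SystemsToLines

variable {V : Type*} [NormedAddCommGroup V] [InnerProductSpace ℝ V]

/-- Both Weyl parts of a diagonal tensor contain the diagonal of its matrix, so the first Weyl
relation between two members says that their matrices have proportional diagonals. -/
theorem weyl_diagTensor (e : OrthonormalBasis (Fin 4) ℝ V) (k : Fin 6 → ℝ) :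
    weylPlus (pairMatrix e (diagTensor e k)) 3 = 2 * paramMatrix k 2 2 ∧
    weylPlus (pairMatrix e (diagTensor e k)) 4 = 2 * paramMatrix k 0 0 ∧
    weylMinus (pairMatrix e (diagTensor e k)) 3 = 2 * paramMatrix k 2 2 ∧
    weylMinus (pairMatrix e (diagTensor e k)) 4 = 2 * paramMatrix k 0 0 := by
  have h1 : pairMatrix e (diagTensor e k) 0 3 = 0 :=
    isDiagonal_diagTensor e k _ _ _ _ (by rw [Ne, Set.pair_eq_pair_iff]; decide)
  have h2 : pairMatrix e (diagTensor e k) 1 4 = 0 :=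
    isDiagonal_diagTensor e k _ _ _ _ (by rw [Ne, Set.pair_eq_pair_iff]; decide)
  simp only [weylPlus, weylMinus, Matrix.cons_val, pairMatrix_diagTensor, h1, h2, paramMatrix,
    LinearMap.coe_mk, AddHom.coe_mk, Matrix.of_apply]
  refine ⟨?_, ?_, ?_, ?_⟩ <;> ring

variable [Fact (finrank ℝ V = 3 + 1)]

/-- The Stäckel line of a Stäckel system with diagonal curvature tensors. -/
theorem IsStaeckelSystem.exists_isStaeckelLine {S : Submodule ℝ (EndField V)}
    (hS : IsStaeckelSystem S) {e : OrthonormalBasis (Fin 4) ℝ V} (hd : ∀ K ∈ S, HasDiagonalCurv e K) :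
    IsStaeckelLine ((S.comap (diagField e)).map paramMatrix) ∧
      (((S.comap (diagField e)).map paramMatrix).comap paramMatrix).map (diagField e) = S := by
  set T := S.comap (diagField e) with hT
  have hmap : T.map (diagField e) = S := by
    rw [hT, Submodule.map_comap_eq, inf_eq_right]
    intro K hK
    obtain ⟨R, hR, hdR⟩ := hd K hK
    obtain ⟨k, rfl, -⟩ := hR.exists_eq_diagField (hS.killing K hK).1 hdR
    exact ⟨k, rfl⟩
  have hfT : finrank ℝ T = 3 := by
    rw [← hS.finrank_eq, ← hmap]
    exact (Submodule.equivMapOfInjective _ (diagField_injective e) T).finrank_eq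
  have h2 : 2 ≤ finrank ℝ (T.map paramMatrix) := by
    have := finrank_le_finrank_map_paramMatrix T
    omega
  have hle : T.map paramMatrix ≤ ksSubmodule := by
    rw [← range_paramMatrix]
    exact LinearMap.map_le_range
  have hdiag : ∀ A ∈ T.map paramMatrix, ∀ B ∈ T.map paramMatrix,
      A 0 0 * B 2 2 = B 0 0 * A 2 2 := by
    rintro _ ⟨k, hk, rfl⟩ _ ⟨k', hk', rfl⟩
    have h := (hS.weyl hk hk' (isCurvOf_diagField e k) (isCurvOf_diagField e k') e).1 4 3
    rw [(weyl_diagTensor e k).2.1, (weyl_diagTensor e k').2.1, (weyl_diagTensor e k).2.2.1,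
      (weyl_diagTensor e k').2.2.1] at h
    linarith
  obtain ⟨n, hn, hi⟩ := exists_iota_mem hle h2 hdiag
  have hiso : T.map paramMatrix ≤ isokernel n := by
    obtain ⟨k, hk, hkn⟩ := hi
    rintro _ ⟨k', hk', rfl⟩
    refine mem_isokernel_of_vecMul_eq hn (paramMatrix_mem k') ?_
    rw [← hkn]
    exact (paramCommute_iff k k').mp (curvCommute_of_commute (isSymField_diagField e k)
      (isCurvOf_diagField e k) (isSymField_diagField e k') (isCurvOf_diagField e k')
      (hS.commute _ hk _ hk')).paramCommute
  have hline := isStaeckelLine_of_le_isokernel hn hiso hi h2 hdiag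
  refine ⟨hline, ?_⟩
  -- The full preimage of the line has dimension `2 + 1` and contains `T`, which has dimension
  -- three, so the two coincide.
  have := FiniteDimensional.finiteDimensional_submodule ((T.map paramMatrix).comap paramMatrix)
  rw [← Submodule.eq_of_le_of_finrank_eq (Submodule.le_comap_map paramMatrix T), hmap]
  rw [finrank_comap_paramMatrix hle, hline.finrank_eq_two, hfT]

/-- A Stäckel line lies in the range of `paramMatrix`, so it is the image of its own preimage. -/
theorem IsStaeckelLine.eq_of_ksPreimage_eq {L L' : Submodule ℝ (Matrix (Fin 3) (Fin 3) ℝ)}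
    (hL : IsStaeckelLine L) (hL' : IsStaeckelLine L') {e : OrthonormalBasis (Fin 4) ℝ V}
    (h : ksPreimage e L = ksPreimage e L') : L = L' := by
  rw [← hL.ksPreimage_eq, ← hL'.ksPreimage_eq, SetLike.coe_set_eq] at h
  have h1 := Submodule.map_injective_of_injective (diagField_injective e) h
  have key : ∀ {M : Submodule ℝ (Matrix (Fin 3) (Fin 3) ℝ)}, M ≤ ksSubmodule →
      (M.comap paramMatrix).map paramMatrix = M := fun hM => by
    rw [Submodule.map_comap_eq, range_paramMatrix, inf_eq_right.mpr hM]
  rw [← key hL.le_ksSubmodule, h1, key hL'.le_ksSubmodule]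

end SystemsToLines

end KSVariety

theorem corollary9 {V : Type*} [NormedAddCommGroup V] [InnerProductSpace ℝ V]
    [Fact (Module.finrank ℝ V = 3 + 1)] :
    (∀ (e : OrthonormalBasis (Fin 4) ℝ V) (L : Submodule ℝ (Matrix (Fin 3) (Fin 3) ℝ)),
      IsStaeckelLine L →
        ∃ S : Submodule ℝ (EndField V), (S : Set (EndField V)) = ksPreimage e L ∧
          IsStaeckelSystem S) ∧
    (∀ (e : OrthonormalBasis (Fin 4) ℝ V) (S : Submodule ℝ (EndField V)),
      IsStaeckelSystem S → (∀ K ∈ S, HasDiagonalCurv e K) →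
        ∃! L : Submodule ℝ (Matrix (Fin 3) (Fin 3) ℝ),
          IsStaeckelLine L ∧ (S : Set (EndField V)) = ksPreimage e L) ∧
    (∀ S : Submodule ℝ (EndField V), IsStaeckelSystem S →
      ∃ e : OrthonormalBasis (Fin 4) ℝ V, ∀ K ∈ S, HasDiagonalCurv e K) := by
  refine ⟨fun e L hL => ⟨_, hL.ksPreimage_eq e, hL.isStaeckelSystem e⟩, fun e S hS hd => ?_,
    fun S hS => hS.exists_diagonal⟩
  obtain ⟨hline, hSL⟩ := hS.exists_isStaeckelLine hd
  have hpre := hline.ksPreimage_eq e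
  rw [hSL] at hpre
  exact ⟨_, ⟨hline, hpre⟩, fun L' ⟨hL', h'⟩ => hL'.eq_of_ksPreimage_eq hline (h'.symm.trans hpre)⟩
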